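/- **Setting.** Let $n\ge 1$. For $U,V\subset\mathbf R^n$ and a cost $c$ consider the conditions, for all $(\tilde x,\bar y)\in\overline U\times\overline V$: * (B0) $U,V$ are open and bounded and $c\in C^4(\overline U\times\overline V)$ (i.e. $c$ is $C^4$ in a neighbourhood of each point of $\overline U\times\overline V$); * (B1) $x\in\overline U\mapsto -D_yc(x,\bar y)$ and $y\in\overline V\mapsto -D_xc(\tilde x,y)$ are diffeomorphisms onto their ranges; * (B2) $U_{\bar y}:=-D_yc(U,\bar y)$ and $V_{\tilde x}:=-D_xc(\tilde x,V)$ are convex; * (B3) for all curves $x(\cdot)$ in $\overline U$ and $y(\cdot)$ in $\overline V$ on $[-1,1]$ such that $t\mapsto (D_yc(x(t),y(0)),D_xc(x(0),y(t)))$ is an affinely parameterized line segment, $\frac{\partial^2}{\partial s\partial t}\big|_{(0,0)}c(x(s),y(t))=0$ implies $-\frac{\partial^4}{\partial s^2\partial t^2}\big|_{(0,0)}c(x(s),y(t))\ge 0$. For $\bar y\in\overline V$ let $q\in\overline{U_{\bar y}}\mapsto x(q)\in\overline U$ be the inverse of $x\mapsto -D_yc(x,\bar y)$, and let $\tilde c(q,y):=c(x(q),y)-c(x(q),\bar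 y)$ be the modified cost on $\overline{U_{\bar y}}\times\overline V$. A function $\tilde u:\overline{U_{\bar y}}\to\mathbf R$ is $\tilde c$-convex if $\tilde u(q)=\sup_{y\in\overline V}\big(-\tilde c(q,y)-\tilde u^{*}(y)\big)$ for all $q$, where $\tilde u^{*}(y)=\sup_{q\in\overline{U_{\bar y}}}\big(-\tilde c(q,y)-\tilde u(q)\big)$; all suprema are finite. Put $\partial^{\tilde c}\tilde u(q)=\{y\in\overline V:\tilde u(q)+\tilde u^{*}(y)+\tilde c(q,y)=0\}$ and $|\partial^{\tilde c}\tilde u|(X)=\mathcal L^n\big(\bigcup_{q\in X}\partial^{\tilde c}\tilde u(q)\big)$. Finally $\gamma^{+}_{\tilde c}=\gamma^+_{\tilde c}(Q\times V):=\|\det D^2_{qy}\tilde c\|_{L^\infty(Q\times V)}$ and $\gamma_c^{\pm}:=\|\det (D^2_{xy}c)^{\pm1}\|_{L^\infty(U\times V)}$. **Theorem (Alexandrov type upper bound).** For every $n\ge1$ there is a constant $C(n)>0$, depending only on $n$, such that for all $U,V,c$ satisfying (B0)–(B3) there is $\varepsilon>0$, depending only on $n$ and the cost $c$ (with its domain $U\times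 V$), with the following property. Let $\bar y\in\overline V$, let $\tilde u:\overline{U_{\bar y}}\to\mathbf R$ be $\tilde c$-convex, let $\lambda>0$ and $Q:=\{q\in\overline{U_{\bar y}}:\tilde u(q)\le0\}$. Assume that $\tilde u=0$ on $\partial Q$, that $|\partial^{\tilde c}\tilde u|(X)\le\frac1\lambda\mathcal L^n(X)$ for every Borel set $X\subset Q$, that there is a ball $B$ with $Q\subset B\subset 4\cdot B\subset U_{\bar y}$ ($4\cdot B$ being the ball with the same centre and four times the radius), and that $\operatorname{diam}(Q)\le\varepsilon$. Then: 1. for every ellipsoid $E$ with $E\subset Q\subset n\cdot E$ (dilation about the centre of $E$), every $t$ with $\frac1{2n}<t\le1$ and every $q_t\in Q$ belonging to the dilation $t\cdot\partial Q$ of $\partial Q$ by the factor $t$ about the centre of $E$, $$|\tilde u(q_t)|^n\le C(n)\,\frac{\gamma^+_{\tilde c}}{\lambda}\,(1-t)^{1/2^{n-1}}\,\mathcal L^n(Q)^2;$$ 2. $$\big|\inf_Q\tilde u\big|^n\le C(n)\,\frac{\gamma^+_{\tilde c}}{\lambda}\,\mathcal L^n(Q)^2$$ (for $Q=\emptyset$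 the left side is read as $0$); 3. $\gamma^+_{\tilde c}\le\gamma^+_c\,\gamma^-_c$. -/

import Mathlib

open MeasureTheory Set
open scoped ENNReal

/-- Euclidean space `ℝⁿ`; cotangent vectors are identified with vectors by the inner product. -/
abbrev Euc (n : ℕ) : Type := EuclideanSpace ℝ (Fin n)

namespace OT

variable {n : ℕ}

noncomputable section

/-- `D_x c (x, y)`. -/
def gradX (c : Euc n → Euc n → ℝ) (x y : Euc n) : Euc n :=
  gradient (fun x' => c x' y) x

/-- `D_y c (x, y)`. -/
def gradY (c : Euc n → Euc n → ℝ) (x y : Euc n) : Euc n :=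
  gradient (fun y' => c x y') y

/-- `D²_{xy} c (x, y)`, the derivative in `x` of `D_y c`. -/
def mixedHess (c : Euc n → Euc n → ℝ) (x y : Euc n) : Euc n →L[ℝ] Euc n :=
  fderiv ℝ (fun x' => gradY c x' y) x

/-- The map `x ↦ -D_y c (x, ȳ)` (cost exponential coordinates `q` from `ȳ`). -/
def qMap (c : Euc n → Euc n → ℝ) (ybar : Euc n) (x : Euc n) : Euc n :=
  -gradY c x ybar

/-- The map `y ↦ -D_x c (x̄, y)` (cost exponential coordinates `p` from `x̄`). -/
def pMap (c : Euc n → Euc n → ℝ) (xbar : Euc n) (y : Euc n) : Euc n :=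
  -gradX c xbar y

/-- `f` restricted to `s` is a diffeomorphism onto its range. As usual for a set that need not be
open, differentiability on `s` and on `f '' s` refers to a neighbourhood. -/
def IsDiffeoOntoRange (f : Euc n → Euc n) (s : Set (Euc n)) : Prop :=
  (∀ x ∈ s, ContDiffAt ℝ 1 f x) ∧
    ∃ g : Euc n → Euc n, (∀ x ∈ s, g (f x) = x) ∧ ∀ x ∈ s, ContDiffAt ℝ 1 g (f x)

/-- (B0): `U`, `V` are open and bounded, `c ∈ C⁴` on `Ū × V̄`. -/
structure B0 (U V : Set (Euc n)) (c : Euc n → Euc n → ℝ) : Prop where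
  isOpen_left : IsOpen U
  isOpen_right : IsOpen V
  isBounded_left : Bornology.IsBounded U
  isBounded_right : Bornology.IsBounded V
  contDiff : ∀ x ∈ closure U, ∀ y ∈ closure V, ContDiffAt ℝ 4 (Function.uncurry c) (x, y)

/-- (B1), bi-twist. -/
structure B1 (U V : Set (Euc n)) (c : Euc n → Euc n → ℝ) : Prop where
  left : ∀ y ∈ closure V, IsDiffeoOntoRange (qMap c y) (closure U)
  right : ∀ x ∈ closure U, IsDiffeoOntoRange (pMap c x) (closure V)

/-- (B2), bi-convexity of the domains. -/
structure B2 (U V : Set (Euc n)) (c : Euc n → Euc n → ℝ) : Prop where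
  left : ∀ y ∈ closure V, Convex ℝ (qMap c y '' U)
  right : ∀ x ∈ closure U, Convex ℝ (pMap c x '' V)

/-- `γ` is an affinely parameterized line segment on `[-1, 1]`. -/
def IsAffineSegment (γ : ℝ → Euc n) : Prop :=
  ∃ a v : Euc n, ∀ t ∈ Icc (-1 : ℝ) 1, γ t = a + t • v

/-- (B3), the weak Ma–Trudinger–Wang condition (A3w). -/
def B3 (U V : Set (Euc n)) (c : Euc n → Euc n → ℝ) : Prop :=
  ∀ x y : ℝ → Euc n,
    (∀ t ∈ Icc (-1 : ℝ) 1, x t ∈ closure U) →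
    (∀ t ∈ Icc (-1 : ℝ) 1, y t ∈ closure V) →
    IsAffineSegment (fun t => gradY c (x t) (y 0)) →
    IsAffineSegment (fun t => gradX c (x 0) (y t)) →
    deriv (fun s => deriv (fun t => c (x s) (y t)) 0) 0 = 0 →
    0 ≤ -iteratedDeriv 2 (fun s => iteratedDeriv 2 (fun t => c (x s) (y t)) 0) 0

/-- The domain `U_ȳ = -D_y c (U, ȳ)`. -/
def coordDomain (c : Euc n → Euc n → ℝ) (U : Set (Euc n)) (ybar : Euc n) : Set (Euc n) :=
  qMap c ybar '' U

/-- The inverse `q ↦ x(q)` of `x ∈ Ū ↦ -D_y c (x, ȳ)`. -/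
def xOf (c : Euc n → Euc n → ℝ) (U : Set (Euc n)) (ybar q : Euc n) : Euc n :=
  Function.invFunOn (qMap c ybar) (closure U) q

/-- The modified cost `c̃(q, y) = c(x(q), y) - c(x(q), ȳ)` at `ȳ`. -/
def modCost (c : Euc n → Euc n → ℝ) (U : Set (Euc n)) (ybar : Euc n) (q y : Euc n) : ℝ :=
  c (xOf c U ybar q) y - c (xOf c U ybar q) ybar

/-- The transform `u^{c*}(y) = sup_{x ∈ X} (-c(x, y) - u(x))`. -/
def cStar (X : Set (Euc n)) (c : Euc n → Euc n → ℝ) (u : Euc n → ℝ) (y : Euc n) : ℝ :=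
  sSup ((fun x => -c x y - u x) '' X)

/-- `u : X → ℝ` is `c`-convex with respect to `Y`, i.e. `u = (u^{c*})^c` on `X`,
all the suprema being finite. -/
def IsCConvex (X Y : Set (Euc n)) (c : Euc n → Euc n → ℝ) (u : Euc n → ℝ) : Prop :=
  (∀ y ∈ Y, BddAbove ((fun x => -c x y - u x) '' X)) ∧
    ∀ x ∈ X, IsLUB ((fun y => -c x y - cStar X c u y) '' Y) (u x)

/-- The `c`-subdifferential `∂^c u(x)`. -/
def cSubdiff (X Y : Set (Euc n)) (c : Euc n → Euc n → ℝ) (u : Euc n → ℝ) (x : Euc n) :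
    Set (Euc n) :=
  {y | x ∈ X ∧ y ∈ Y ∧ u x + cStar X c u y + c x y = 0}

/-- The `c`-Monge–Ampère measure `|∂^c u|(S) = ℒⁿ(∂^c u(S))`. -/
def cMongeAmpere (X Y : Set (Euc n)) (c : Euc n → Euc n → ℝ) (u : Euc n → ℝ)
    (S : Set (Euc n)) : ℝ≥0∞ :=
  volume (⋃ x ∈ S, cSubdiff X Y c u x)

/-- `γ⁺_c(A × B) = ‖det D²_{xy} c‖` in `L^∞(A × B)`. -/
def gammaPlus (c : Euc n → Euc n → ℝ) (A B : Set (Euc n)) : ℝ :=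
  (eLpNorm (fun z : Euc n × Euc n => (mixedHess c z.1 z.2).det) ∞
    (volume.restrict (A ×ˢ B))).toReal

/-- `γ⁻_c(A × B) = ‖det (D²_{xy} c)⁻¹‖` in `L^∞(A × B)`. -/
def gammaMinus (c : Euc n → Euc n → ℝ) (A B : Set (Euc n)) : ℝ :=
  (eLpNorm (fun z : Euc n × Euc n => ((mixedHess c z.1 z.2).det)⁻¹) ∞
    (volume.restrict (A ×ˢ B))).toReal

/-- The sublevel set `{u ≤ 0}` of a function `u` on `X`. -/
def zeroSection (X : Set (Euc n)) (u : Euc n → ℝ) : Set (Euc n) :=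
  {q ∈ X | u q ≤ 0}

/-- The ellipsoid `E = L(B̄₁)`, with centre `L 0`, satisfies `E ⊆ Q ⊆ n · E` (the dilation being
about the centre of `E`), as in John's lemma. -/
def IsJohnEllipsoid (L : Euc n ≃ᵃ[ℝ] Euc n) (Q : Set (Euc n)) : Prop :=
  L '' Metric.closedBall 0 1 ⊆ Q ∧
    Q ⊆ AffineMap.homothety (L 0) (n : ℝ) '' (L '' Metric.closedBall 0 1)

end

end OT

/-!
The height of `u` below zero at a point `q₁` of the section `Q` is measured by a cone. Let `F` be the
negative of the modified cost, `F = -c̃`, so that `F (·, ȳ) = 0`, and consider all `y` for which the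
translate of `F (·, y)` with value `u q₁` at `q₁` is nonpositive on `Q` (`coneSupports`). Such a
function slides down until it touches the graph of `u` at a point of `Q`, so these `y` lie in
`∂u(Q)` and fill at most the volume `|Q| / λ` (`CostChart.coneSupports_subset`). Their gradients
`∇_q F (q₁, y)` therefore fill at most the volume `γ⁺ |Q| / λ`
(`RegCost.volume_grad_coneSupports_le`). On the other hand the set of gradients is convex, contains
`0`, and for each unit vector `e` contains a vector nearly parallel to `e` of length at least
`|u q₁| / (2 d)`, where `d` is the width of `Q` beyond `q₁` in the direction `e`
(`CostChart.exists_coneSupport_direction`). For `n` directions whose determinant is bounded below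
this gives `|u q₁| ^ n ≤ C (∏ dᵢ) γ⁺ |Q| / λ` (`exists_height_estimate`).

That `u` has global supports of this kind although the cost is not bilinear is due to Loeper's
maximum principle (`RegCost.maximum_principle` and its dual): in the coordinates at `ȳ` the
functions `F (·, y)` are quasi-convex, so sections are convex, and along a segment of gradients the
differences of `F` are bounded by their values at the ends, so that subdifferentials are convex and
local supports are global. The maximum principle follows from (B3) in the quantitative form that for
arbitrary directions `ξ`, `η` the cross-curvature is bounded below by
`-K |∂_s ∂_t c| |ξ| |η|` (`RegCost.exists_crossCurvatureBound`): for a segment `x(s)` the function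
`f(s) = c(x(s), y₀) - c(x(s), y₁)` then satisfies `f'' ≥ -K |f'|`, which excludes interior maxima.
The length `ε` is chosen such that `∇_q F (q, y)` changes little, relative to its own size, when `q`
varies in `Q` (`RegCost.exists_chartGrad_oscillation`); this makes the gradient at `q₁` nearly
parallel to the normal of the supporting hyperplane of `Q` from which it comes.

The bound for the infimum uses the axes of a box around `Q` of comparable volume, for which
`∏ dᵢ ≤ C |Q|`. Near the boundary one axis is exchanged for a better direction. If `q₁` is obtained
from `q₀ ∈ ∂Q` by a contraction `t = 1 - τ` towards the centre of the ellipsoid, the normal of `Q` at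
`q₀`, truncated to those coordinates that stand above a gap in the scale of powers of `τ ^ (1 / n)`,
is a direction in which `Q` extends beyond `q₁` by at most `C τ ^ (1 / n)` times the length of one
of the axes, the one along which the truncated normal is largest (`exists_tilted_normal`). Replacing
that axis gains the factor `τ ^ (1 / n) ≤ τ ^ (1 / 2 ^ (n - 1))`.
-/

open scoped Topology InnerProductSpace

namespace OT

variable {n : ℕ}

noncomputable section

/-! ### Derivatives of the cost -/

/-- The `k`-th derivative of the cost, as a function on `ℝⁿ × ℝⁿ`, at `(x, y)` in the directions `v`.
Partial derivatives have the directions `(ξ, 0)` and `(0, η)`. -/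
def jet (c : Euc n → Euc n → ℝ) (k : ℕ) (x y : Euc n) (v : Fin k → Euc n × Euc n) : ℝ :=
  iteratedFDeriv ℝ k (Function.uncurry c) (x, y) v

/-- The cost with the roles of the two variables exchanged. -/
def flipCost (c : Euc n → Euc n → ℝ) : Euc n → Euc n → ℝ := fun y x => c x y

theorem jet_flipCost (c : Euc n → Euc n → ℝ) (k : ℕ) (x y : Euc n) (v : Fin k → Euc n × Euc n) :
    jet (flipCost c) k y x v = jet c k x y (fun i => (v i).swap) := by
  have h := (ContinuousLinearEquiv.prodComm ℝ (Euc n) (Euc n)).iteratedFDerivWithin_comp_right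
    (Function.uncurry c) (s := univ) uniqueDiffOn_univ (x := (y, x)) (mem_univ _) k
  simp only [preimage_univ, iteratedFDerivWithin_univ] at h
  have e : Function.uncurry c ∘ (ContinuousLinearEquiv.prodComm ℝ (Euc n) (Euc n)) =
    Function.uncurry (flipCost c) := by ext ⟨a, b⟩; rfl
  rw [e] at h
  unfold jet
  rw [h]; rfl

section jets
variable {F : Type*} [NormedAddCommGroup F] [NormedSpace ℝ F]

theorem iteratedFDeriv_cons_eq {f : F → ℝ} {z : F} {k : ℕ} (hf : ContDiffAt ℝ 4 f z)
    (hk : k + 1 ≤ 4) (v : Fin k → F) (a : F) :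
    iteratedFDeriv ℝ (k + 1) f z (Fin.cons a v) =
      fderiv ℝ (fun w => iteratedFDeriv ℝ k f w v) z a := by
  have hd : DifferentiableAt ℝ (iteratedFDeriv ℝ k f) z :=
    hf.differentiableAt_iteratedFDeriv (by exact_mod_cast hk)
  rw [iteratedFDeriv_succ_apply_left]
  simp only [Fin.cons_zero, Fin.tail_cons]
  have := ((ContinuousMultilinearMap.apply ℝ (fun _ : Fin k => F) ℝ v).hasFDerivAt.comp z
    hd.hasFDerivAt).fderiv
  erw [this]; rfl

theorem iteratedFDeriv_cons_congr {f : F → ℝ} {z : F} {k : ℕ} (hf : ContDiffAt ℝ 4 f z)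
    (hk : k + 1 ≤ 4) {v v' : Fin k → F}
    (h : ∀ᶠ w in 𝓝 z, iteratedFDeriv ℝ k f w v = iteratedFDeriv ℝ k f w v') (a : F) :
    iteratedFDeriv ℝ (k + 1) f z (Fin.cons a v) = iteratedFDeriv ℝ (k + 1) f z (Fin.cons a v') := by
  rw [iteratedFDeriv_cons_eq hf hk, iteratedFDeriv_cons_eq hf hk, Filter.EventuallyEq.fderiv_eq h]

theorem contDiffAt_iteratedFDeriv_apply {f : F → ℝ} {z : F} {k : ℕ} (hf : ContDiffAt ℝ 4 f z)
    (hk : k + 2 ≤ 4) (v : Fin k → F) : ContDiffAt ℝ 2 (fun w => iteratedFDeriv ℝ k f w v) z := by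
  have : ContDiffAt ℝ 2 (iteratedFDeriv ℝ k f) z :=
    hf.iteratedFDeriv_right (by norm_cast; omega)
  exact (ContinuousMultilinearMap.apply ℝ (fun _ : Fin k => F) ℝ v).contDiff.contDiffAt.comp z this

theorem iteratedFDeriv_cons_cons_eq {f : F → ℝ} {z : F} {k : ℕ} (hf : ContDiffAt ℝ 4 f z)
    (hk : k + 2 ≤ 4) (v : Fin k → F) (a b : F) :
    iteratedFDeriv ℝ (k + 2) f z (Fin.cons a (Fin.cons b v)) =
      fderiv ℝ (fderiv ℝ (fun w => iteratedFDeriv ℝ k f w v)) z a b := by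
  have hev : ∀ᶠ w in 𝓝 z, iteratedFDeriv ℝ (k + 1) f w (Fin.cons b v) =
      fderiv ℝ (fun w => iteratedFDeriv ℝ k f w v) w b := by
    filter_upwards [hf.eventually (by simp)] with w hw
    exact iteratedFDeriv_cons_eq hw (by omega) v b
  rw [iteratedFDeriv_cons_eq hf hk, Filter.EventuallyEq.fderiv_eq hev]
  have hd2 : DifferentiableAt ℝ (fderiv ℝ (fun w => iteratedFDeriv ℝ k f w v)) z :=
    ((contDiffAt_iteratedFDeriv_apply hf hk v).fderiv_right (m := 1)
      (by norm_num)).differentiableAt (by norm_num)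
  rw [fderiv_clm_apply hd2 (differentiableAt_const b)]
  simp

theorem iteratedFDeriv_swap_first {f : F → ℝ} {z : F} {k : ℕ} (hf : ContDiffAt ℝ 4 f z)
    (hk : k + 2 ≤ 4) (v : Fin k → F) (a b : F) :
    iteratedFDeriv ℝ (k + 2) f z (Fin.cons a (Fin.cons b v)) =
      iteratedFDeriv ℝ (k + 2) f z (Fin.cons b (Fin.cons a v)) := by
  rw [iteratedFDeriv_cons_cons_eq hf hk, iteratedFDeriv_cons_cons_eq hf hk]
  exact (contDiffAt_iteratedFDeriv_apply hf hk v).isSymmSndFDerivAt (by simp) a b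

theorem hasDerivAt_fderiv_apply {G : Type*} [NormedAddCommGroup G] [NormedSpace ℝ G] {φ : F → G}
    {Z W : ℝ → F} {Z' W' : F} {s : ℝ}
    (hφ : ContDiffAt ℝ 2 φ (Z s)) (hZ : HasDerivAt Z Z' s) (hW : HasDerivAt W W' s) :
    HasDerivAt (fun r => fderiv ℝ φ (Z r) (W r))
      (fderiv ℝ (fderiv ℝ φ) (Z s) Z' (W s) + fderiv ℝ φ (Z s) W') s := by
  have hd1 : HasFDerivAt (fderiv ℝ φ) (fderiv ℝ (fderiv ℝ φ) (Z s)) (Z s) :=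
    ((hφ.fderiv_right (m := 1) (by norm_num)).differentiableAt (by norm_num)).hasFDerivAt
  exact (hd1.comp_hasDerivAt s hZ).clm_apply hW

end jets

variable {c : Euc n → Euc n → ℝ} {x y : Euc n}

/-- Derivative of a partial derivative of the cost along a curve, the first direction being allowed
to move with the curve. -/
theorem jet_hasDerivAt_cons {k : ℕ} {X Y : ℝ → Euc n} {W : ℝ → Euc n × Euc n}
    {X' Y' : Euc n} {W' : Euc n × Euc n} {s : ℝ}
    (hc : ContDiffAt ℝ 4 (Function.uncurry c) (X s, Y s)) (hk : k + 2 ≤ 4)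
    (hX : HasDerivAt X X' s) (hY : HasDerivAt Y Y' s) (hW : HasDerivAt W W' s)
    (v : Fin k → Euc n × Euc n) :
    HasDerivAt (fun r => jet c (k + 1) (X r) (Y r) (Fin.cons (W r) v))
      (jet c (k + 2) (X s) (Y s) (Fin.cons (X', Y') (Fin.cons (W s) v)) +
        jet c (k + 1) (X s) (Y s) (Fin.cons W' v)) s := by
  unfold jet
  rw [iteratedFDeriv_cons_cons_eq hc hk, iteratedFDeriv_cons_eq hc (by omega)]
  have hφ := contDiffAt_iteratedFDeriv_apply hc hk v
  have hev : ∀ᶠ r in 𝓝 s, iteratedFDeriv ℝ (k + 1) (Function.uncurry c) (X r, Y r)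
      (Fin.cons (W r) v) =
      fderiv ℝ (fun w => iteratedFDeriv ℝ k (Function.uncurry c) w v) (X r, Y r) (W r) := by
    filter_upwards [(hX.continuousAt.prodMk hY.continuousAt).eventually
      (hc.eventually (by simp))] with r hr
    exact iteratedFDeriv_cons_eq hr (by omega) v _
  refine HasDerivAt.congr_of_eventuallyEq ?_ hev
  exact hasDerivAt_fderiv_apply hφ (hX.prodMk hY) hW

theorem jet_hasDerivAt {k : ℕ} {X Y : ℝ → Euc n} {X' Y' : Euc n} {s : ℝ}
    (hc : ContDiffAt ℝ 4 (Function.uncurry c) (X s, Y s)) (hk : k + 1 ≤ 4)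
    (hX : HasDerivAt X X' s) (hY : HasDerivAt Y Y' s) (v : Fin k → Euc n × Euc n) :
    HasDerivAt (fun r => jet c k (X r) (Y r) v)
      (jet c (k + 1) (X s) (Y s) (Fin.cons (X', Y') v)) s := by
  have hd : HasFDerivAt (iteratedFDeriv ℝ k (Function.uncurry c)) _ (X s, Y s) :=
    (hc.differentiableAt_iteratedFDeriv (m := k) (by norm_cast)).hasFDerivAt
  have hd' := hd.comp_hasDerivAt s (hX.prodMk hY)
  exact (ContinuousMultilinearMap.apply ℝ (fun _ : Fin k => Euc n × Euc n) ℝ v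
    ).hasFDerivAt.comp_hasDerivAt s hd'

theorem jet_one (v : Euc n × Euc n) :
    jet c 1 x y ![v] = fderiv ℝ (Function.uncurry c) (x, y) v := by
  simp [jet, iteratedFDeriv_one_apply]

theorem jet_two_comm (hc : ContDiffAt ℝ 4 (Function.uncurry c) (x, y)) (a b : Euc n × Euc n) :
    jet c 2 x y ![a, b] = jet c 2 x y ![b, a] :=
  iteratedFDeriv_swap_first hc (by norm_num) ![] a b

theorem jet_three_swap (hc : ContDiffAt ℝ 4 (Function.uncurry c) (x, y)) (a b d : Euc n × Euc n) :
    jet c 3 x y ![a, b, d] = jet c 3 x y ![b, a, d] :=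
  iteratedFDeriv_swap_first hc (by norm_num) ![d] a b

theorem jet_three_swap' (hc : ContDiffAt ℝ 4 (Function.uncurry c) (x, y)) (a b d : Euc n × Euc n) :
    jet c 3 x y ![a, b, d] = jet c 3 x y ![a, d, b] := by
  refine iteratedFDeriv_cons_congr hc (by norm_num) ?_ a
  filter_upwards [hc.eventually (by simp)] with w hw
  exact iteratedFDeriv_swap_first hw (by norm_num) ![] b d

theorem jet_four_swap (hc : ContDiffAt ℝ 4 (Function.uncurry c) (x, y))
    (a b d e : Euc n × Euc n) :
    jet c 4 x y ![a, b, d, e] = jet c 4 x y ![b, a, d, e] :=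
  iteratedFDeriv_swap_first hc (by norm_num) ![d, e] a b

theorem jet_four_swap' (hc : ContDiffAt ℝ 4 (Function.uncurry c) (x, y))
    (a b d e : Euc n × Euc n) :
    jet c 4 x y ![a, b, d, e] = jet c 4 x y ![a, d, b, e] := by
  refine iteratedFDeriv_cons_congr hc (by norm_num) ?_ a
  filter_upwards [hc.eventually (by simp)] with w hw
  exact iteratedFDeriv_swap_first hw (by norm_num) ![e] b d

theorem jet_four_swap'' (hc : ContDiffAt ℝ 4 (Function.uncurry c) (x, y))
    (a b d e : Euc n × Euc n) :
    jet c 4 x y ![a, b, d, e] = jet c 4 x y ![a, b, e, d] := by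
  refine iteratedFDeriv_cons_congr hc (by norm_num) ?_ a
  filter_upwards [hc.eventually (by simp)] with w hw
  exact jet_three_swap' (x := w.1) (y := w.2) hw b d e

theorem jet_four_pairs (hc : ContDiffAt ℝ 4 (Function.uncurry c) (x, y))
    (a b : Euc n × Euc n) :
    jet c 4 x y ![a, a, b, b] = jet c 4 x y ![b, b, a, a] := by
  rw [jet_four_swap' hc, jet_four_swap hc, jet_four_swap'' hc, jet_four_swap' hc]

theorem inner_gradY (hc : ContDiffAt ℝ 4 (Function.uncurry c) (x, y)) (w : Euc n) :
    ⟪gradY c x y, w⟫_ℝ = jet c 1 x y ![(0, w)] := by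
  have hd : HasFDerivAt (Function.uncurry c) _ (x, y) :=
    (hc.differentiableAt (by norm_num)).hasFDerivAt
  have h2 := (hd.comp y (hasFDerivAt_prodMk_right x y)).fderiv
  rw [gradY, inner_gradient_left, jet_one]
  erw [h2]; simp

theorem inner_gradX (hc : ContDiffAt ℝ 4 (Function.uncurry c) (x, y)) (w : Euc n) :
    ⟪gradX c x y, w⟫_ℝ = jet c 1 x y ![(w, 0)] := by
  have hd : HasFDerivAt (Function.uncurry c) _ (x, y) :=
    (hc.differentiableAt (by norm_num)).hasFDerivAt
  have h2 := (HasFDerivAt.comp (f := fun e => (e, y)) x hd (hasFDerivAt_prodMk_left x y)).fderiv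
  rw [gradX, inner_gradient_left, jet_one]
  erw [h2]; simp

theorem contDiffAt_gradY (hc : ContDiffAt ℝ 4 (Function.uncurry c) (x, y)) :
    ContDiffAt ℝ 3 (fun z : Euc n × Euc n => gradY c z.1 z.2) (x, y) := by
  have h1 : ContDiffAt ℝ 3 (fderiv ℝ (Function.uncurry c)) (x, y) :=
    hc.fderiv_right (by norm_num)
  have h2 : ContDiffAt ℝ 3 (fun z => (InnerProductSpace.toDual ℝ (Euc n)).symm
      ((fderiv ℝ (Function.uncurry c) z).comp (ContinuousLinearMap.inr ℝ (Euc n) (Euc n))))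
      (x, y) :=
    (InnerProductSpace.toDual ℝ (Euc n)).symm.contDiff.contDiffAt.comp _
      (h1.clm_comp contDiffAt_const)
  refine h2.congr_of_eventuallyEq ?_
  filter_upwards [hc.eventually (by simp)] with z hz
  have hd : HasFDerivAt (Function.uncurry c) _ (z.1, z.2) :=
    (hz.differentiableAt (by norm_num)).hasFDerivAt
  have h2 := (hd.comp z.2 (hasFDerivAt_prodMk_right z.1 z.2)).fderiv
  rw [gradY, gradient]
  congr 1

theorem contDiffAt_flipCost (hc : ContDiffAt ℝ 4 (Function.uncurry c) (x, y)) :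
    ContDiffAt ℝ 4 (Function.uncurry (flipCost c)) (y, x) := by
  have : Function.uncurry (flipCost c) = Function.uncurry c ∘ Prod.swap := by
    ext ⟨a, b⟩; rfl
  rw [this]
  exact ContDiffAt.comp (y, x) hc (contDiff_snd.prodMk contDiff_fst).contDiffAt

theorem hasFDerivAt_gradY (hc : ContDiffAt ℝ 4 (Function.uncurry c) (x, y)) :
    HasFDerivAt (fun x' => gradY c x' y) (mixedHess c x y) x := by
  have h := (contDiffAt_gradY hc).comp x (contDiff_prodMk_left y).contDiffAt
  exact (h.differentiableAt (by norm_num)).hasFDerivAt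

theorem inner_mixedHess (hc : ContDiffAt ℝ 4 (Function.uncurry c) (x, y)) (ξ w : Euc n) :
    ⟪mixedHess c x y ξ, w⟫_ℝ = jet c 2 x y ![(ξ, 0), (0, w)] := by
  have hl : HasDerivAt (fun r : ℝ => x + r • ξ) ξ 0 := by
    simpa using ((hasDerivAt_id (0 : ℝ)).smul_const ξ).const_add x
  have h1 : HasDerivAt (fun r : ℝ => ⟪gradY c (x + r • ξ) y, w⟫_ℝ) ⟪mixedHess c x y ξ, w⟫_ℝ 0 := by
    have := (show HasFDerivAt (fun x' => gradY c x' y) (mixedHess c x y) (x + (0 : ℝ) • ξ) by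
      simpa using hasFDerivAt_gradY hc).comp_hasDerivAt (0 : ℝ) hl
    simpa using this.inner ℝ (hasDerivAt_const (0 : ℝ) w)
  have h2 := jet_hasDerivAt (c := c) (k := 1) (X := fun r : ℝ => x + r • ξ) (Y := fun _ => y)
    (s := 0) (by simpa using hc) (by norm_num) hl (hasDerivAt_const _ _) ![(0, w)]
  have h3 := h2.congr_of_eventuallyEq (f₁ := fun r : ℝ => ⟪gradY c (x + r • ξ) y, w⟫_ℝ) ?_
  · have := h1.unique h3
    simpa using this
  · have hcont : Filter.Tendsto (fun r : ℝ => (x + r • ξ, y)) (𝓝 0) (𝓝 (x, y)) := by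
      have : Continuous (fun r : ℝ => (x + r • ξ, y)) := by fun_prop
      simpa using this.tendsto 0
    filter_upwards [hcont.eventually (hc.eventually (by simp))] with r hr
    exact inner_gradY hr w

theorem continuousAt_mixedHess (hc : ContDiffAt ℝ 4 (Function.uncurry c) (x, y)) :
    ContinuousAt (fun z : Euc n × Euc n => mixedHess c z.1 z.2) (x, y) := by
  have h := contDiffAt_gradY hc
  have h1 : ContDiffAt ℝ 2 (fderiv ℝ (fun z : Euc n × Euc n => gradY c z.1 z.2)) (x, y) :=
    h.fderiv_right (by norm_num)
  have h2 : ContinuousAt (fun z => (fderiv ℝ (fun z : Euc n × Euc n => gradY c z.1 z.2) z).comp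
    (ContinuousLinearMap.inl ℝ (Euc n) (Euc n))) (x, y) :=
    h1.continuousAt.clm_comp continuousAt_const
  refine h2.congr ?_
  filter_upwards [hc.eventually (by simp)] with z hz
  have hd : HasFDerivAt (fun z : Euc n × Euc n => gradY c z.1 z.2) _ (z.1, z.2) :=
    ((contDiffAt_gradY hz).differentiableAt (by norm_num)).hasFDerivAt
  exact (HasFDerivAt.comp (f := fun e => (e, z.2)) z.1 hd
    (hasFDerivAt_prodMk_left z.1 z.2)).fderiv.symm

theorem continuousAt_jet {k : ℕ} (hc : ContDiffAt ℝ 4 (Function.uncurry c) (x, y)) (hk : k ≤ 4) :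
    ContinuousAt (fun z : Euc n × Euc n => iteratedFDeriv ℝ k (Function.uncurry c) z) (x, y) :=
  (hc.iteratedFDeriv_right (m := 0) (by norm_cast; omega)).continuousAt

/-- Exchanging the variables transposes the mixed Hessian, by symmetry of second derivatives. -/
theorem mixedHess_flipCost (hc : ContDiffAt ℝ 4 (Function.uncurry c) (x, y)) :
    mixedHess (flipCost c) y x = ContinuousLinearMap.adjoint (mixedHess c x y) := by
  ext1 η
  refine ext_inner_right ℝ fun w => ?_
  rw [inner_mixedHess (contDiffAt_flipCost hc), ContinuousLinearMap.adjoint_inner_left,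
    real_inner_comm, inner_mixedHess hc, jet_flipCost, jet_two_comm hc]
  congr 1
  funext i; fin_cases i <;> rfl

/-! ### The cost exponential coordinates -/

/-- The hypotheses (B0), (B1), (B2), which are symmetric in the two variables. -/
structure RegCost (U V : Set (Euc n)) (c : Euc n → Euc n → ℝ) : Prop where
  b0 : B0 U V c
  b1 : B1 U V c
  b2 : B2 U V c

namespace RegCost

variable {U V : Set (Euc n)} {c : Euc n → Euc n → ℝ} (H : RegCost U V c) {x y : Euc n}
include H

theorem flip : RegCost V U (flipCost c) where
  b0 := ⟨H.b0.isOpen_right, H.b0.isOpen_left, H.b0.isBounded_right, H.b0.isBounded_left,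
    fun y hy x hx => contDiffAt_flipCost (H.b0.contDiff x hx y hy)⟩
  b1 := ⟨fun x hx => H.b1.right x hx, fun y hy => H.b1.left y hy⟩
  b2 := ⟨fun x hx => H.b2.right x hx, fun y hy => H.b2.left y hy⟩

theorem isCompact_left : IsCompact (closure U) := H.b0.isBounded_left.isCompact_closure
theorem isCompact_right : IsCompact (closure V) := H.b0.isBounded_right.isCompact_closure

theorem contDiffAt_qMap (hx : x ∈ closure U) (hy : y ∈ closure V) :
    ContDiffAt ℝ 3 (qMap c y) x :=
  ((contDiffAt_gradY (H.b0.contDiff x hx y hy)).comp x (contDiff_prodMk_left y).contDiffAt).neg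

theorem hasFDerivAt_qMap (hx : x ∈ closure U) (hy : y ∈ closure V) :
    HasFDerivAt (qMap c y) (-mixedHess c x y) x :=
  (hasFDerivAt_gradY (H.b0.contDiff x hx y hy)).neg

theorem continuousAt_qMap (hx : x ∈ closure U) (hy : y ∈ closure V) :
    ContinuousAt (fun z : Euc n × Euc n => qMap c z.2 z.1) (x, y) :=
  ((contDiffAt_gradY (H.b0.contDiff x hx y hy)).continuousAt).neg

theorem injOn_qMap (hy : y ∈ closure V) : InjOn (qMap c y) (closure U) := by
  obtain ⟨-, g, hg, -⟩ := H.b1.left y hy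
  intro a ha b hb hab
  rw [← hg a ha, ← hg b hb, hab]

/-- The mixed Hessian is invertible on the closures. At interior points this is the chain rule for
the inverse of the coordinate map, whose derivative is continuous up to the boundary. -/
theorem exists_leftInverse_mixedHess (hx : x ∈ closure U) (hy : y ∈ closure V) :
    ∃ G : Euc n →L[ℝ] Euc n, G.comp (mixedHess c x y) = ContinuousLinearMap.id ℝ _ := by
  obtain ⟨-, g, hg, hg'⟩ := H.b1.left y hy
  have hU : ∀ x ∈ U, (fderiv ℝ g (qMap c y x)).comp (-mixedHess c x y) =
      ContinuousLinearMap.id ℝ _ := by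
    intro x hx
    have hx' := subset_closure hx
    have h1 := (((hg' x hx').differentiableAt (by norm_num)).hasFDerivAt).comp x
      (H.hasFDerivAt_qMap hx' hy)
    refine h1.unique ((hasFDerivAt_id x).congr_of_eventuallyEq ?_)
    filter_upwards [H.b0.isOpen_left.mem_nhds hx] with x' hx'
    exact hg x' (subset_closure hx')
  -- a boundary point need not be interior to the domain on which `g` inverts the coordinate map
  have hcont : ContinuousAt (fun x => (fderiv ℝ g (qMap c y x)).comp (-mixedHess c x y)) x := by
    refine ContinuousAt.clm_comp ?_ ?_
    · exact ContinuousAt.comp (f := qMap c y) (((hg' x hx).fderiv_right (m := 0)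
        (by norm_num)).continuousAt) (H.contDiffAt_qMap hx hy).continuousAt
    · exact (ContinuousAt.comp (f := fun x => (x, y)) (continuousAt_mixedHess
        (H.b0.contDiff x hx y hy)) (by fun_prop)).neg
  have : (𝓝[U] x).NeBot := mem_closure_iff_nhdsWithin_neBot.1 hx
  have h := tendsto_nhds_unique (hcont.tendsto.mono_left nhdsWithin_le_nhds)
    (tendsto_const_nhds.congr' (by
      filter_upwards [self_mem_nhdsWithin] with x hx using (hU x hx).symm))
  refine ⟨-(fderiv ℝ g (qMap c y x)), ?_⟩
  rw [← h]; ext; simp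

theorem exists_mixedHess_lower :
    ∃ m : ℝ, 0 < m ∧ ∀ x ∈ closure U, ∀ y ∈ closure V, ∀ ξ, m * ‖ξ‖ ≤ ‖mixedHess c x y ξ‖ := by
  set S := (closure U ×ˢ closure V) ×ˢ Metric.sphere (0 : Euc n) 1 with hS
  have hScomp : IsCompact S :=
    (H.isCompact_left.prod H.isCompact_right).prod (isCompact_sphere _ _)
  have hcont : ContinuousOn (fun z : (Euc n × Euc n) × Euc n => ‖mixedHess c z.1.1 z.1.2 z.2‖) S := by
    rintro ⟨⟨x, y⟩, ξ⟩ ⟨⟨hx, hy⟩, -⟩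
    refine ContinuousAt.continuousWithinAt ?_
    refine (ContinuousAt.clm_apply ?_ continuousAt_snd).norm
    exact ContinuousAt.comp (f := fun z : (Euc n × Euc n) × Euc n => z.1)
      (continuousAt_mixedHess (H.b0.contDiff x hx y hy)) continuousAt_fst
  have key : ∃ m : ℝ, 0 < m ∧ ∀ z ∈ S, m ≤ ‖mixedHess c z.1.1 z.1.2 z.2‖ := by
    rcases S.eq_empty_or_nonempty with h | h
    · exact ⟨1, one_pos, by simp [h]⟩
    · obtain ⟨z, hz, hmin⟩ := hScomp.exists_isMinOn h hcont
      refine ⟨_, ?_, fun w hw => hmin hw⟩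
      rw [norm_pos_iff]
      intro h0
      obtain ⟨G, hG⟩ := H.exists_leftInverse_mixedHess hz.1.1 hz.1.2
      have := DFunLike.congr_fun hG z.2
      simp only [ContinuousLinearMap.comp_apply, h0, map_zero, ContinuousLinearMap.id_apply] at this
      have h1 := hz.2
      simp [← this] at h1
  obtain ⟨m, hm, hmin⟩ := key
  refine ⟨m, hm, fun x hx y hy ξ => ?_⟩
  rcases eq_or_ne ξ 0 with rfl | hξ
  · simp
  have hpos : 0 < ‖ξ‖ := norm_pos_iff.2 hξ
  have := hmin ((x, y), ‖ξ‖⁻¹ • ξ) ⟨⟨hx, hy⟩, by simp [norm_smul, hpos.ne']⟩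
  simp only [map_smul, norm_smul, norm_inv, norm_norm] at this
  rwa [inv_mul_eq_div, le_div_iff₀ hpos] at this

theorem exists_jet_bound :
    ∃ K : ℝ, 0 < K ∧ ∀ x ∈ closure U, ∀ y ∈ closure V, ∀ k ≤ 4, ∀ v : Fin k → Euc n × Euc n,
      |jet c k x y v| ≤ K * ∏ i, ‖v i‖ := by
  have hk : ∀ k : ℕ, ∃ K : ℝ, k ≤ 4 → ∀ x ∈ closure U, ∀ y ∈ closure V,
      ‖iteratedFDeriv ℝ k (Function.uncurry c) (x, y)‖ ≤ K := by
    intro k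
    by_cases hk : k ≤ 4
    · obtain ⟨K, hK⟩ := (H.isCompact_left.prod H.isCompact_right).exists_bound_of_continuousOn
        (f := fun z => iteratedFDeriv ℝ k (Function.uncurry c) z)
        (fun z hz => (continuousAt_jet (H.b0.contDiff z.1 hz.1 z.2 hz.2) hk).continuousWithinAt)
      exact ⟨K, fun _ x hx y hy => hK (x, y) ⟨hx, hy⟩⟩
    · exact ⟨0, fun h => absurd h hk⟩
  choose K hK using hk
  refine ⟨1 + ∑ k ∈ Finset.range 5, |K k|, by positivity, fun x hx y hy k hk v => ?_⟩
  have h1 := (iteratedFDeriv ℝ k (Function.uncurry c) (x, y)).le_opNorm v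
  refine h1.trans (mul_le_mul_of_nonneg_right ?_ (by positivity))
  have h2 := hK k hk x hx y hy
  have h3 : |K k| ≤ ∑ k ∈ Finset.range 5, |K k| :=
    Finset.single_le_sum (f := fun k => |K k|) (fun _ _ => abs_nonneg _)
      (Finset.mem_range.2 (by omega))
  linarith [le_abs_self (K k)]

theorem exists_mixedHess_upper :
    ∃ K : ℝ, 0 < K ∧ ∀ x ∈ closure U, ∀ y ∈ closure V, ‖mixedHess c x y‖ ≤ K := by
  obtain ⟨K, hK⟩ := (H.isCompact_left.prod H.isCompact_right).exists_bound_of_continuousOn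
    (f := fun z => mixedHess c z.1 z.2)
    (fun z hz => (continuousAt_mixedHess (H.b0.contDiff z.1 hz.1 z.2 hz.2)).continuousWithinAt)
  exact ⟨|K| + 1, by positivity, fun x hx y hy => (hK (x, y) ⟨hx, hy⟩).trans
    (by linarith [le_abs_self K])⟩

omit H in
/-- An injective endomorphism of `ℝⁿ` as a continuous linear equivalence. -/
def equivOfInj (A : Euc n →L[ℝ] Euc n) (hA : Function.Injective A) : Euc n ≃L[ℝ] Euc n :=
  (LinearEquiv.ofInjectiveEndo (A : Euc n →ₗ[ℝ] Euc n) hA).toContinuousLinearEquiv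

theorem injective_mixedHess (hx : x ∈ closure U) (hy : y ∈ closure V) :
    Function.Injective (mixedHess c x y) := by
  obtain ⟨G, hG⟩ := H.exists_leftInverse_mixedHess hx hy
  intro a b hab
  have h1 := DFunLike.congr_fun hG a
  have h2 := DFunLike.congr_fun hG b
  simp only [ContinuousLinearMap.comp_apply, ContinuousLinearMap.id_apply] at h1 h2
  rw [← h1, ← h2, hab]

theorem surjective_mixedHess (hx : x ∈ closure U) (hy : y ∈ closure V) :
    Function.Surjective (mixedHess c x y) :=
  (equivOfInj _ (H.injective_mixedHess hx hy)).surjective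

theorem det_mixedHess_ne_zero (hx : x ∈ closure U) (hy : y ∈ closure V) :
    (mixedHess c x y).det ≠ 0 := by
  have := (equivOfInj _ (H.injective_mixedHess hx hy)).toLinearEquiv.isUnit_det'
  exact this.ne_zero

theorem xOf_qMap (hx : x ∈ closure U) (hy : y ∈ closure V) : xOf c U y (qMap c y x) = x :=
  (H.injOn_qMap hy).leftInvOn_invFunOn hx

/-- Near the image of an interior point the coordinate map has a `C³` local inverse. -/
theorem exists_localInverse (hx : x ∈ U) (hy : y ∈ closure V) :
    ∃ h : Euc n → Euc n, ContDiffAt ℝ 3 h (qMap c y x) ∧ h (qMap c y x) = x ∧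
      ∀ᶠ q in 𝓝 (qMap c y x), h q ∈ U ∧ qMap c y (h q) = q := by
  have hx' := subset_closure hx
  have hinj : Function.Injective (-mixedHess c x y) := by
    intro a b hab
    exact H.injective_mixedHess hx' hy (by simpa using hab)
  have hd : HasFDerivAt (qMap c y) ((equivOfInj _ hinj : Euc n ≃L[ℝ] Euc n) : Euc n →L[ℝ] Euc n) x :=
    H.hasFDerivAt_qMap hx' hy
  have hcd := H.contDiffAt_qMap hx' hy
  have h3 : (3 : WithTop ℕ∞) ≠ 0 := by norm_num
  have hh := hcd.to_localInverse hd h3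
  have hh0 := hcd.localInverse_apply_image hd h3
  refine ⟨hcd.localInverse hd h3, hh, hh0, ?_⟩
  have e1 : ∀ᶠ q in 𝓝 (qMap c y x), hcd.localInverse hd h3 q ∈ U :=
    hh.continuousAt.eventually (by rw [hh0]; exact H.b0.isOpen_left.mem_nhds hx)
  exact e1.and (hcd.hasStrictFDerivAt' hd h3).eventually_right_inverse

theorem isOpen_coordDomain (hy : y ∈ closure V) : IsOpen (coordDomain c U y) := by
  rw [isOpen_iff_mem_nhds]
  rintro _ ⟨x, hx, rfl⟩
  obtain ⟨h, -, -, hev⟩ := H.exists_localInverse hx hy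
  filter_upwards [hev] with q hq
  exact ⟨h q, hq.1, hq.2⟩

theorem contDiffAt_xOf {q : Euc n} (hq : q ∈ coordDomain c U y) (hy : y ∈ closure V) :
    ContDiffAt ℝ 3 (xOf c U y) q := by
  obtain ⟨x, hx, rfl⟩ := hq
  obtain ⟨h, hh, -, hev⟩ := H.exists_localInverse hx hy
  refine hh.congr_of_eventuallyEq ?_
  filter_upwards [hev] with q hq
  conv_lhs => rw [← hq.2]
  exact H.xOf_qMap (subset_closure hq.1) hy

theorem xOf_mem {q : Euc n} (hq : q ∈ coordDomain c U y) (hy : y ∈ closure V) :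
    xOf c U y q ∈ U := by
  obtain ⟨x, hx, rfl⟩ := hq
  rwa [H.xOf_qMap (subset_closure hx) hy]

theorem qMap_xOf {q : Euc n} (hq : q ∈ coordDomain c U y) (hy : y ∈ closure V) :
    qMap c y (xOf c U y q) = q := by
  obtain ⟨x, hx, rfl⟩ := hq
  rw [H.xOf_qMap (subset_closure hx) hy]

/-- The derivative of `q ↦ x(q)` is minus the inverse of the mixed Hessian at `y`. -/
theorem mixedHess_fderiv_xOf {q : Euc n} (hq : q ∈ coordDomain c U y) (hy : y ∈ closure V)
    (ζ : Euc n) : mixedHess c (xOf c U y q) y (fderiv ℝ (xOf c U y) q ζ) = -ζ := by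
  have hx := subset_closure (H.xOf_mem hq hy)
  have h1 := (H.hasFDerivAt_qMap hx hy).comp q
    ((H.contDiffAt_xOf hq hy).differentiableAt (by norm_num)).hasFDerivAt
  have h2 := h1.unique ((hasFDerivAt_id q).congr_of_eventuallyEq (by
    filter_upwards [(H.isOpen_coordDomain hy).mem_nhds hq] with q' hq'
    exact H.qMap_xOf hq' hy))
  have h3 := DFunLike.congr_fun h2 ζ
  simp only [ContinuousLinearMap.comp_apply, ContinuousLinearMap.id_apply, neg_apply] at h3
  rw [← neg_eq_iff_eq_neg, h3]

/-- The curve `s ↦ x(q + s ζ)` is twice differentiable; differentiating the identity that its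
coordinates are affine gives the linear equations for its velocity and acceleration. -/
theorem exists_segment_derivs {q ζ : Euc n} (hy : y ∈ closure V) :
    ∃ X' X'' : ℝ → Euc n, ∀ s : ℝ, q + s • ζ ∈ coordDomain c U y →
      HasDerivAt (fun r : ℝ => xOf c U y (q + r • ζ)) (X' s) s ∧ HasDerivAt X' (X'' s) s ∧
      (∀ w, jet c 2 (xOf c U y (q + s • ζ)) y ![(X' s, 0), (0, w)] = -⟪ζ, w⟫_ℝ) ∧
      (∀ w, jet c 3 (xOf c U y (q + s • ζ)) y ![(X' s, 0), (X' s, 0), (0, w)] +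
        jet c 2 (xOf c U y (q + s • ζ)) y ![(X'' s, 0), (0, w)] = 0) := by
  have hl : ∀ s : ℝ, HasDerivAt (fun r : ℝ => q + r • ζ) ζ s := fun s => by
    simpa using ((hasDerivAt_id s).smul_const ζ).const_add q
  have h1 : ∀ s : ℝ, q + s • ζ ∈ coordDomain c U y →
      HasDerivAt (fun r : ℝ => xOf c U y (q + r • ζ)) (fderiv ℝ (xOf c U y) (q + s • ζ) ζ) s := by
    intro s hs
    exact ((H.contDiffAt_xOf hs hy).differentiableAt (by norm_num)).hasFDerivAt.comp_hasDerivAt s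
      (hl s)
  have h2 : ∀ s : ℝ, q + s • ζ ∈ coordDomain c U y →
      HasDerivAt (fun r : ℝ => fderiv ℝ (xOf c U y) (q + r • ζ) ζ)
        (fderiv ℝ (fderiv ℝ (xOf c U y)) (q + s • ζ) ζ ζ) s := by
    intro s hs
    have := hasDerivAt_fderiv_apply ((H.contDiffAt_xOf hs hy).of_le (by norm_num)) (hl s)
      (hasDerivAt_const s ζ)
    simpa only [map_zero, add_zero] using this
  have h3 : ∀ s : ℝ, q + s • ζ ∈ coordDomain c U y → ∀ w,
      jet c 2 (xOf c U y (q + s • ζ)) y ![(fderiv ℝ (xOf c U y) (q + s • ζ) ζ, 0), (0, w)]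
        = -⟪ζ, w⟫_ℝ := by
    intro s hs w
    rw [← inner_mixedHess (H.b0.contDiff _ (subset_closure (H.xOf_mem hs hy)) _ hy),
      H.mixedHess_fderiv_xOf hs hy, inner_neg_left]
  refine ⟨_, _, fun s hs => ⟨h1 s hs, h2 s hs, h3 s hs, fun w => ?_⟩⟩
  have hc := H.b0.contDiff _ (subset_closure (H.xOf_mem hs hy)) _ hy
  have h4 := jet_hasDerivAt_cons (k := 1) (Y := fun _ => y) hc (by norm_num) (h1 s hs)
    (hasDerivAt_const s y) ((h2 s hs).prodMk (hasDerivAt_const s (0 : Euc n))) ![(0, w)]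
  have hev : ∀ᶠ r in 𝓝 s, q + r • ζ ∈ coordDomain c U y :=
    (hl s).continuousAt.eventually ((H.isOpen_coordDomain hy).mem_nhds hs)
  have h5 := (hasDerivAt_const s (-⟪ζ, w⟫_ℝ)).congr_of_eventuallyEq
    (hev.mono fun r hr => h3 r hr w)
  exact h4.unique h5

end RegCost

/-! ### The cross-curvature bound -/

section multilinear
variable (c : Euc n → Euc n → ℝ) (x y : Euc n)

theorem jet_cons_add {k : ℕ} (a b : Euc n × Euc n) (v : Fin k → Euc n × Euc n) :
    jet c (k + 1) x y (Matrix.vecCons (a + b) v) =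
      jet c (k + 1) x y (Matrix.vecCons a v) + jet c (k + 1) x y (Matrix.vecCons b v) :=
  (iteratedFDeriv ℝ (k + 1) (Function.uncurry c) (x, y)).cons_add v a b

theorem jet_cons_smul {k : ℕ} (r : ℝ) (a : Euc n × Euc n) (v : Fin k → Euc n × Euc n) :
    jet c (k + 1) x y (Matrix.vecCons (r • a) v) = r * jet c (k + 1) x y (Matrix.vecCons a v) :=
  (iteratedFDeriv ℝ (k + 1) (Function.uncurry c) (x, y)).cons_smul v r a

theorem jet_smul_univ {k : ℕ} (r : Fin k → ℝ) (v : Fin k → Euc n × Euc n) :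
    jet c k x y (fun i => r i • v i) = (∏ i, r i) * jet c k x y v :=
  (iteratedFDeriv ℝ k (Function.uncurry c) (x, y)).map_smul_univ r v

end multilinear

/-- The second-order condition satisfied by the velocity `ξ` and acceleration `ξ'` at `(x, y)` of a
curve in the first variable along which `D_y c (·, y)` is affine. -/
def AffineLeft (c : Euc n → Euc n → ℝ) (x y ξ ξ' : Euc n) : Prop :=
  ∀ w, jet c 3 x y ![(ξ, 0), (ξ, 0), (0, w)] + jet c 2 x y ![(ξ', 0), (0, w)] = 0

/-- The second-order condition satisfied by the velocity `η` and acceleration `η'` at `(x, y)` of a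
curve in the second variable along which `D_x c (x, ·)` is affine. -/
def AffineRight (c : Euc n → Euc n → ℝ) (x y η η' : Euc n) : Prop :=
  ∀ w, jet c 3 x y ![(0, η), (0, η), (w, 0)] + jet c 2 x y ![(0, η'), (w, 0)] = 0

/-- The value of `∂²_s ∂²_t c (x(s), y(t))` along two curves that are affine in the respective
coordinates, i.e. minus the cross-curvature, is bounded by a multiple of `|∂_s ∂_t c|`. -/
def CrossCurvatureBound (U V : Set (Euc n)) (c : Euc n → Euc n → ℝ) (K : ℝ) : Prop :=
  ∀ x ∈ U, ∀ y ∈ V, ∀ ξ ξ' η η', AffineLeft c x y ξ ξ' → AffineRight c x y η η' →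
    jet c 4 x y ![(ξ, 0), (ξ, 0), (0, η), (0, η)] - jet c 2 x y ![(ξ', 0), (0, η')] ≤
      K * |jet c 2 x y ![(ξ, 0), (0, η)]| * ‖ξ‖ * ‖η‖

theorem affineLeft_flipCost {c : Euc n → Euc n → ℝ} {x y η η' : Euc n} :
    AffineLeft (flipCost c) y x η η' ↔ AffineRight c x y η η' := by
  refine forall_congr' fun w => ?_
  rw [jet_flipCost, jet_flipCost]
  have e1 : (fun i => (![(η, (0 : Euc n)), (η, 0), (0, w)] i).swap) = ![(0, η), (0, η), (w, 0)] := by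
    funext i; fin_cases i <;> rfl
  have e2 : (fun i => (![(η', (0 : Euc n)), (0, w)] i).swap) = ![(0, η'), (w, 0)] := by
    funext i; fin_cases i <;> rfl
  rw [e1, e2]

theorem affineRight_flipCost {c : Euc n → Euc n → ℝ} {x y ξ ξ' : Euc n} :
    AffineRight (flipCost c) y x ξ ξ' ↔ AffineLeft c x y ξ ξ' :=
  affineLeft_flipCost (c := flipCost c).symm

theorem iteratedDeriv_two_of_hasDerivAt {f f' : ℝ → ℝ} {a : ℝ}
    (h : ∀ᶠ s in 𝓝 (0 : ℝ), HasDerivAt f (f' s) s) (h' : HasDerivAt f' a 0) :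
    iteratedDeriv 2 f 0 = a := by
  rw [iteratedDeriv_succ, iteratedDeriv_one]
  exact (h'.congr_of_eventuallyEq (h.mono fun s hs => hs.deriv)).deriv

theorem exists_small_segment {W : Set (Euc n)} (q ζ : Euc n) (hW : IsOpen W) (hq : q ∈ W) :
    ∃ α : ℝ, 0 < α ∧ ∀ s ∈ Icc (-1 : ℝ) 1, q + s • (α • ζ) ∈ W := by
  obtain ⟨r, hr, hball⟩ := Metric.isOpen_iff.1 hW q hq
  refine ⟨r / (‖ζ‖ + 1), by positivity, fun s hs => hball ?_⟩
  rw [mem_ball_iff_norm, add_sub_cancel_left, norm_smul, norm_smul, Real.norm_eq_abs,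
    Real.norm_eq_abs, abs_of_pos (by positivity : 0 < r / (‖ζ‖ + 1))]
  have h1 : |s| ≤ 1 := abs_le.2 hs
  have h2 : r / (‖ζ‖ + 1) * ‖ζ‖ < r := by
    rw [div_mul_eq_mul_div, div_lt_iff₀ (by positivity)]
    nlinarith [norm_nonneg ζ]
  have h3 : 0 ≤ r / (‖ζ‖ + 1) * ‖ζ‖ := by positivity
  nlinarith

namespace RegCost

variable {U V : Set (Euc n)} {c : Euc n → Euc n → ℝ} (H : RegCost U V c) {x y : Euc n}
include H

theorem crossCurvatureBound_flip {K : ℝ} (h : CrossCurvatureBound U V c K) :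
    CrossCurvatureBound V U (flipCost c) K := by
  intro y hy x hx η η' ξ ξ' hη hξ
  have hc := H.b0.contDiff x (subset_closure hx) y (subset_closure hy)
  have := h x hx y hy ξ ξ' η η' (affineRight_flipCost.1 hξ) (affineLeft_flipCost.1 hη)
  rw [jet_flipCost, jet_flipCost, jet_flipCost]
  have e1 : (fun i => (![(η, (0 : Euc n)), (η, 0), (0, ξ), (0, ξ)] i).swap) =
    ![(0, η), (0, η), (ξ, 0), (ξ, 0)] := by funext i; fin_cases i <;> rfl
  have e2 : ∀ η ξ : Euc n, (fun i => (![(η, (0 : Euc n)), (0, ξ)] i).swap) =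
    ![(0, η), (ξ, 0)] := by intro η ξ; funext i; fin_cases i <;> rfl
  rw [e1, e2, e2, jet_four_pairs hc, jet_two_comm hc, jet_two_comm hc (0, η)]
  linarith

theorem inner_mixedHess_flip (hx : x ∈ closure U) (hy : y ∈ closure V) (η w : Euc n) :
    ⟪mixedHess (flipCost c) y x η, w⟫_ℝ = jet c 2 x y ![(w, 0), (0, η)] := by
  have hc := H.b0.contDiff x hx y hy
  rw [mixedHess_flipCost hc, ContinuousLinearMap.adjoint_inner_left, real_inner_comm,
    inner_mixedHess hc]

theorem affineLeft_unique {ξ a b : Euc n} (hx : x ∈ closure U) (hy : y ∈ closure V)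
    (ha : AffineLeft c x y ξ a) (hb : AffineLeft c x y ξ b) : a = b := by
  refine H.injective_mixedHess hx hy (ext_inner_right ℝ fun w => ?_)
  rw [inner_mixedHess (H.b0.contDiff x hx y hy), inner_mixedHess (H.b0.contDiff x hx y hy)]
  linarith [ha w, hb w]

omit H in
theorem affineLeft_smul {ξ ξ' : Euc n} (h : AffineLeft c x y ξ ξ') (r : ℝ) :
    AffineLeft c x y (r • ξ) (r ^ 2 • ξ') := by
  intro w
  have h1 := jet_smul_univ c x y ![r, r, 1] ![(ξ, 0), (ξ, 0), (0, w)]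
  have h2 := jet_smul_univ c x y ![r ^ 2, 1] ![(ξ', 0), (0, w)]
  have e1 : (fun i => (![r, r, 1] : Fin 3 → ℝ) i • (![(ξ, (0 : Euc n)), (ξ, 0), (0, w)] :
    Fin 3 → Euc n × Euc n) i) = ![(r • ξ, 0), (r • ξ, 0), (0, w)] := by
    funext i; fin_cases i <;> simp
  have e2 : (fun i => (![r ^ 2, 1] : Fin 2 → ℝ) i • (![(ξ', (0 : Euc n)), (0, w)] :
    Fin 2 → Euc n × Euc n) i) = ![(r ^ 2 • ξ', 0), (0, w)] := by
    funext i; fin_cases i <;> simp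
  rw [e1] at h1
  rw [e2] at h2
  rw [h1, h2]
  simp only [Fin.prod_univ_three, Fin.prod_univ_two, Matrix.cons_val]
  linear_combination r ^ 2 * h w

/-- Every velocity has an acceleration satisfying the affinity condition, because the mixed Hessian is
surjective. -/
theorem exists_affineLeft (hx : x ∈ closure U) (hy : y ∈ closure V) (ξ : Euc n) :
    ∃ ξ', AffineLeft c x y ξ ξ' := by
  have hc := H.b0.contDiff x hx y hy
  let L : Euc n →ₗ[ℝ] ℝ :=
    { toFun := fun w => -jet c 3 x y ![(0, w), (ξ, 0), (ξ, 0)]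
      map_add' := fun a b => by
        rw [show ((0 : Euc n), a + b) = (0, a) + (0, b) by simp, jet_cons_add]; ring
      map_smul' := fun r a => by
        rw [show ((0 : Euc n), r • a) = r • (0, a) by simp, jet_cons_smul]; simp }
  obtain ⟨ξ', hξ'⟩ := H.surjective_mixedHess hx hy
    ((InnerProductSpace.toDual ℝ (Euc n)).symm (LinearMap.toContinuousLinearMap L))
  refine ⟨ξ', fun w => ?_⟩
  rw [← inner_mixedHess hc, hξ', InnerProductSpace.toDual_symm_apply, jet_three_swap' hc,
    jet_three_swap hc]
  simp [L]

/-- Up to scaling, a velocity and an acceleration satisfying the affinity condition come from a curve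
inside `U` that is a segment in the coordinates at `y`. -/
theorem exists_affine_curve {ξ ξ' : Euc n} (hx : x ∈ U) (hy : y ∈ V) (hξ : AffineLeft c x y ξ ξ') :
    ∃ α : ℝ, 0 < α ∧ ∃ X X' : ℝ → Euc n,
      X 0 = x ∧ X' 0 = α • ξ ∧ (∀ s ∈ Icc (-1 : ℝ) 1, X s ∈ U) ∧
      IsAffineSegment (fun t => gradY c (X t) y) ∧
      (∀ s ∈ Icc (-1 : ℝ) 1, HasDerivAt X (X' s) s) ∧ HasDerivAt X' (α ^ 2 • ξ') 0 := by
  have hx' := subset_closure hx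
  have hy' := subset_closure hy
  obtain ⟨α, hα, hseg⟩ := exists_small_segment (qMap c y x) (-mixedHess c x y ξ)
    (H.isOpen_coordDomain hy') ⟨x, hx, rfl⟩
  obtain ⟨X', X'', hX⟩ := H.exists_segment_derivs (q := qMap c y x)
    (ζ := α • -mixedHess c x y ξ) hy'
  have h0 : (0 : ℝ) ∈ Icc (-1 : ℝ) 1 := by constructor <;> norm_num
  have hX0 : xOf c U y (qMap c y x + (0 : ℝ) • (α • -mixedHess c x y ξ)) = x := by
    rw [zero_smul, add_zero, H.xOf_qMap hx' hy']
  obtain ⟨-, hd2, hv, ha⟩ := hX 0 (hseg 0 h0)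
  rw [hX0] at hv ha
  have hv' : X' 0 = α • ξ := by
    refine H.injective_mixedHess hx' hy' (ext_inner_right ℝ fun w => ?_)
    rw [inner_mixedHess (H.b0.contDiff x hx' y hy'), hv, smul_neg, inner_neg_left, neg_neg,
      map_smul]
  refine ⟨α, hα, fun s => xOf c U y (qMap c y x + s • (α • -mixedHess c x y ξ)), X', hX0, hv',
    fun s hs => H.xOf_mem (hseg s hs) hy', ?_, fun s hs => (hX s (hseg s hs)).1, ?_⟩
  · refine ⟨-qMap c y x, -(α • -mixedHess c x y ξ), fun t ht => ?_⟩
    have := H.qMap_xOf (hseg t ht) hy'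
    rw [qMap, neg_eq_iff_eq_neg] at this
    exact this.trans (by module)
  · rw [hv'] at ha
    rwa [H.affineLeft_unique hx' hy' ha (affineLeft_smul hξ α)] at hd2

/-- The cross-curvature condition at interior points for orthogonal directions, in terms of
partial derivatives of the cost. -/
theorem crossCurvature_of_orthogonal (h3 : B3 U V c) (hx : x ∈ U) (hy : y ∈ V)
    {ξ ξ' η η' : Euc n} (hξ : AffineLeft c x y ξ ξ') (hη : AffineRight c x y η η')
    (h0 : jet c 2 x y ![(ξ, 0), (0, η)] = 0) :
    jet c 4 x y ![(ξ, 0), (ξ, 0), (0, η), (0, η)] - jet c 2 x y ![(ξ', 0), (0, η')] ≤ 0 := by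
  have hx' := subset_closure hx
  have hy' := subset_closure hy
  have hc := H.b0.contDiff x hx' y hy'
  obtain ⟨α, hα, X, X', hX0, hX'0, hXU, hXs, hXd, hXd2⟩ := H.exists_affine_curve hx hy hξ
  obtain ⟨β, hβ, Y, Y', hY0, hY'0, hYV, hYs, hYd, hYd2⟩ :=
    H.flip.exists_affine_curve hy hx (affineLeft_flipCost.2 hη)
  have hIcc : Icc (-1 : ℝ) 1 ∈ 𝓝 (0 : ℝ) := Icc_mem_nhds (by norm_num) (by norm_num)
  have hC : ∀ s ∈ Icc (-1 : ℝ) 1, ∀ t ∈ Icc (-1 : ℝ) 1,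
      ContDiffAt ℝ 4 (Function.uncurry c) (X s, Y t) := fun s hs t ht =>
    H.b0.contDiff _ (subset_closure (hXU s hs)) _ (subset_closure (hYV t ht))
  have hz : (0 : ℝ) ∈ Icc (-1 : ℝ) 1 := by constructor <;> norm_num
  have hd1 : ∀ s ∈ Icc (-1 : ℝ) 1, ∀ t ∈ Icc (-1 : ℝ) 1,
      HasDerivAt (fun t => c (X s) (Y t)) (jet c 1 (X s) (Y t) ![(0, Y' t)]) t := fun s hs t ht =>
    jet_hasDerivAt (k := 0) (X := fun _ => X s) (hC s hs t ht) (by norm_num)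
      (hasDerivAt_const t (X s)) (hYd t ht) ![]
  have hd2 : ∀ s ∈ Icc (-1 : ℝ) 1, iteratedDeriv 2 (fun t => c (X s) (Y t)) 0 =
      jet c 2 (X s) y ![(0, β • η), (0, β • η)] + jet c 1 (X s) y ![(0, β ^ 2 • η')] := by
    intro s hs
    have h := jet_hasDerivAt_cons (k := 0) (X := fun _ => X s) (hC s hs 0 hz) (by norm_num)
      (hasDerivAt_const 0 (X s)) (hYd 0 hz) ((hasDerivAt_const (0 : ℝ) (0 : Euc n)).prodMk hYd2) ![]
    rw [hY0, hY'0] at h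
    exact iteratedDeriv_two_of_hasDerivAt (by filter_upwards [hIcc] with t ht using hd1 s hs t ht) h
  have hs1 : ∀ s ∈ Icc (-1 : ℝ) 1, ∀ (k : ℕ) (v : Fin k → Euc n × Euc n), k + 1 ≤ 4 →
      HasDerivAt (fun s => jet c k (X s) y v)
        (jet c (k + 1) (X s) y (Fin.cons (X' s, 0) v)) s := by
    intro s hs k v hk
    have := hC s hs 0 hz
    rw [hY0] at this
    exact jet_hasDerivAt (Y := fun _ => y) this hk (hXd s hs) (hasDerivAt_const s y) v
  have hmix : deriv (fun s => deriv (fun t => c (X s) (Y t)) 0) 0 = 0 := by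
    have h := hs1 0 hz 1 ![(0, β • η)] (by norm_num)
    rw [hX0, hX'0] at h
    have h' : (fun s => deriv (fun t => c (X s) (Y t)) 0) =ᶠ[𝓝 0]
        fun s => jet c 1 (X s) y ![(0, β • η)] := by
      filter_upwards [hIcc] with s hs
      rw [(hd1 s hs 0 hz).deriv, hY0, hY'0]
    rw [h'.deriv_eq, h.deriv]
    have e := jet_smul_univ c x y ![α, β] ![(ξ, 0), (0, η)]
    rw [h0, mul_zero] at e
    rw [← e]
    congr 1; funext i; fin_cases i <;> simp
  have hfour : iteratedDeriv 2 (fun s => iteratedDeriv 2 (fun t => c (X s) (Y t)) 0) 0 =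
      (jet c 4 x y ![(α • ξ, 0), (α • ξ, 0), (0, β • η), (0, β • η)] +
        jet c 3 x y ![(α ^ 2 • ξ', 0), (0, β • η), (0, β • η)]) +
      (jet c 3 x y ![(α • ξ, 0), (α • ξ, 0), (0, β ^ 2 • η')] +
        jet c 2 x y ![(α ^ 2 • ξ', 0), (0, β ^ 2 • η')]) := by
    have h' : (fun s => iteratedDeriv 2 (fun t => c (X s) (Y t)) 0) =ᶠ[𝓝 0]
        fun s => jet c 2 (X s) y ![(0, β • η), (0, β • η)] +
          jet c 1 (X s) y ![(0, β ^ 2 • η')] := by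
      filter_upwards [hIcc] with s hs using hd2 s hs
    rw [h'.iteratedDeriv_eq]
    have hc0 : ContDiffAt ℝ 4 (Function.uncurry c) (X 0, y) := by rwa [hX0]
    refine iteratedDeriv_two_of_hasDerivAt (by
      filter_upwards [hIcc] with s hs
      exact (hs1 s hs 2 _ (by norm_num)).add (hs1 s hs 1 _ (by norm_num))) ?_
    have ha := jet_hasDerivAt_cons (k := 2) (Y := fun _ => y) hc0 (by norm_num) (hXd 0 hz)
      (hasDerivAt_const 0 y) (hXd2.prodMk (hasDerivAt_const (0 : ℝ) (0 : Euc n)))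
      ![(0, β • η), (0, β • η)]
    have hb := jet_hasDerivAt_cons (k := 1) (Y := fun _ => y) hc0 (by norm_num) (hXd 0 hz)
      (hasDerivAt_const 0 y) (hXd2.prodMk (hasDerivAt_const (0 : ℝ) (0 : Euc n)))
      ![(0, β ^ 2 • η')]
    rw [hX0, hX'0] at ha hb
    exact ha.add hb
  have hB3 := h3 X Y (fun t ht => subset_closure (hXU t ht)) (fun t ht => subset_closure (hYV t ht))
    (by rw [hY0]; exact hXs) (by rw [hX0]; exact hYs) hmix
  -- by the affinity conditions each term of order three is minus the last term
  have e1 := affineLeft_smul hξ α (β ^ 2 • η')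
  have e2 := affineLeft_flipCost.1 (affineLeft_smul (affineLeft_flipCost.2 hη) β) (α ^ 2 • ξ')
  have e3 : jet c 3 x y ![(α ^ 2 • ξ', 0), (0, β • η), (0, β • η)] =
      jet c 3 x y ![(0, β • η), (0, β • η), (α ^ 2 • ξ', 0)] := by
    rw [jet_three_swap hc, jet_three_swap' hc]
  have e4 := jet_two_comm hc (0, β ^ 2 • η') (α ^ 2 • ξ', 0)
  have e5 : jet c 4 x y ![(α • ξ, 0), (α • ξ, 0), (0, β • η), (0, β • η)] =
      (α ^ 2 * β ^ 2) * jet c 4 x y ![(ξ, 0), (ξ, 0), (0, η), (0, η)] := by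
    have := jet_smul_univ c x y ![α, α, β, β] ![(ξ, 0), (ξ, 0), (0, η), (0, η)]
    rw [Fin.prod_univ_four] at this
    simp only [Matrix.cons_val] at this
    rw [show α ^ 2 * β ^ 2 = α * α * β * β by ring, ← this]
    congr 1; funext i; fin_cases i <;> simp
  have e6 : jet c 2 x y ![(α ^ 2 • ξ', 0), (0, β ^ 2 • η')] =
      (α ^ 2 * β ^ 2) * jet c 2 x y ![(ξ', 0), (0, η')] := by
    have := jet_smul_univ c x y ![α ^ 2, β ^ 2] ![(ξ', 0), (0, η')]
    rw [Fin.prod_univ_two] at this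
    simp only [Matrix.cons_val_zero, Matrix.cons_val_one] at this
    rw [← this]
    congr 1; funext i; fin_cases i <;> simp
  rw [hfour] at hB3
  have hpos : 0 < α ^ 2 * β ^ 2 := by positivity
  have hle : (α ^ 2 * β ^ 2) * (jet c 4 x y ![(ξ, 0), (ξ, 0), (0, η), (0, η)] -
      jet c 2 x y ![(ξ', 0), (0, η')]) ≤ 0 := by
    rw [mul_sub, ← e5, ← e6]; linarith
  exact nonpos_of_mul_nonpos_right hle hpos

theorem norm_mixedHess_flip_lower : ∃ m : ℝ, 0 < m ∧ ∀ x ∈ closure U, ∀ y ∈ closure V, ∀ η,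
    m * ‖η‖ ≤ ‖mixedHess (flipCost c) y x η‖ := by
  obtain ⟨m, hm, h⟩ := H.flip.exists_mixedHess_lower
  exact ⟨m, hm, fun x hx y hy => h y hy x hx⟩

/-- (B3) implies the cross-curvature bound: a pair of directions is made orthogonal at the cost of
a perturbation controlled by `|∂_s ∂_t c|`. -/
theorem exists_crossCurvatureBound (h3 : B3 U V c) :
    ∃ K : ℝ, 0 ≤ K ∧ CrossCurvatureBound U V c K := by
  obtain ⟨m, hm, hlow⟩ := H.norm_mixedHess_flip_lower
  obtain ⟨K, hK, hjet⟩ := H.exists_jet_bound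
  refine ⟨(K + K * (K / m)) / m * (2 + K / m), by positivity, ?_⟩
  intro x hx y hy ξ ξ' η η' hξ hη
  have hx' := subset_closure hx
  have hy' := subset_closure hy
  have hc := H.b0.contDiff x hx' y hy'
  have n1 : ∀ a : Euc n, ‖((a, 0) : Euc n × Euc n)‖ = ‖a‖ := fun a => by simp
  have n2 : ∀ a : Euc n, ‖((0, a) : Euc n × Euc n)‖ = ‖a‖ := fun a => by simp
  have hη' : ‖η'‖ ≤ K / m * ‖η‖ ^ 2 := by
    set w := mixedHess (flipCost c) y x η' with hw
    have h1 : ‖w‖ * ‖w‖ ≤ K * ‖η‖ ^ 2 * ‖w‖ := by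
      rw [← real_inner_self_eq_norm_mul_norm]
      conv_lhs => rw [hw, H.inner_mixedHess_flip hx' hy', ← hw]
      have h2 := hη w
      rw [jet_two_comm hc] at h2
      have h3 := hjet x hx' y hy' 3 (by norm_num) ![(0, η), (0, η), (w, 0)]
      rw [Fin.prod_univ_three] at h3
      simp only [Matrix.cons_val, n1, n2] at h3
      have := neg_abs_le (jet c 3 x y ![(0, η), (0, η), (w, 0)])
      nlinarith
    have h4 : ‖w‖ ≤ K * ‖η‖ ^ 2 := by
      rcases (norm_nonneg w).eq_or_lt with h | h
      · rw [← h]; positivity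
      · exact le_of_mul_le_mul_right h1 h
    have h5 := (hlow x hx' y hy' η').trans h4
    rw [div_mul_eq_mul_div, le_div_iff₀ hm]; linarith
  rcases eq_or_ne η 0 with rfl | hη0
  · have : η' = 0 := by simpa using hη'
    subst this
    have h1 := hjet x hx' y hy' 4 (by norm_num) ![(ξ, 0), (ξ, 0), (0, 0), (0, 0)]
    have h2 := hjet x hx' y hy' 2 (by norm_num) ![(ξ', 0), (0, 0)]
    rw [Fin.prod_univ_four] at h1
    rw [Fin.prod_univ_two] at h2
    simp only [Matrix.cons_val, n1, norm_zero, mul_zero, Matrix.cons_val_one,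
      Matrix.cons_val_zero] at h1 h2
    rw [abs_nonpos_iff.1 h1, abs_nonpos_iff.1 h2]; simp
  have hηp : 0 < ‖η‖ := norm_pos_iff.2 hη0
  set N := mixedHess (flipCost c) y x η with hN
  have hNlow : m * ‖η‖ ≤ ‖N‖ := hlow x hx' y hy' η
  have hNp : 0 < ‖N‖ := lt_of_lt_of_le (by positivity) hNlow
  set δ := jet c 2 x y ![(ξ, 0), (0, η)] with hδ
  -- `ζ` pairs to one with `η`
  set ζ : Euc n := (‖N‖ ^ 2)⁻¹ • N with hζ
  have hζn : ‖ζ‖ ≤ (m * ‖η‖)⁻¹ := by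
    rw [hζ, norm_smul, norm_inv, norm_pow, norm_norm,
      show (‖N‖ ^ 2)⁻¹ * ‖N‖ = ‖N‖⁻¹ by field_simp]
    exact inv_anti₀ (by positivity) hNlow
  have hζη : jet c 2 x y ![(ζ, 0), (0, η)] = 1 := by
    rw [← H.inner_mixedHess_flip hx' hy', ← hN, hζ, inner_smul_right,
      real_inner_self_eq_norm_sq]
    field_simp
  set ξ₀ := ξ - δ • ζ with hξ₀
  have horth : jet c 2 x y ![(ξ₀, 0), (0, η)] = 0 := by
    rw [show ((ξ₀, 0) : Euc n × Euc n) = (ξ, 0) + (-δ) • (ζ, 0) by simp [hξ₀, sub_eq_add_neg],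
      jet_cons_add, jet_cons_smul, hζη]
    ring
  obtain ⟨ξ₀', hξ₀'⟩ := H.exists_affineLeft hx' hy' ξ₀
  have hneg := H.crossCurvature_of_orthogonal h3 hx hy hξ₀' hη horth
  -- the quadratic form in the first direction
  set Q : Euc n → Euc n → ℝ := fun a b => jet c 4 x y ![(a, 0), (b, 0), (0, η), (0, η)] +
    jet c 3 x y ![(a, 0), (b, 0), (0, η')] with hQ
  have hQeq : ∀ a a', AffineLeft c x y a a' →
      jet c 4 x y ![(a, 0), (a, 0), (0, η), (0, η)] - jet c 2 x y ![(a', 0), (0, η')] = Q a a := by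
    intro a a' ha
    simp only [hQ]; linarith [ha η']
  have hQcomm : ∀ a b, Q a b = Q b a := by
    intro a b
    simp only [hQ]
    rw [jet_four_swap hc, jet_three_swap hc]
  have hQadd : ∀ a b d, Q (a + b) d = Q a d + Q b d := by
    intro a b d
    simp only [hQ]
    rw [show ((a + b, 0) : Euc n × Euc n) = (a, 0) + (b, 0) by simp, jet_cons_add, jet_cons_add]
    ring
  have hQbd : ∀ a b, Q a b ≤ (K + K * (K / m)) * ‖a‖ * ‖b‖ * ‖η‖ ^ 2 := by
    intro a b
    have h1 := hjet x hx' y hy' 4 (by norm_num) ![(a, 0), (b, 0), (0, η), (0, η)]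
    have h2 := hjet x hx' y hy' 3 (by norm_num) ![(a, 0), (b, 0), (0, η')]
    rw [Fin.prod_univ_four] at h1
    rw [Fin.prod_univ_three] at h2
    simp only [Matrix.cons_val, n1, n2] at h1 h2
    have h3 := (le_abs_self _).trans h1
    have h4 := (le_abs_self _).trans h2
    have h5 : K * (‖a‖ * ‖b‖ * ‖η'‖) ≤ K * (‖a‖ * ‖b‖ * (K / m * ‖η‖ ^ 2)) := by gcongr
    simp only [hQ]
    linarith
  rw [hQeq ξ₀ ξ₀' hξ₀'] at hneg
  rw [hQeq ξ ξ' hξ]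
  have hdec : Q ξ ξ = Q ξ₀ ξ₀ + Q (δ • ζ) ξ₀ + Q (δ • ζ) ξ := by
    have : ξ = ξ₀ + δ • ζ := by simp [hξ₀]
    calc Q ξ ξ = Q ξ₀ ξ + Q (δ • ζ) ξ := by conv_lhs => rw [this, hQadd, ← this]
      _ = Q ξ₀ ξ₀ + Q (δ • ζ) ξ₀ + Q (δ • ζ) ξ := by
        rw [hQcomm ξ₀ ξ]
        conv_lhs => enter [1]; rw [this, hQadd]
  have hδζ : ‖δ • ζ‖ ≤ |δ| * (m * ‖η‖)⁻¹ := by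
    rw [norm_smul, Real.norm_eq_abs]; gcongr
  have hδ' : |δ| ≤ K * (‖ξ‖ * ‖η‖) := by
    have h1 := hjet x hx' y hy' 2 (by norm_num) ![(ξ, 0), (0, η)]
    rw [Fin.prod_univ_two] at h1
    simpa only [Matrix.cons_val_zero, Matrix.cons_val_one, n1, n2] using h1
  have hδζ' : ‖δ • ζ‖ ≤ K / m * ‖ξ‖ := by
    refine hδζ.trans ?_
    calc |δ| * (m * ‖η‖)⁻¹ ≤ K * (‖ξ‖ * ‖η‖) * (m * ‖η‖)⁻¹ := by gcongr
      _ = K / m * ‖ξ‖ := by field_simp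
  have hξ₀n : ‖ξ₀‖ ≤ (1 + K / m) * ‖ξ‖ := by
    have := norm_sub_le ξ (δ • ζ)
    rw [← hξ₀] at this; linarith
  have b1 := hQbd (δ • ζ) ξ₀
  have b2 := hQbd (δ • ζ) ξ
  calc Q ξ ξ ≤ (K + K * (K / m)) * ‖δ • ζ‖ * (‖ξ₀‖ + ‖ξ‖) * ‖η‖ ^ 2 := by rw [hdec]; linarith
    _ ≤ (K + K * (K / m)) * (|δ| * (m * ‖η‖)⁻¹) * ((1 + K / m) * ‖ξ‖ + ‖ξ‖) * ‖η‖ ^ 2 := by gcongr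
    _ = (K + K * (K / m)) / m * (2 + K / m) * |δ| * ‖ξ‖ * ‖η‖ := by field_simp; ring

end RegCost

/-! ### Loeper's maximum principle -/

/-- A function on `[0, 1]` whose second derivative is bounded below by a multiple of the absolute
value of the first is bounded by its boundary values. -/
theorem le_max_of_deriv2_ge {f f' f'' : ℝ → ℝ} {K : ℝ}
    (hf : ∀ s ∈ Icc (0 : ℝ) 1, HasDerivAt f (f' s) s)
    (hf' : ∀ s ∈ Icc (0 : ℝ) 1, HasDerivAt f' (f'' s) s)
    (h : ∀ s ∈ Icc (0 : ℝ) 1, -(K * |f' s|) ≤ f'' s) {s : ℝ} (hs : s ∈ Icc (0 : ℝ) 1) :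
    f s ≤ max (f 0) (f 1) := by
  by_contra! hlt
  obtain ⟨h0, h1⟩ := max_lt_iff.1 hlt
  have hs0 : 0 < s := lt_of_le_of_ne hs.1 (by rintro rfl; exact lt_irrefl _ h0)
  have hs1 : s < 1 := lt_of_le_of_ne hs.2 (by rintro rfl; exact lt_irrefl _ h1)
  obtain ⟨a, ha, hfa⟩ := exists_hasDerivAt_eq_slope f f' hs0
    (fun r hr => (hf r ⟨hr.1, hr.2.trans hs.2⟩).continuousAt.continuousWithinAt)
    (fun r hr => hf r ⟨hr.1.le, hr.2.le.trans hs.2⟩)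
  obtain ⟨b, hb, hfb⟩ := exists_hasDerivAt_eq_slope f f' hs1
    (fun r hr => (hf r ⟨hs.1.trans hr.1, hr.2⟩).continuousAt.continuousWithinAt)
    (fun r hr => hf r ⟨hs.1.trans hr.1.le, hr.2.le⟩)
  have hfa' : 0 < f' a := by rw [hfa]; apply div_pos <;> linarith
  have hfb' : f' b < 0 := by rw [hfb]; apply div_neg_of_neg_of_pos <;> linarith
  have hab : a < b := ha.2.trans hb.1
  have hsub : Icc a b ⊆ Icc 0 1 := Icc_subset_Icc ha.1.le hb.2.le
  have hc' : ContinuousOn f' (Icc a b) := fun r hr => (hf' r (hsub hr)).continuousAt.continuousWithinAt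
  -- the last zero of the derivative before `b`
  set Z := Icc a b ∩ f' ⁻¹' {0} with hZ
  have hZc : IsCompact Z := isCompact_Icc.of_isClosed_subset
    (hc'.preimage_isClosed_of_isClosed isClosed_Icc isClosed_singleton) inter_subset_left
  have hivt : ∀ r ∈ Icc a b, 0 ≤ f' r → ∃ z ∈ Z, r ≤ z := by
    intro r hr h0
    obtain ⟨z, hz, hz0⟩ := intermediate_value_Icc' hr.2
      (hc'.mono (Icc_subset_Icc_left hr.1)) ⟨hfb'.le, h0⟩
    exact ⟨z, ⟨⟨hr.1.trans hz.1, hz.2⟩, hz0⟩, hz.1⟩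
  obtain ⟨z0, hz0, -⟩ := hivt a ⟨le_rfl, hab.le⟩ hfa'.le
  obtain ⟨z, ⟨hzab, hz0⟩, hzmax⟩ := hZc.exists_isMaxOn ⟨z0, hz0⟩ continuousOn_id
  -- on `(z, b)` the derivative is negative, and it is monotone up to an exponential factor
  have hneg : ∀ r ∈ Ioo z b, f' r < 0 := by
    intro r hr
    by_contra! h0
    obtain ⟨w, hw, hrw⟩ := hivt r ⟨hzab.1.trans hr.1.le, hr.2.le⟩ h0
    exact absurd (hr.1.trans_le hrw) (not_lt.2 (hzmax hw))
  have hsub' : Icc z b ⊆ Icc 0 1 := (Icc_subset_Icc_left hzab.1).trans hsub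
  have hder : ∀ r ∈ Icc z b, HasDerivAt (fun r => f' r * Real.exp (-(K * r)))
      (f'' r * Real.exp (-(K * r)) + f' r * (Real.exp (-(K * r)) * (-(K * 1)))) r := fun r hr =>
    (hf' r (hsub' hr)).mul (((hasDerivAt_id r).const_mul K).neg.exp)
  have hmono : MonotoneOn (fun r => f' r * Real.exp (-(K * r))) (Icc z b) := by
    refine monotoneOn_of_deriv_nonneg (convex_Icc z b)
      (fun r hr => (hder r hr).continuousAt.continuousWithinAt) ?_ ?_
    · intro r hr
      rw [interior_Icc] at hr
      exact (hder r (Ioo_subset_Icc_self hr)).differentiableAt.differentiableWithinAt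
    · intro r hr
      rw [interior_Icc] at hr
      rw [(hder r (Ioo_subset_Icc_self hr)).deriv]
      have h1 := h r (hsub' (Ioo_subset_Icc_self hr))
      rw [abs_of_neg (hneg r hr)] at h1
      have : 0 ≤ (f'' r - K * f' r) * Real.exp (-(K * r)) :=
        mul_nonneg (by linarith) (Real.exp_pos _).le
      linarith
  have h2 := hmono ⟨le_rfl, hzab.2⟩ ⟨hzab.2, le_rfl⟩ hzab.2
  rw [mem_preimage, mem_singleton_iff] at hz0
  simp only [hz0, zero_mul] at h2
  have := mul_neg_of_neg_of_pos hfb' (Real.exp_pos (-(K * b)))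
  linarith

/-- A function with vanishing derivative at `0` and second derivative at least `-B` decreases by at
most `B` on `[0, 1]`. -/
theorem neg_le_sub_of_deriv2_ge {g g' g'' : ℝ → ℝ} {B : ℝ} (hB : 0 ≤ B)
    (hg : ∀ t ∈ Icc (0 : ℝ) 1, HasDerivAt g (g' t) t)
    (hg' : ∀ t ∈ Icc (0 : ℝ) 1, HasDerivAt g' (g'' t) t) (h0 : g' 0 = 0)
    (h : ∀ t ∈ Icc (0 : ℝ) 1, -B ≤ g'' t) : -B ≤ g 1 - g 0 := by
  obtain ⟨r, hr, hgr⟩ := exists_hasDerivAt_eq_slope g g' zero_lt_one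
    (fun r hr => (hg r hr).continuousAt.continuousWithinAt)
    (fun r hr => hg r (Ioo_subset_Icc_self hr))
  obtain ⟨t, ht, hgt⟩ := exists_hasDerivAt_eq_slope g' g'' hr.1
    (fun t ht => (hg' t ⟨ht.1, ht.2.trans hr.2.le⟩).continuousAt.continuousWithinAt)
    (fun t ht => hg' t ⟨ht.1.le, ht.2.le.trans hr.2.le⟩)
  have h1 := h t ⟨ht.1.le, ht.2.le.trans hr.2.le⟩
  rw [hgt, h0, sub_zero, sub_zero, le_div_iff₀ hr.1] at h1
  rw [sub_zero, div_one] at hgr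
  nlinarith [hr.2]

namespace RegCost

variable {U V : Set (Euc n)} {c : Euc n → Euc n → ℝ} (H : RegCost U V c) {x y : Euc n}
include H

theorem exists_gradX_bound : ∃ K : ℝ, 0 < K ∧ ∀ x ∈ closure U, ∀ y ∈ closure V,
    ‖gradX c x y‖ ≤ K := by
  obtain ⟨K, hK, hjet⟩ := H.exists_jet_bound
  refine ⟨K, hK, fun x hx y hy => ?_⟩
  have h1 := hjet x hx y hy 1 (by norm_num) ![(gradX c x y, 0)]
  rw [← inner_gradX (H.b0.contDiff x hx y hy), real_inner_self_eq_norm_mul_norm,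
    Fin.prod_univ_one] at h1
  have h2 := (le_abs_self _).trans h1
  have e : ‖(![((gradX c x y, 0) : Euc n × Euc n)] : Fin 1 → _) 0‖ = ‖gradX c x y‖ := by simp
  rw [e] at h2
  rcases (norm_nonneg (gradX c x y)).eq_or_lt with h | h
  · rw [← h]; exact hK.le
  · exact le_of_mul_le_mul_right h2 h

/-- Loeper's maximum principle at interior points. Along a segment `x(s)` in the coordinates at
`y₀`, let `f(s) = c(x(s), y₀) - c(x(s), y₁)`. Joining `y₀` to `y₁` by a segment in the coordinates
at `x(s)` and integrating the cross-curvature bound twice gives `f'' ≥ -K |f'|`. -/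
theorem maximum_principle_interior {K : ℝ} (hK0 : 0 ≤ K) (hK : CrossCurvatureBound U V c K)
    {x₀ x₁ y₀ y₁ : Euc n} (hx₀ : x₀ ∈ U) (hx₁ : x₁ ∈ U) (hx : x ∈ U) (hy₀ : y₀ ∈ V) (hy₁ : y₁ ∈ V)
    {s : ℝ} (hs : s ∈ Icc (0 : ℝ) 1)
    (hq : qMap c y₀ x = qMap c y₀ x₀ + s • (qMap c y₀ x₁ - qMap c y₀ x₀)) :
    c x y₀ - c x y₁ ≤ max (c x₀ y₀ - c x₀ y₁) (c x₁ y₀ - c x₁ y₁) := by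
  have cl : ∀ {x}, x ∈ U → x ∈ closure U := fun h => subset_closure h
  have cl' : ∀ {y}, y ∈ V → y ∈ closure V := fun h => subset_closure h
  obtain ⟨m, hm, hmlow⟩ := H.exists_mixedHess_lower
  obtain ⟨m', hm', hmlow'⟩ := H.norm_mixedHess_flip_lower
  obtain ⟨G, hG, hGb⟩ := H.exists_gradX_bound
  set q := qMap c y₀ x₀ with hqdef
  set ζ := qMap c y₀ x₁ - q with hζ
  have hdom : ∀ s ∈ Icc (0 : ℝ) 1, q + s • ζ ∈ coordDomain c U y₀ := fun s hs =>
    (H.b2.left y₀ (cl' hy₀)).add_smul_sub_mem ⟨x₀, hx₀, rfl⟩ ⟨x₁, hx₁, rfl⟩ hs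
  obtain ⟨X', X'', hX⟩ := H.exists_segment_derivs (q := q) (ζ := ζ) (cl' hy₀)
  set X : ℝ → Euc n := fun s => xOf c U y₀ (q + s • ζ) with hXdef
  have hXU : ∀ s ∈ Icc (0 : ℝ) 1, X s ∈ U := fun s hs => H.xOf_mem (hdom s hs) (cl' hy₀)
  have hX0 : X 0 = x₀ := by
    simp only [hXdef, zero_smul, add_zero]; exact H.xOf_qMap (cl hx₀) (cl' hy₀)
  have hX1 : X 1 = x₁ := by
    simp only [hXdef, one_smul, hζ, add_sub_cancel]; exact H.xOf_qMap (cl hx₁) (cl' hy₀)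
  have hXs : X s = x := by
    simp only [hXdef, ← hq]; exact H.xOf_qMap (cl hx) (cl' hy₀)
  have hC : ∀ s ∈ Icc (0 : ℝ) 1, ∀ y ∈ V, ContDiffAt ℝ 4 (Function.uncurry c) (X s, y) :=
    fun s hs y hy => H.b0.contDiff _ (cl (hXU s hs)) _ (cl' hy)
  have hf1 : ∀ y ∈ V, ∀ s ∈ Icc (0 : ℝ) 1,
      HasDerivAt (fun s => c (X s) y) (jet c 1 (X s) y ![(X' s, 0)]) s := fun y hy s hs =>
    jet_hasDerivAt (k := 0) (Y := fun _ => y) (hC s hs y hy) (by norm_num) (hX s (hdom s hs)).1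
      (hasDerivAt_const s y) ![]
  have hf2 : ∀ y ∈ V, ∀ s ∈ Icc (0 : ℝ) 1,
      HasDerivAt (fun s => jet c 1 (X s) y ![(X' s, 0)])
        (jet c 2 (X s) y ![(X' s, 0), (X' s, 0)] + jet c 1 (X s) y ![(X'' s, 0)]) s :=
    fun y hy s hs => jet_hasDerivAt_cons (k := 0) (Y := fun _ => y) (hC s hs y hy) (by norm_num)
      (hX s (hdom s hs)).1 (hasDerivAt_const s y)
      ((hX s (hdom s hs)).2.1.prodMk (hasDerivAt_const s (0 : Euc n))) ![]
  have key := le_max_of_deriv2_ge (K := K * (‖ζ‖ / m) * (2 * G / m'))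
    (fun s hs => (hf1 y₀ hy₀ s hs).sub (hf1 y₁ hy₁ s hs))
    (fun s hs => (hf2 y₀ hy₀ s hs).sub (hf2 y₁ hy₁ s hs)) ?_ hs
  · simpa only [Pi.sub_apply, hX0, hX1, hXs] using key
  clear hs hq hXs
  intro s hs
  have hxU := hXU s hs
  obtain ⟨-, -, hv, ha⟩ := hX s (hdom s hs)
  change ∀ w, jet c 2 (X s) y₀ _ = _ at hv
  change AffineLeft c (X s) y₀ _ _ at ha
  have hCs := hC s hs
  beta_reduce
  generalize X s = x at *
  generalize X' s = ξ at *
  generalize X'' s = ξ₂ at *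
  have hξn : ‖ξ‖ ≤ ‖ζ‖ / m := by
    have : mixedHess c x y₀ ξ = -ζ := ext_inner_right ℝ fun w => by
      rw [inner_mixedHess (hCs y₀ hy₀), hv, inner_neg_left]
    have h1 := hmlow x (cl hxU) y₀ (cl' hy₀) ξ
    rw [this, norm_neg] at h1
    rw [le_div_iff₀ hm]; linarith
  -- the dual segment from `y₀` to `y₁`
  set p := pMap c x y₀ with hp
  set ω := pMap c x y₁ - p with hω
  have hdomY : ∀ t ∈ Icc (0 : ℝ) 1, p + t • ω ∈ coordDomain (flipCost c) V x := fun t ht =>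
    (H.b2.right x (cl hxU)).add_smul_sub_mem ⟨y₀, hy₀, rfl⟩ ⟨y₁, hy₁, rfl⟩ ht
  obtain ⟨Y', Y'', hY⟩ := H.flip.exists_segment_derivs (q := p) (ζ := ω) (cl hxU)
  set Y : ℝ → Euc n := fun t => xOf (flipCost c) V x (p + t • ω) with hYdef
  have hYV : ∀ t ∈ Icc (0 : ℝ) 1, Y t ∈ V := fun t ht => H.flip.xOf_mem (hdomY t ht) (cl hxU)
  have hY0 : Y 0 = y₀ := by
    simp only [hYdef, zero_smul, add_zero]; exact H.flip.xOf_qMap (cl' hy₀) (cl hxU)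
  have hY1 : Y 1 = y₁ := by
    simp only [hYdef, one_smul, hω, add_sub_cancel]; exact H.flip.xOf_qMap (cl' hy₁) (cl hxU)
  have hCt : ∀ t ∈ Icc (0 : ℝ) 1, ContDiffAt ℝ 4 (Function.uncurry c) (x, Y t) := fun t ht =>
    hCs _ (hYV t ht)
  have hYv : ∀ t ∈ Icc (0 : ℝ) 1, ∀ w, jet c 2 x (Y t) ![(w, 0), (0, Y' t)] = -⟪ω, w⟫_ℝ := by
    intro t ht w
    rw [← H.inner_mixedHess_flip (cl hxU) (cl' (hYV t ht)),
      inner_mixedHess (contDiffAt_flipCost (hCt t ht))]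
    exact (hY t (hdomY t ht)).2.2.1 w
  have hYa : ∀ t ∈ Icc (0 : ℝ) 1, AffineRight c x (Y t) (Y' t) (Y'' t) := fun t ht =>
    affineLeft_flipCost.1 (hY t (hdomY t ht)).2.2.2
  have hωn : ‖ω‖ ≤ 2 * G := by
    have h1 := hGb x (cl hxU) y₀ (cl' hy₀)
    have h2 := hGb x (cl hxU) y₁ (cl' hy₁)
    have h3 := norm_sub_le (pMap c x y₁) p
    rw [hp, pMap, pMap, norm_neg, norm_neg] at h3
    rw [hω, hp, pMap, pMap]; linarith
  have hYn : ∀ t ∈ Icc (0 : ℝ) 1, ‖Y' t‖ ≤ 2 * G / m' := by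
    intro t ht
    have : mixedHess (flipCost c) (Y t) x (Y' t) = -ω := ext_inner_right ℝ fun w => by
      rw [H.inner_mixedHess_flip (cl hxU) (cl' (hYV t ht)), hYv t ht, inner_neg_left]
    have h1 := hmlow' x (cl hxU) (Y t) (cl' (hYV t ht)) (Y' t)
    rw [this, norm_neg] at h1
    rw [le_div_iff₀ hm']; linarith
  have hfω : jet c 1 x y₀ ![(ξ, 0)] - jet c 1 x y₁ ![(ξ, 0)] = ⟪ω, ξ⟫_ℝ := by
    rw [← inner_gradX (hCs y₀ hy₀), ← inner_gradX (hCs y₁ hy₁), hω, hp, pMap, pMap,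
      inner_sub_left, inner_neg_left, inner_neg_left]
    ring
  rw [hfω]
  -- minus the second derivative in `s` of `c (x(s), y(t))`, as a function of `t`
  have hg := neg_le_sub_of_deriv2_ge (B := K * (‖ζ‖ / m) * (2 * G / m') * |⟪ω, ξ⟫_ℝ|)
    (g := fun t => -(jet c 2 x (Y t) ![(ξ, 0), (ξ, 0)] + jet c 1 x (Y t) ![(ξ₂, 0)]))
    (g' := fun t => -(jet c 3 x (Y t) ![(0, Y' t), (ξ, 0), (ξ, 0)] +
      jet c 2 x (Y t) ![(0, Y' t), (ξ₂, 0)]))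
    (g'' := fun t => -((jet c 4 x (Y t) ![(0, Y' t), (0, Y' t), (ξ, 0), (ξ, 0)] +
      jet c 3 x (Y t) ![(0, Y'' t), (ξ, 0), (ξ, 0)]) +
      (jet c 3 x (Y t) ![(0, Y' t), (0, Y' t), (ξ₂, 0)] +
      jet c 2 x (Y t) ![(0, Y'' t), (ξ₂, 0)]))) (by positivity) ?_ ?_ ?_ ?_
  · simp only [hY0, hY1] at hg
    linarith
  · intro t ht
    have hYt := (hY t (hdomY t ht)).1
    exact ((jet_hasDerivAt (k := 2) (X := fun _ => x) (hCt t ht) (by norm_num)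
      (hasDerivAt_const t x) hYt _).add (jet_hasDerivAt (k := 1) (X := fun _ => x) (hCt t ht)
      (by norm_num) (hasDerivAt_const t x) hYt _)).neg
  · intro t ht
    have hYt := (hY t (hdomY t ht)).1
    have hYt2 := (hY t (hdomY t ht)).2.1
    exact ((jet_hasDerivAt_cons (k := 2) (X := fun _ => x) (hCt t ht) (by norm_num)
      (hasDerivAt_const t x) hYt ((hasDerivAt_const t (0 : Euc n)).prodMk hYt2) _).add
      (jet_hasDerivAt_cons (k := 1) (X := fun _ => x) (hCt t ht)
      (by norm_num) (hasDerivAt_const t x) hYt ((hasDerivAt_const t (0 : Euc n)).prodMk hYt2)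
      _)).neg
  · have hc := hCs y₀ hy₀
    have h1 := ha (Y' 0)
    simp only [hY0]
    rw [jet_three_swap hc, jet_three_swap' hc, jet_two_comm hc, h1, neg_zero]
  · intro t ht
    have hc := hCt t ht
    obtain ⟨ξ', hξ'⟩ := H.exists_affineLeft (cl hxU) (cl' (hYV t ht)) ξ
    have h1 := hK x hxU (Y t) (hYV t ht) ξ ξ' (Y' t) (Y'' t) hξ' (hYa t ht)
    have h2 := hYa t ht ξ₂
    have h3 := hξ' (Y'' t)
    rw [← jet_three_swap' hc, ← jet_three_swap hc, jet_three_swap' hc] at h3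
    rw [jet_four_pairs hc, hYv t ht ξ, abs_neg] at h1
    have h4 : K * |⟪ω, ξ⟫_ℝ| * ‖ξ‖ * ‖Y' t‖ ≤
        K * |⟪ω, ξ⟫_ℝ| * (‖ζ‖ / m) * (2 * G / m') := by
      have := hYn t ht
      gcongr
    linarith

theorem tendsto_qMap {ι : Type*} {l : Filter ι} {z w : ι → Euc n} (hx : x ∈ closure U)
    (hy : y ∈ closure V) (hz : Filter.Tendsto z l (𝓝 x)) (hw : Filter.Tendsto w l (𝓝 y)) :
    Filter.Tendsto (fun k => qMap c (w k) (z k)) l (𝓝 (qMap c y x)) :=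
  Filter.Tendsto.comp (g := fun z : Euc n × Euc n => qMap c z.2 z.1) (f := fun k => (z k, w k))
    (H.continuousAt_qMap hx hy) (hz.prodMk_nhds hw)

theorem tendsto_cost {ι : Type*} {l : Filter ι} {z w : ι → Euc n} (hx : x ∈ closure U)
    (hy : y ∈ closure V) (hz : Filter.Tendsto z l (𝓝 x)) (hw : Filter.Tendsto w l (𝓝 y)) :
    Filter.Tendsto (fun k => c (z k) (w k)) l (𝓝 (c x y)) :=
  Filter.Tendsto.comp (g := Function.uncurry c) (f := fun k => (z k, w k))
    (H.b0.contDiff x hx y hy).continuousAt (hz.prodMk_nhds hw)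

/-- Loeper's maximum principle: `q ↦ -c(x(q), y₁) + c(x(q), y₀)` is quasi-convex in the
coordinates at `y₀`. The points may lie on the boundary, where the statement follows by
approximation, the coordinate maps being injective on the closures. -/
theorem maximum_principle {K : ℝ} (hK0 : 0 ≤ K) (hK : CrossCurvatureBound U V c K)
    {x₀ x₁ y₀ y₁ : Euc n}
    (hx₀ : x₀ ∈ closure U) (hx₁ : x₁ ∈ closure U) (hx : x ∈ closure U)
    (hy₀ : y₀ ∈ closure V) (hy₁ : y₁ ∈ closure V) {s : ℝ} (hs : s ∈ Icc (0 : ℝ) 1)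
    (hq : qMap c y₀ x = qMap c y₀ x₀ + s • (qMap c y₀ x₁ - qMap c y₀ x₀)) :
    c x y₀ - c x y₁ ≤ max (c x₀ y₀ - c x₀ y₁) (c x₁ y₀ - c x₁ y₁) := by
  obtain ⟨a₀, ha₀, la₀⟩ := mem_closure_iff_seq_limit.1 hx₀
  obtain ⟨a₁, ha₁, la₁⟩ := mem_closure_iff_seq_limit.1 hx₁
  obtain ⟨b₀, hb₀, lb₀⟩ := mem_closure_iff_seq_limit.1 hy₀
  obtain ⟨b₁, hb₁, lb₁⟩ := mem_closure_iff_seq_limit.1 hy₁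
  have hex : ∀ k, ∃ a ∈ U, qMap c (b₀ k) a =
      qMap c (b₀ k) (a₀ k) + s • (qMap c (b₀ k) (a₁ k) - qMap c (b₀ k) (a₀ k)) := fun k =>
    (H.b2.left (b₀ k) (subset_closure (hb₀ k))).add_smul_sub_mem ⟨a₀ k, ha₀ k, rfl⟩
      ⟨a₁ k, ha₁ k, rfl⟩ hs
  choose a ha haq using hex
  obtain ⟨x', hx', φ, hφ, hlim⟩ := H.isCompact_left.tendsto_subseq
    (fun k => subset_closure (ha k))
  have la₀ := la₀.comp hφ.tendsto_atTop
  have la₁ := la₁.comp hφ.tendsto_atTop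
  have lb₀ := lb₀.comp hφ.tendsto_atTop
  have lb₁ := lb₁.comp hφ.tendsto_atTop
  have hxx' : x' = x := by
    refine H.injOn_qMap hy₀ hx' hx ?_
    rw [hq]
    refine tendsto_nhds_unique (H.tendsto_qMap hx' hy₀ hlim lb₀) ?_
    have t₀ := H.tendsto_qMap hx₀ hy₀ la₀ lb₀
    have t₁ := H.tendsto_qMap hx₁ hy₀ la₁ lb₀
    have t := t₀.add ((t₁.sub t₀).const_smul s)
    exact t.congr fun k => (haq (φ k)).symm
  subst hxx'
  have t := (H.tendsto_cost hx' hy₀ hlim lb₀).sub (H.tendsto_cost hx' hy₁ hlim lb₁)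
  have t₀ := (H.tendsto_cost hx₀ hy₀ la₀ lb₀).sub (H.tendsto_cost hx₀ hy₁ la₀ lb₁)
  have t₁ := (H.tendsto_cost hx₁ hy₀ la₁ lb₀).sub (H.tendsto_cost hx₁ hy₁ la₁ lb₁)
  exact le_of_tendsto_of_tendsto' t (t₀.max t₁) fun k =>
    H.maximum_principle_interior hK0 hK (ha₀ (φ k)) (ha₁ (φ k)) (ha (φ k)) (hb₀ (φ k)) (hb₁ (φ k))
      hs (haq (φ k))

/-- The dual maximum principle, for segments in the second variable. -/
theorem maximum_principle_dual {K : ℝ} (hK0 : 0 ≤ K) (hK : CrossCurvatureBound U V c K)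
    {x₀ x₁ y₀ y₁ y : Euc n}
    (hx₀ : x₀ ∈ closure U) (hx₁ : x₁ ∈ closure U)
    (hy₀ : y₀ ∈ closure V) (hy₁ : y₁ ∈ closure V) (hy : y ∈ closure V)
    {s : ℝ} (hs : s ∈ Icc (0 : ℝ) 1)
    (hp : pMap c x₀ y = pMap c x₀ y₀ + s • (pMap c x₀ y₁ - pMap c x₀ y₀)) :
    c x₀ y - c x₁ y ≤ max (c x₀ y₀ - c x₁ y₀) (c x₀ y₁ - c x₁ y₁) :=
  H.flip.maximum_principle hK0 (H.crossCurvatureBound_flip hK) hy₀ hy₁ hy hx₀ hx₁ hs hp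

end RegCost

/-! ### Supports of a function and of a cone -/

/-- The properties of a function `F`, minus the modified cost at `ȳ`, on `O × B` that the height
estimate rests on: `F` vanishes at `ȳ`, `G = ∇_q F` is injective in `y` and has an oscillation in
`q` controlled by its own size, `F` is quasi-convex in `q`, and any two points of `B` are joined by
a curve which is a segment in the coordinates `G q` and along which differences of `F` satisfy the
maximum principle. -/
structure CostChart (O B : Set (Euc n)) (F : Euc n → Euc n → ℝ) (G : Euc n → Euc n → Euc n)
    (ybar : Euc n) (K : ℝ) : Prop where
  isOpen : IsOpen O
  isCompact : IsCompact B
  ybar_mem : ybar ∈ B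
  continuousOn : ContinuousOn (Function.uncurry F) (closure O ×ˢ B)
  apply_ybar : ∀ q, F q ybar = 0
  hasGradientAt : ∀ q ∈ O, ∀ y ∈ B, HasGradientAt (fun q => F q y) (G q y) q
  continuousOn_grad : ∀ q ∈ O, ContinuousOn (G q) B
  injOn : ∀ q ∈ O, InjOn (G q) B
  nonneg : 0 ≤ K
  oscillation : ∀ q ∈ O, ∀ q' ∈ O, ∀ y ∈ B, ‖G q y - G q' y‖ ≤ K * ‖q - q'‖ * ‖G q' y‖
  convex : Convex ℝ (closure O)
  quasiconvex : ∀ y ∈ B, ∀ q₀ ∈ closure O, ∀ q₁ ∈ closure O, ∀ s ∈ Icc (0 : ℝ) 1,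
    F (q₀ + s • (q₁ - q₀)) y ≤ max (F q₀ y) (F q₁ y)
  segment : ∀ q ∈ O, ∀ y₀ ∈ B, ∀ y₁ ∈ B, ∃ γ : ℝ → Euc n, ContinuousOn γ (Icc 0 1) ∧
    ∀ s ∈ Icc (0 : ℝ) 1, γ s ∈ B ∧ G q (γ s) = G q y₀ + s • (G q y₁ - G q y₀) ∧
      ∀ q' ∈ closure O, F q' (γ s) - F q (γ s) ≤ max (F q' y₀ - F q y₀) (F q' y₁ - F q y₁)

/-- The points `y` such that `F (·, y)` supports `u` from below at `q`, up to a constant. -/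
def supports (X B : Set (Euc n)) (F : Euc n → Euc n → ℝ) (u : Euc n → ℝ) (q : Euc n) :
    Set (Euc n) :=
  {y ∈ B | ∀ q' ∈ X, F q' y - F q y + u q ≤ u q'}

/-- The points `y` such that the translate of `F (·, y)` with value `u q₀` at `q₀` is nonpositive on
`Q`: the subdifferential at its vertex of the cone over `Q` with vertex `(q₀, u q₀)`. -/
def coneSupports (Q B : Set (Euc n)) (F : Euc n → Euc n → ℝ) (u : Euc n → ℝ) (q₀ : Euc n) :
    Set (Euc n) :=
  {y ∈ B | ∀ q ∈ Q, F q y - F q₀ y + u q₀ ≤ 0}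

namespace CostChart

variable {O B : Set (Euc n)} {F : Euc n → Euc n → ℝ} {G : Euc n → Euc n → Euc n} {ybar : Euc n}
  {K : ℝ} (S : CostChart O B F G ybar K) {u : Euc n → ℝ}
include S

theorem continuousOn_left {y : Euc n} (hy : y ∈ B) : ContinuousOn (fun q => F q y) (closure O) :=
  S.continuousOn.comp (f := fun q => (q, y)) (by fun_prop) fun _ hq => ⟨hq, hy⟩

theorem continuousOn_right {q : Euc n} (hq : q ∈ closure O) : ContinuousOn (F q) B :=
  S.continuousOn.comp (f := fun y => (q, y)) (by fun_prop) fun _ hy => ⟨hq, hy⟩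

theorem grad_ybar {q : Euc n} (hq : q ∈ O) : G q ybar = 0 := by
  refine (S.hasGradientAt q hq ybar S.ybar_mem).unique ?_
  rw [show (fun q => F q ybar) = fun _ => 0 from funext S.apply_ybar]
  exact hasGradientAt_const q 0

theorem hasDerivAt_line {q v y : Euc n} {s : ℝ} (hq : q + s • v ∈ O) (hy : y ∈ B) :
    HasDerivAt (fun r : ℝ => F (q + r • v) y) ⟪G (q + s • v) y, v⟫_ℝ s := by
  have h1 := (S.hasGradientAt _ hq y hy).hasFDerivAt
  have hl : HasDerivAt (fun r : ℝ => q + r • v) v s := by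
    simpa using ((hasDerivAt_id s).smul_const v).const_add q
  have h2 := h1.comp_hasDerivAt s hl
  rw [InnerProductSpace.toDual_apply_apply] at h2
  exact h2

/-- The mean value inequality along a segment, the gradient being compared with its value at a
further point `q₀`. -/
theorem sub_le_of_segment {q v q₀ y : Euc n} {s ρ : ℝ} (hs : 0 ≤ s)
    (hseg : ∀ r ∈ Icc (0 : ℝ) s, q + r • v ∈ O ∧ ‖q + r • v - q₀‖ ≤ ρ) (hq₀ : q₀ ∈ O) (hy : y ∈ B) :
    F (q + s • v) y - F q y ≤ s * (⟪G q₀ y, v⟫_ℝ + K * ρ * ‖G q₀ y‖ * ‖v‖) := by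
  rcases hs.eq_or_lt with rfl | hs
  · simp
  obtain ⟨r, hr, hslope⟩ := exists_hasDerivAt_eq_slope (fun r : ℝ => F (q + r • v) y)
    (fun r => ⟪G (q + r • v) y, v⟫_ℝ) hs
    (fun r hr => (S.hasDerivAt_line (hseg r hr).1 hy).continuousAt.continuousWithinAt)
    (fun r hr => S.hasDerivAt_line (hseg r ⟨hr.1.le, hr.2.le⟩).1 hy)
  obtain ⟨h1, h2⟩ := hseg r ⟨hr.1.le, hr.2.le⟩
  rw [eq_div_iff (by linarith)] at hslope
  simp only [zero_smul, add_zero, sub_zero] at hslope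
  rw [← hslope, mul_comm]
  refine mul_le_mul_of_nonneg_left ?_ hs.le
  have h3 : ⟪G (q + r • v) y, v⟫_ℝ = ⟪G q₀ y, v⟫_ℝ + ⟪G (q + r • v) y - G q₀ y, v⟫_ℝ := by
    rw [inner_sub_left]; ring
  rw [h3]
  gcongr
  refine (real_inner_le_norm _ _).trans ?_
  gcongr
  refine (S.oscillation _ h1 _ hq₀ y hy).trans ?_
  have := S.nonneg
  gcongr

theorem lowerSemicontinuousOn (hu : ∀ q ∈ closure O, (supports (closure O) B F u q).Nonempty) :
    LowerSemicontinuousOn u (closure O) := by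
  intro q hq a ha
  obtain ⟨y, hy, hsup⟩ := hu q hq
  have hc : ContinuousWithinAt (fun q' => F q' y - F q y + u q) (closure O) q :=
    ((S.continuousOn_left hy q hq).sub continuousWithinAt_const).add continuousWithinAt_const
  have : ∀ᶠ q' in 𝓝[closure O] q, a < F q' y - F q y + u q :=
    hc.tendsto.eventually (by simpa using lt_mem_nhds ha)
  filter_upwards [this, self_mem_nhdsWithin] with q' h1 h2
  exact h1.trans_le (hsup q' h2)

/-- Sections are convex, because the supports are quasi-convex. -/
theorem convex_sublevel (hu : ∀ q ∈ closure O, (supports (closure O) B F u q).Nonempty) :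
    Convex ℝ {q ∈ closure O | u q ≤ 0} := by
  rintro q₀ ⟨h₀, hu₀⟩ q₁ ⟨h₁, hu₁⟩ a b ha hb hab
  have hmem := S.convex h₀ h₁ ha hb hab
  refine ⟨hmem, ?_⟩
  obtain ⟨y, hy, hsup⟩ := hu _ hmem
  have h1 := S.quasiconvex y hy q₀ h₀ q₁ h₁ b ⟨hb, by linarith⟩
  rw [show q₀ + b • (q₁ - q₀) = a • q₀ + b • q₁ by
    rw [show a = 1 - b by linarith]; module] at h1
  rcases max_cases (F q₀ y) (F q₁ y) with ⟨h2, -⟩ | ⟨h2, -⟩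
  · linarith [hsup q₀ h₀]
  · linarith [hsup q₁ h₁]

/-- The graph of the subdifferential is closed, `u` being lower semicontinuous. -/
theorem supports_of_tendsto (hu : ∀ q ∈ closure O, (supports (closure O) B F u q).Nonempty)
    {q : ℕ → Euc n} {y : ℕ → Euc n} {q₀ y₀ : Euc n} (hq₀ : q₀ ∈ closure O)
    (hq : ∀ᶠ k in Filter.atTop, y k ∈ supports (closure O) B F u (q k))
    (hqX : ∀ᶠ k in Filter.atTop, q k ∈ closure O)
    (lq : Filter.Tendsto q Filter.atTop (𝓝 q₀)) (ly : Filter.Tendsto y Filter.atTop (𝓝 y₀)) :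
    y₀ ∈ supports (closure O) B F u q₀ := by
  have hyB : ∀ᶠ k in Filter.atTop, y k ∈ B := hq.mono fun k hk => hk.1
  have hy₀ : y₀ ∈ B := S.isCompact.isClosed.mem_of_tendsto ly hyB
  have lim : ∀ {z : ℕ → Euc n} {z₀}, z₀ ∈ closure O → (∀ᶠ k in Filter.atTop, z k ∈ closure O) →
      Filter.Tendsto z Filter.atTop (𝓝 z₀) →
      Filter.Tendsto (fun k => F (z k) (y k)) Filter.atTop (𝓝 (F z₀ y₀)) := by
    intro z z₀ hz₀ hz lz
    have h1 : Filter.Tendsto (Function.uncurry F) (𝓝[closure O ×ˢ B] (z₀, y₀)) (𝓝 (F z₀ y₀)) :=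
      S.continuousOn (z₀, y₀) ⟨hz₀, hy₀⟩
    refine Filter.Tendsto.comp (f := fun k => (z k, y k)) h1 ?_
    exact tendsto_nhdsWithin_iff.2 ⟨lz.prodMk_nhds ly, (hz.and hyB).mono fun k hk => hk⟩
  refine ⟨hy₀, fun q' hq' => ?_⟩
  rw [add_comm, ← le_sub_iff_add_le]
  refine le_of_forall_lt fun a ha => ?_
  obtain ⟨b, hab, hb⟩ := exists_between ha
  refine hab.trans_le ?_
  have hlow : ∀ᶠ k in Filter.atTop, b < u (q k) :=
    (tendsto_nhdsWithin_iff.2 ⟨lq, hqX⟩).eventually (S.lowerSemicontinuousOn hu q₀ hq₀ b hb)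
  have l1 := lim (z := fun _ => q') hq' (Filter.Eventually.of_forall fun _ => hq')
    tendsto_const_nhds
  have l2 := lim hq₀ hqX lq
  refine ge_of_tendsto (tendsto_const_nhds.sub (l1.sub l2)) ?_
  filter_upwards [hq, hlow] with k h1 h2
  linarith [h1.2 q' hq']

/-- The gradients at `q` of the supports at `q` form a convex set. -/
theorem convex_grad_supports {q : Euc n} (hq : q ∈ O) :
    Convex ℝ (G q '' supports (closure O) B F u q) := by
  rintro _ ⟨y₀, hy₀, rfl⟩ _ ⟨y₁, hy₁, rfl⟩ a b ha hb hab
  obtain ⟨γ, -, hγ⟩ := S.segment q hq y₀ hy₀.1 y₁ hy₁.1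
  obtain ⟨hB, hG, hF⟩ := hγ b ⟨hb, by linarith⟩
  refine ⟨γ b, ⟨hB, fun q' hq' => ?_⟩, ?_⟩
  · have h1 := hF q' hq'
    have h2 := hy₀.2 q' hq'
    have h3 := hy₁.2 q' hq'
    have : max (F q' y₀ - F q y₀) (F q' y₁ - F q y₁) ≤ u q' - u q :=
      max_le (by linarith) (by linarith)
    linarith
  · rw [hG, show a = 1 - b by linarith]; module

theorem convex_grad_coneSupports {Q : Set (Euc n)} (hQ : Q ⊆ closure O) {q : Euc n} (hq : q ∈ O) :
    Convex ℝ (G q '' coneSupports Q B F u q) := by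
  rintro _ ⟨y₀, hy₀, rfl⟩ _ ⟨y₁, hy₁, rfl⟩ a b ha hb hab
  obtain ⟨γ, -, hγ⟩ := S.segment q hq y₀ hy₀.1 y₁ hy₁.1
  obtain ⟨hB, hG, hF⟩ := hγ b ⟨hb, by linarith⟩
  refine ⟨γ b, ⟨hB, fun q' hq' => ?_⟩, ?_⟩
  · have h1 := hF q' (hQ hq')
    have h2 := hy₀.2 q' hq'
    have h3 := hy₁.2 q' hq'
    have : max (F q' y₀ - F q y₀) (F q' y₁ - F q y₁) ≤ - u q := max_le (by linarith) (by linarith)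
    linarith
  · rw [hG, show a = 1 - b by linarith]; module

theorem isCompact_supports (hu : ∀ q ∈ closure O, (supports (closure O) B F u q).Nonempty)
    {q : Euc n} (hq : q ∈ closure O) : IsCompact (supports (closure O) B F u q) := by
  refine S.isCompact.of_isClosed_subset ?_ fun y hy => hy.1
  refine IsSeqClosed.isClosed fun y y₀ hy ly => ?_
  exact S.supports_of_tendsto hu hq (Filter.Eventually.of_forall hy)
    (Filter.Eventually.of_forall fun _ => hq) tendsto_const_nhds ly

/-- The growth of `u` at `q₀` in a direction is bounded by the gradients of its supports at `q₀`. -/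
theorem exists_support_of_growth
    (hu : ∀ q ∈ closure O, (supports (closure O) B F u q).Nonempty) {q₀ v : Euc n} (hq₀ : q₀ ∈ O)
    {ψ : ℝ → ℝ} {a : ℝ} (hψ : HasDerivAt ψ a 0) (hψ0 : ψ 0 = 0)
    (hgrow : ∀ᶠ δ in 𝓝[>] (0 : ℝ), u q₀ + ψ δ ≤ u (q₀ + δ • v)) :
    ∃ y ∈ supports (closure O) B F u q₀, a ≤ ⟪G q₀ y, v⟫_ℝ := by
  have hcont : ContinuousAt (fun δ : ℝ => q₀ + δ • v) 0 := by fun_prop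
  have hin : ∀ᶠ δ in 𝓝 (0 : ℝ), ∀ r ∈ Icc 0 δ, q₀ + r • v ∈ O := by
    have h1 : ∀ᶠ δ in 𝓝 (0 : ℝ), q₀ + δ • v ∈ O :=
      hcont.eventually (by simpa using S.isOpen.mem_nhds hq₀)
    obtain ⟨ε, hε, hball⟩ := Metric.eventually_nhds_iff.1 h1
    refine Metric.eventually_nhds_iff.2 ⟨ε, hε, fun δ hδ r hr => hball ?_⟩
    rw [Real.dist_eq, sub_zero] at hδ ⊢
    rw [abs_of_nonneg hr.1]
    exact (hr.2.trans (le_abs_self δ)).trans_lt hδ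
  have hall := (hgrow.and (hin.filter_mono nhdsWithin_le_nhds)).and self_mem_nhdsWithin
  obtain ⟨δ, lδ, hδ⟩ := Filter.exists_seq_forall_of_frequently hall.frequently
  have hδX : ∀ k, q₀ + δ k • v ∈ closure O := fun k =>
    subset_closure ((hδ k).1.2 _ ⟨le_of_lt (hδ k).2, le_rfl⟩)
  choose y hy using fun k => hu _ (hδX k)
  obtain ⟨y₀, hy₀, φ, hφ, ly⟩ := S.isCompact.tendsto_subseq fun k => (hy k).1
  have lδ0 : Filter.Tendsto (fun k => δ (φ k)) Filter.atTop (𝓝 0) :=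
    (lδ.mono_right nhdsWithin_le_nhds).comp hφ.tendsto_atTop
  have lq : Filter.Tendsto (fun k => q₀ + δ (φ k) • v) Filter.atTop (𝓝 q₀) := by
    have := hcont.tendsto.comp lδ0
    simpa [Function.comp_def] using this
  refine ⟨y₀, S.supports_of_tendsto hu (subset_closure hq₀)
    (Filter.Eventually.of_forall fun k => hy (φ k)) (Filter.Eventually.of_forall fun k => hδX (φ k))
    lq ly, ?_⟩
  have lG : Filter.Tendsto (fun k => G q₀ (y (φ k))) Filter.atTop (𝓝 (G q₀ y₀)) :=
    (S.continuousOn_grad q₀ hq₀ y₀ hy₀).tendsto.comp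
      (tendsto_nhdsWithin_iff.2 ⟨ly, Filter.Eventually.of_forall fun k => (hy (φ k)).1⟩)
  have lψ : Filter.Tendsto (fun k => (δ (φ k))⁻¹ * ψ (δ (φ k))) Filter.atTop (𝓝 a) := by
    have h1 := hψ.tendsto_slope_zero_right.comp (lδ.comp hφ.tendsto_atTop)
    simpa [hψ0, Function.comp_def] using h1
  have lrhs : Filter.Tendsto (fun k => ⟪G q₀ (y (φ k)), v⟫_ℝ +
      K * (δ (φ k) * ‖v‖) * ‖G q₀ (y (φ k))‖ * ‖v‖) Filter.atTop
      (𝓝 (⟪G q₀ y₀, v⟫_ℝ + K * (0 * ‖v‖) * ‖G q₀ y₀‖ * ‖v‖)) :=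
    (lG.inner tendsto_const_nhds).add ((((lδ0.mul_const _).const_mul K).mul lG.norm).mul_const _)
  have hle := le_of_tendsto_of_tendsto' lψ lrhs fun k => ?_
  · simpa using hle
  obtain ⟨⟨hg, hseg⟩, hpos⟩ := hδ (φ k)
  have hpos : 0 < δ (φ k) := hpos
  have h1 := S.sub_le_of_segment (q := q₀) (v := v) (q₀ := q₀) (ρ := δ (φ k) * ‖v‖) hpos.le
    (fun r hr => ⟨hseg r hr, by
      rw [add_sub_cancel_left, norm_smul, Real.norm_eq_abs, abs_of_nonneg hr.1]
      exact mul_le_mul_of_nonneg_right hr.2 (norm_nonneg _)⟩) hq₀ (hy (φ k)).1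
  have h2 := (hy (φ k)).2 q₀ (subset_closure hq₀)
  rw [inv_mul_le_iff₀ hpos]
  linarith

/-- A local support is a global one: otherwise its gradient is separated from the convex set of
gradients of global supports, against `exists_support_of_growth` in the separating direction. -/
theorem mem_supports_of_local
    (hu : ∀ q ∈ closure O, (supports (closure O) B F u q).Nonempty) {q₀ y : Euc n} (hq₀ : q₀ ∈ O)
    (hy : y ∈ B) (hloc : ∀ᶠ q in 𝓝 q₀, F q y - F q₀ y + u q₀ ≤ u q) :
    y ∈ supports (closure O) B F u q₀ := by
  have hcpt : IsCompact (G q₀ '' supports (closure O) B F u q₀) :=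
    (S.isCompact_supports hu (subset_closure hq₀)).image_of_continuousOn
      ((S.continuousOn_grad q₀ hq₀).mono fun y hy => hy.1)
  by_cases hmem : G q₀ y ∈ G q₀ '' supports (closure O) B F u q₀
  · obtain ⟨y', hy', he⟩ := hmem
    rwa [← S.injOn q₀ hq₀ hy'.1 hy he]
  obtain ⟨f, a, hf, ha⟩ := geometric_hahn_banach_closed_point (S.convex_grad_supports hq₀)
    hcpt.isClosed hmem
  set v := (InnerProductSpace.toDual ℝ (Euc n)).symm f with hv
  have hfv : ∀ p, f p = ⟪p, v⟫_ℝ := fun p => by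
    rw [real_inner_comm, hv, InnerProductSpace.toDual_symm_apply]
  have hd := S.hasDerivAt_line (q := q₀) (v := v) (s := 0) (by simpa using hq₀) hy
  obtain ⟨y', hy', hle⟩ := S.exists_support_of_growth hu (v := v) hq₀ (hd.sub_const (F q₀ y))
    (by simp) (by
      have hcont : Filter.Tendsto (fun δ : ℝ => q₀ + δ • v) (𝓝[>] 0) (𝓝 q₀) := by
        have : Continuous (fun δ : ℝ => q₀ + δ • v) := by fun_prop
        simpa using (this.tendsto 0).mono_left nhdsWithin_le_nhds
      filter_upwards [hcont.eventually hloc] with δ hδ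
      linarith)
  have h1 := hf _ ⟨y', hy', rfl⟩
  rw [hfv] at h1 ha
  simp only [zero_smul, add_zero] at hle
  linarith

/-- Every normal direction of a sublevel set at a boundary point is, up to a positive factor, the
gradient of a support: otherwise a direction separating the normal ray from the gradients would
leave the sublevel set without `u` increasing. -/
theorem exists_support_normal
    (hu : ∀ q ∈ closure O, (supports (closure O) B F u q).Nonempty) {q₀ e : Euc n} (hq₀ : q₀ ∈ O)
    (hu0 : u q₀ = 0) (he : e ≠ 0) (hnormal : ∀ q ∈ closure O, u q ≤ 0 → ⟪e, q - q₀⟫_ℝ ≤ 0)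
    (hneg : ∃ q ∈ closure O, u q < 0) :
    ∃ y ∈ supports (closure O) B F u q₀, ∃ l : ℝ, 0 < l ∧ G q₀ y = l • e := by
  set P := G q₀ '' supports (closure O) B F u q₀ with hP
  have hcpt : IsCompact P :=
    (S.isCompact_supports hu (subset_closure hq₀)).image_of_continuousOn
      ((S.continuousOn_grad q₀ hq₀).mono fun y hy => hy.1)
  set R := (fun l : ℝ => l • e) '' Ici 0 with hR
  have hRclosed : IsClosed R := isClosedMap_smul_left e _ isClosed_Ici
  have hRconv : Convex ℝ R := (convex_Ici (0 : ℝ)).is_linear_image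
    ((LinearMap.toSpanSingleton ℝ (Euc n) e).isLinear)
  by_cases hdis : Disjoint P R
  · exfalso
    obtain ⟨f, a, b, hfa, hab, hfb⟩ := geometric_hahn_banach_compact_closed
      (S.convex_grad_supports hq₀) hcpt hRconv hRclosed hdis
    set w := (InnerProductSpace.toDual ℝ (Euc n)).symm f with hw
    have hfw : ∀ p, f p = ⟪p, w⟫_ℝ := fun p => by
      rw [real_inner_comm, hw, InnerProductSpace.toDual_symm_apply]
    have hb0 : b < 0 := by simpa using hfb 0 ⟨0, by simp, by simp⟩
    have hfe : 0 ≤ f e := by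
      by_contra! hlt
      have := hfb ((b / f e) • e) ⟨b / f e, (div_pos_of_neg_of_neg hb0 hlt).le, rfl⟩
      rw [map_smul, smul_eq_mul, div_mul_cancel₀ _ hlt.ne] at this
      exact lt_irrefl _ this
    obtain ⟨M, hM⟩ := hcpt.isBounded.exists_norm_le
    set η := -b / (‖e‖ * (|M| + 1)) with hη
    have hen : 0 < ‖e‖ := norm_pos_iff.2 he
    have hηpos : 0 < η := div_pos (by linarith) (by positivity)
    -- tilting the separating direction towards `e` makes it point strictly outwards
    obtain ⟨y, hy, hle⟩ := S.exists_support_of_growth hu (v := w + η • e) hq₀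
      (hasDerivAt_const (0 : ℝ) (0 : ℝ)) rfl (by
        have hcont : Filter.Tendsto (fun δ : ℝ => q₀ + δ • (w + η • e)) (𝓝[>] 0) (𝓝 q₀) := by
          have : Continuous (fun δ : ℝ => q₀ + δ • (w + η • e)) := by fun_prop
          simpa using (this.tendsto 0).mono_left nhdsWithin_le_nhds
        filter_upwards [hcont.eventually (S.isOpen.mem_nhds hq₀), self_mem_nhdsWithin] with δ h1 h2
        by_contra! hlt
        have h3 := hnormal _ (subset_closure h1) (by linarith)
        rw [add_sub_cancel_left, inner_smul_right, inner_add_right, inner_smul_right,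
          real_inner_self_eq_norm_sq] at h3
        rw [hfw] at hfe
        have h2 : 0 < δ := h2
        have : 0 < δ * (⟪e, w⟫_ℝ + η * ‖e‖ ^ 2) := by positivity
        linarith)
    have h1 := hfa _ ⟨y, hy, rfl⟩
    have h2 := hM _ ⟨y, hy, rfl⟩
    rw [hfw] at h1
    rw [inner_add_right, inner_smul_right] at hle
    have h3 : ⟪G q₀ y, e⟫_ℝ ≤ (|M| + 1) * ‖e‖ :=
      (real_inner_le_norm _ _).trans (by gcongr; linarith [le_abs_self M])
    have h4 : η * ⟪G q₀ y, e⟫_ℝ ≤ -b := by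
      calc η * ⟪G q₀ y, e⟫_ℝ ≤ η * ((|M| + 1) * ‖e‖) := by gcongr
        _ = -b := by rw [hη]; field_simp
    linarith
  · obtain ⟨_, ⟨y, hy, rfl⟩, l, hl, hly⟩ := not_disjoint_iff.1 hdis
    refine ⟨y, hy, l, lt_of_le_of_ne hl ?_, hly.symm⟩
    rintro rfl
    have h0 : y = ybar := S.injOn q₀ hq₀ hy.1 S.ybar_mem (by
      rw [S.grad_ybar hq₀, ← hly]; simp)
    obtain ⟨q, hq, hlt⟩ := hneg
    have := hy.2 q hq
    rw [h0, S.apply_ybar, S.apply_ybar] at this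
    linarith

/-- In the half-space beyond a hyperplane orthogonal to the gradient at `q₀`, a quasi-convex function
is at least its value at `q₀`. -/
theorem le_of_mem_hyperplane {q₀ q e y : Euc n} {k : ℝ} (hq₀ : q₀ ∈ O) (hq : q ∈ O) (hy : y ∈ B)
    (hk : 0 < k) (he : e ≠ 0) (hG : G q₀ y = k • e) (hqe : ⟪e, q - q₀⟫_ℝ = 0) : F q₀ y ≤ F q y := by
  by_contra! hlt
  have hcont : ContinuousAt (fun q => F q y) q := (S.hasGradientAt q hq y hy).continuousAt
  have hl : Filter.Tendsto (fun η : ℝ => q + η • e) (𝓝[>] 0) (𝓝 q) := by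
    have : Continuous (fun η : ℝ => q + η • e) := by fun_prop
    simpa using (this.tendsto 0).mono_left nhdsWithin_le_nhds
  obtain ⟨η, ⟨h1, h2⟩, h3⟩ := ((hl.eventually ((hcont.eventually (gt_mem_nhds hlt)).and
    (S.isOpen.mem_nhds hq))).and self_mem_nhdsWithin).exists
  have h3 : 0 < η := h3
  have hd := S.hasDerivAt_line (q := q₀) (v := q + η • e - q₀) (s := 0) (by simpa using hq₀) hy
  have hsl := hd.tendsto_slope_zero_right
  have hle : ⟪G (q₀ + (0 : ℝ) • (q + η • e - q₀)) y, q + η • e - q₀⟫_ℝ ≤ 0 := by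
    refine le_of_tendsto hsl ?_
    filter_upwards [Ioc_mem_nhdsGT (zero_lt_one' ℝ)] with s hs
    have := S.quasiconvex y hy q₀ (subset_closure hq₀) _ (subset_closure h2) s ⟨hs.1.le, hs.2⟩
    rw [max_eq_left h1.le] at this
    simp only [zero_add, zero_smul, add_zero, smul_eq_mul]
    exact mul_nonpos_of_nonneg_of_nonpos (inv_nonneg.2 hs.1.le) (by linarith)
  rw [zero_smul, add_zero, hG, inner_smul_left, add_sub_right_comm, inner_add_right, hqe,
    inner_smul_right, real_inner_self_eq_norm_sq, zero_add] at hle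
  have : 0 < k * (η * ‖e‖ ^ 2) := by
    have := norm_pos_iff.2 he
    positivity
  simp only [conj_trivial] at hle
  linarith

theorem isClosed_coneSupports {Q : Set (Euc n)} (hQ : Q ⊆ closure O) {q : Euc n}
    (hq : q ∈ closure O) : IsClosed (coneSupports Q B F u q) := by
  have : coneSupports Q B F u q = B ∩ ⋂ q' ∈ Q, {y ∈ B | F q' y - F q y + u q ≤ 0} := by
    ext y
    simp only [coneSupports, mem_ofPred_eq, mem_inter_iff, mem_iInter]
    exact ⟨fun h => ⟨h.1, fun q' hq' => ⟨h.1, h.2 q' hq'⟩⟩,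
      fun h => ⟨h.1, fun q' hq' => (h.2 q' hq').2⟩⟩
  rw [this]
  refine S.isCompact.isClosed.inter (isClosed_biInter fun q' hq' => ?_)
  exact (((S.continuousOn_right (hQ hq')).sub (S.continuousOn_right hq)).add
    continuousOn_const).preimage_isClosed_of_isClosed S.isCompact.isClosed isClosed_Iic

theorem isClosed_sublevel (hu : ∀ q ∈ closure O, (supports (closure O) B F u q).Nonempty) :
    IsClosed {q ∈ closure O | u q ≤ 0} := by
  refine IsSeqClosed.isClosed fun q q₀ hq lq => ?_
  have hq₀ : q₀ ∈ closure O := isClosed_closure.mem_of_tendsto lq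
    (Filter.Eventually.of_forall fun k => (hq k).1)
  refine ⟨hq₀, ?_⟩
  by_contra! hlt
  obtain ⟨k, hk⟩ := ((tendsto_nhdsWithin_iff.2 ⟨lq, Filter.Eventually.of_forall fun k =>
    (hq k).1⟩).eventually (S.lowerSemicontinuousOn hu q₀ hq₀ 0 hlt)).exists
  linarith [(hq k).2]

/-- A support of the cone slides down to a support of `u` at a point of `Q`. -/
theorem coneSupports_subset (hu : ∀ q ∈ closure O, (supports (closure O) B F u q).Nonempty)
    {Q : Set (Euc n)} (hQ : IsCompact Q) (hQO : Q ⊆ O) (hfr : ∀ q ∈ frontier Q, u q = 0) {q₀ : Euc n}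
    (hq₀ : q₀ ∈ Q) (hneg : u q₀ < 0) :
    coneSupports Q B F u q₀ ⊆ ⋃ q ∈ Q, supports (closure O) B F u q := by
  rintro y ⟨hy, hcone⟩
  have hQX : Q ⊆ closure O := hQO.trans subset_closure
  have hlsc : LowerSemicontinuousOn (fun q => u q + -F q y) Q :=
    ((S.lowerSemicontinuousOn hu).mono hQX).add
      ((S.continuousOn_left hy).mono hQX).neg.lowerSemicontinuousOn
  obtain ⟨q₁, hq₁, hmin⟩ := hlsc.exists_isMinOn ⟨q₀, hq₀⟩ hQ
  have key : ∀ q ∈ Q, q ∉ frontier Q → (∀ q' ∈ Q, u q + -F q y ≤ u q' + -F q' y) →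
      y ∈ ⋃ q ∈ Q, supports (closure O) B F u q := by
    intro q hq hqf hm
    have hint : q ∈ interior Q := by
      by_contra h
      exact hqf ⟨subset_closure hq, h⟩
    refine mem_iUnion₂.2 ⟨q, hq, S.mem_supports_of_local hu (hQO hq) hy ?_⟩
    filter_upwards [mem_interior_iff_mem_nhds.1 hint] with q' hq'
    linarith [hm q' hq']
  by_cases hf : q₁ ∈ frontier Q
  · -- the minimum is not smaller than the value at the vertex
    refine key q₀ hq₀ (fun h => hneg.ne (hfr q₀ h)) fun q' hq' => ?_
    have h1 := hcone q₁ hq₁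
    have h2 := hfr q₁ hf
    have h3 : u q₁ + -F q₁ y ≤ u q' + -F q' y := hmin hq'
    linarith
  · exact key q₁ hq₁ hf fun q' hq' => hmin hq'

theorem ybar_mem_coneSupports {Q : Set (Euc n)} {q₀ : Euc n} (h : u q₀ ≤ 0) :
    ybar ∈ coneSupports Q B F u q₀ :=
  ⟨S.ybar_mem, fun q _ => by rw [S.apply_ybar, S.apply_ybar]; linarith⟩

/-- The cone over `Q` with vertex `(q₁, u q₁)` has in each unit direction `e` a support whose
gradient at the vertex is nearly parallel to `e`, with a length at least comparable to the height
of the cone divided by the width `d` of `Q` in the direction `e` as seen from `q₁`. -/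
theorem exists_coneSupport_direction
    (hu : ∀ q ∈ closure O, (supports (closure O) B F u q).Nonempty) {Q : Set (Euc n)}
    (hQ : Q = {q ∈ closure O | u q ≤ 0}) (hfr : ∀ q ∈ frontier Q, u q = 0) {z : Euc n} {r : ℝ}
    (hQz : Q ⊆ Metric.ball z r) (hzO : Metric.ball z (4 * r) ⊆ O) {ε θ : ℝ}
    (hdiam : ∀ q ∈ Q, ∀ q' ∈ Q, ‖q - q'‖ ≤ ε) (hKθ : K * ε ≤ θ) (hθ : θ ≤ 1 / 2)
    {q₁ e : Euc n} (hq₁ : q₁ ∈ Q) (hneg : u q₁ < 0) (he : ‖e‖ = 1) {d : ℝ}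
    (hd : ∀ q ∈ Q, ⟪e, q - q₁⟫_ℝ ≤ d) :
    ∃ y ∈ coneSupports Q B F u q₁, ∃ k : ℝ, 0 ≤ k ∧ ‖G q₁ y - k • e‖ ≤ θ * k ∧
      -u q₁ ≤ 2 * k * d := by
  have hQX : Q ⊆ closure O := by rw [hQ]; exact fun q hq => hq.1
  have hle : ∀ q ∈ Q, u q ≤ 0 := by rw [hQ]; exact fun q hq => hq.2
  have hr : 0 < r := by
    by_contra! h
    have := hQz hq₁
    rw [Metric.ball_eq_empty.2 h] at this
    exact this
  have hQO : Q ⊆ O := hQz.trans ((Metric.ball_subset_ball (by linarith)).trans hzO)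
  have hQclosed : IsClosed Q := by rw [hQ]; exact S.isClosed_sublevel hu
  have hQcpt : IsCompact Q :=
    Metric.isCompact_of_isClosed_isBounded hQclosed (Metric.isBounded_ball.subset hQz)
  have he0 : e ≠ 0 := by rintro rfl; simp at he
  -- a point of `Q` on the supporting hyperplane with normal `e`
  obtain ⟨q₀, hq₀, hmax⟩ := hQcpt.exists_isMaxOn ⟨q₁, hq₁⟩
    (f := fun q => ⟪e, q⟫_ℝ) (by fun_prop)
  have hmax : ∀ q ∈ Q, ⟪e, q - q₀⟫_ℝ ≤ 0 := fun q hq => by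
    have : ⟪e, q⟫_ℝ ≤ ⟪e, q₀⟫_ℝ := hmax hq
    rw [inner_sub_right]; linarith
  have hq₀f : q₀ ∈ frontier Q := by
    refine ⟨subset_closure hq₀, fun hint => ?_⟩
    have hl : Filter.Tendsto (fun η : ℝ => q₀ + η • e) (𝓝[>] 0) (𝓝 q₀) := by
      have : Continuous (fun η : ℝ => q₀ + η • e) := by fun_prop
      simpa using (this.tendsto 0).mono_left nhdsWithin_le_nhds
    obtain ⟨η, h1, h2⟩ := ((hl.eventually (mem_interior_iff_mem_nhds.1 hint)).and
      self_mem_nhdsWithin).exists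
    have h2 : 0 < η := h2
    have := hmax _ h1
    rw [add_sub_cancel_left, inner_smul_right, real_inner_self_eq_norm_sq, he] at this
    linarith
  have hu0 := hfr q₀ hq₀f
  have hq₀O := hQO hq₀
  have hq₁O := hQO hq₁
  obtain ⟨y₁, hy₁, l, hl, hGl⟩ := S.exists_support_normal hu hq₀O hu0 he0
    (fun q hq h => hmax q (by rw [hQ]; exact ⟨hq, h⟩)) ⟨q₁, hQX hq₁, hneg⟩
  -- move along the segment from `ȳ` to this support until the height at `q₁` is right
  obtain ⟨γ, hγc, hγ⟩ := S.segment q₀ hq₀O ybar S.ybar_mem y₁ hy₁.1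
  have hγ0 : γ 0 = ybar := S.injOn q₀ hq₀O (hγ 0 ⟨le_rfl, zero_le_one⟩).1 S.ybar_mem (by
    rw [(hγ 0 ⟨le_rfl, zero_le_one⟩).2.1]; simp)
  have hγ1 : γ 1 = y₁ := S.injOn q₀ hq₀O (hγ 1 ⟨zero_le_one, le_rfl⟩).1 hy₁.1 (by
    rw [(hγ 1 ⟨zero_le_one, le_rfl⟩).2.1]; simp)
  have hφc : ContinuousOn (fun s => F q₁ (γ s) - F q₀ (γ s)) (Icc 0 1) :=
    ((S.continuousOn_right (hQX hq₁)).comp hγc fun s hs => (hγ s hs).1).sub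
      ((S.continuousOn_right (hQX hq₀)).comp hγc fun s hs => (hγ s hs).1)
  obtain ⟨s, hs, hφs⟩ : u q₁ ∈ (fun s => F q₁ (γ s) - F q₀ (γ s)) '' Icc 0 1 := by
    refine intermediate_value_Icc' zero_le_one hφc ⟨?_, ?_⟩
    · have := hy₁.2 q₁ (hQX hq₁)
      simp only [hγ1]; linarith
    · simp only [hγ0, S.apply_ybar]; linarith
  simp only at hφs
  obtain ⟨hyB, hGy, hFy⟩ := hγ s hs
  set y := γ s with hy
  set k := s * l with hk
  have hGk : G q₀ y = k • e := by
    rw [hGy, S.grad_ybar hq₀O, hGl, hk]; simp [mul_smul]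
  have hs0 : 0 < s := by
    refine lt_of_le_of_ne hs.1 ?_
    rintro rfl
    rw [hy, hγ0, S.apply_ybar, S.apply_ybar] at hφs
    linarith
  have hkpos : 0 < k := mul_pos hs0 hl
  have hGn : ‖G q₀ y‖ = k := by rw [hGk, norm_smul, he, mul_one, Real.norm_eq_abs, abs_of_pos hkpos]
  refine ⟨y, ⟨hyB, fun q hq => ?_⟩, k, hkpos.le, ?_, ?_⟩
  · have h1 := hFy q (hQX hq)
    have h2 := hy₁.2 q (hQX hq)
    have h3 := hle q hq
    rw [S.apply_ybar, S.apply_ybar] at h1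
    have : max (0 - 0) (F q y₁ - F q₀ y₁) ≤ 0 := max_le (by simp) (by linarith)
    linarith
  · rw [← hGk]
    refine (S.oscillation _ hq₁O _ hq₀O y hyB).trans ?_
    rw [hGn]
    refine mul_le_mul_of_nonneg_right (le_trans ?_ hKθ) hkpos.le
    exact mul_le_mul_of_nonneg_left (hdiam _ hq₁ _ hq₀) S.nonneg
  · -- the orthogonal projection of `q₁` to the supporting hyperplane
    set d₀ := ⟪e, q₀ - q₁⟫_ℝ with hd₀
    have hd₀0 : 0 ≤ d₀ := by
      have := hmax q₁ hq₁
      rw [← neg_sub, inner_neg_right] at this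
      linarith
    have hd₀n : d₀ ≤ ‖q₀ - q₁‖ := (real_inner_le_norm _ _).trans (by rw [he, one_mul])
    have hqn : ‖q₀ - q₁‖ < 2 * r := by
      have h1 := mem_ball_iff_norm.1 (hQz hq₀)
      have h2 := mem_ball_iff_norm'.1 (hQz hq₁)
      have := norm_add_le (q₀ - z) (z - q₁)
      rw [sub_add_sub_cancel] at this
      linarith
    have hseg : ∀ t ∈ Icc (0 : ℝ) d₀, q₁ + t • e ∈ O ∧ ‖q₁ + t • e - q₀‖ ≤ 2 * ε := by
      intro t ht
      have htn : ‖t • e‖ ≤ ‖q₀ - q₁‖ := by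
        rw [norm_smul, he, mul_one, Real.norm_eq_abs, abs_of_nonneg ht.1]
        exact ht.2.trans hd₀n
      constructor
      · refine hzO (mem_ball_iff_norm.2 ?_)
        have h1 := mem_ball_iff_norm.1 (hQz hq₁)
        have h2 := norm_add_le (q₁ - z) (t • e)
        rw [sub_add_eq_add_sub] at h2
        linarith
      · have h2 := norm_add_le (q₁ - q₀) (t • e)
        rw [sub_add_eq_add_sub] at h2
        have h3 := hdiam _ hq₁ _ hq₀
        have h4 := hdiam _ hq₀ _ hq₁
        linarith
    have h1 := S.sub_le_of_segment hd₀0 hseg hq₀O hyB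
    have h2 : F q₀ y ≤ F (q₁ + d₀ • e) y := by
      refine S.le_of_mem_hyperplane hq₀O (hseg d₀ ⟨hd₀0, le_rfl⟩).1 hyB hkpos he0 hGk ?_
      rw [show q₁ + d₀ • e - q₀ = d₀ • e - (q₀ - q₁) by abel, inner_sub_right, inner_smul_right,
        real_inner_self_eq_norm_sq, he, ← hd₀]
      ring
    rw [hGn, hGk, inner_smul_left, real_inner_self_eq_norm_sq, he] at h1
    simp only [conj_trivial] at h1
    have h3 : K * (2 * ε) * k * 1 ≤ k := by
      have : K * (2 * ε) ≤ 1 := by linarith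
      nlinarith
    have h4 : d₀ * (k * 1 ^ 2 + K * (2 * ε) * k * 1) ≤ d₀ * (2 * k) :=
      mul_le_mul_of_nonneg_left (by linarith) hd₀0
    have h5 : d₀ ≤ d := hd q₀ hq₀
    have h6 : d₀ * (2 * k) ≤ d * (2 * k) := mul_le_mul_of_nonneg_right h5 (by linarith)
    linarith

end CostChart

/-! ### Volumes, determinants and boxes of convex sets -/

/-- The matrix of coordinates in an orthonormal basis, the vectors being the columns. -/
def coordMatrix (b : OrthonormalBasis (Fin n) ℝ (Euc n)) (p : Fin n → Euc n) :
    Matrix (Fin n) (Fin n) ℝ := Matrix.of fun i j => ⟪b i, p j⟫_ℝ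

/-- A convex set containing `0` and `n` vectors contains the parallelepiped that they span, scaled by
`1 / n`. -/
theorem volume_ge_det {P : Set (Euc n)} (hP : Convex ℝ P) (h0 : (0 : Euc n) ∈ P)
    (b : OrthonormalBasis (Fin n) ℝ (Euc n)) {p : Fin n → Euc n} (hp : ∀ i, p i ∈ P) :
    ENNReal.ofReal (|(coordMatrix b p).det| / (n : ℝ) ^ n) ≤ volume P := by
  have hsub : parallelepiped (fun i => (n : ℝ)⁻¹ • p i) ⊆ P := by
    intro x hx
    obtain ⟨t, ht, rfl⟩ := (mem_parallelepiped_iff _ _).1 hx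
    have ht0 : ∀ i, 0 ≤ t i * (n : ℝ)⁻¹ := fun i => mul_nonneg (ht.1 i) (by positivity)
    have hle : ∑ i, t i * (n : ℝ)⁻¹ ≤ 1 := by
      calc ∑ i, t i * (n : ℝ)⁻¹ ≤ ∑ _i : Fin n, 1 * (n : ℝ)⁻¹ :=
            Finset.sum_le_sum fun i _ => mul_le_mul_of_nonneg_right (ht.2 i) (by positivity)
        _ ≤ 1 := by simpa using mul_inv_le_one
    simp only [smul_smul]
    set σ := ∑ i, t i * (n : ℝ)⁻¹ with hσ
    rcases (Finset.sum_nonneg fun i _ => ht0 i : 0 ≤ σ).eq_or_lt with h | h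
    · have hz : ∀ i, t i * (n : ℝ)⁻¹ = 0 := fun i =>
        (Finset.sum_eq_zero_iff_of_nonneg fun i _ => ht0 i).1 h.symm i (Finset.mem_univ i)
      simpa [hz] using h0
    · have h1 : ∑ i, (σ⁻¹ * (t i * (n : ℝ)⁻¹)) • p i ∈ P :=
        hP.sum_mem (fun i _ => mul_nonneg (inv_nonneg.2 h.le) (ht0 i))
          (by rw [← Finset.mul_sum]; exact inv_mul_cancel₀ h.ne') fun i _ => hp i
      have h2 := hP.smul_mem_of_zero_mem h0 h1 ⟨h.le, hle⟩
      rw [Finset.smul_sum] at h2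
      convert h2 using 2 with i
      rw [smul_smul, mul_inv_cancel_left₀ h.ne']
  refine le_trans (le_of_eq ?_) (measure_mono hsub)
  rw [← b.addHaar_eq_volume, Measure.addHaar_parallelepiped]
  congr 1
  have : b.toBasis.toMatrix (fun i => (n : ℝ)⁻¹ • p i) = (n : ℝ)⁻¹ • coordMatrix b p := by
    ext i j
    simp [coordMatrix, Module.Basis.toMatrix_apply, b.repr_apply_apply]
  rw [Module.Basis.det_apply, this, Matrix.det_smul, abs_mul, Fintype.card_fin,
    abs_of_nonneg (by positivity : (0 : ℝ) ≤ (n : ℝ)⁻¹ ^ n), inv_pow]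
  field_simp

/-- The determinant is uniformly continuous on bounded sets of matrices. -/
theorem exists_det_perturbation (n : ℕ) {η : ℝ} (hη : 0 < η) :
    ∃ θ : ℝ, 0 < θ ∧ θ ≤ 1 / 2 ∧ ∀ M N : Matrix (Fin n) (Fin n) ℝ, (∀ i j, |M i j| ≤ 1) →
      (∀ i j, |N i j - M i j| ≤ θ) → |N.det - M.det| ≤ η := by
  have hcont : Continuous fun M : Fin n → Fin n → ℝ => Matrix.det (Matrix.of M) :=
    Continuous.matrix_det continuous_id
  have hu := (isCompact_closedBall (0 : Fin n → Fin n → ℝ) 2).uniformContinuousOn_of_continuous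
    hcont.continuousOn
  obtain ⟨δ, hδ, hu⟩ := Metric.uniformContinuousOn_iff.1 hu η hη
  refine ⟨min (δ / 2) (1 / 2), by positivity, min_le_right _ _, fun M N hM hN => ?_⟩
  have h2 : ∀ i j, |N i j| ≤ 2 := fun i j => by
    have h1 := (hN i j).trans (min_le_right _ _)
    have h3 := hM i j
    rw [abs_le] at *
    constructor <;> linarith
  have hle := hu (fun i j => N i j) ?_ (fun i j => M i j) ?_ ?_
  · rw [Real.dist_eq] at hle
    exact hle.le
  · rw [mem_closedBall_zero_iff, pi_norm_le_iff_of_nonneg (by norm_num)]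
    intro i
    rw [pi_norm_le_iff_of_nonneg (by norm_num)]
    exact fun j => h2 i j
  · rw [mem_closedBall_zero_iff, pi_norm_le_iff_of_nonneg (by norm_num)]
    intro i
    rw [pi_norm_le_iff_of_nonneg (by norm_num)]
    exact fun j => (hM i j).trans (by norm_num)
  · refine lt_of_le_of_lt ?_ (half_lt_self hδ)
    rw [dist_pi_le_iff (by positivity)]
    intro i
    rw [dist_pi_le_iff (by positivity)]
    exact fun j => (hN i j).trans (min_le_left _ _)

/-- A convex set containing the origin and `n` vectors close in direction to given independent unit
vectors `v i` and of length at least `h / (2 d i)` has volume at least a multiple of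
`h ^ n / ∏ i, d i`. -/
theorem exists_volume_estimate (hn : 1 ≤ n) :
    ∃ θ C : ℝ, 0 < θ ∧ θ ≤ 1 / 2 ∧ 0 < C ∧
      ∀ (b : OrthonormalBasis (Fin n) ℝ (Euc n)) (v p : Fin n → Euc n) (P : Set (Euc n))
        (k d : Fin n → ℝ) (h : ℝ), (∀ i, ‖v i‖ = 1) → 1 / √n ≤ |(coordMatrix b v).det| →
        Convex ℝ P → (0 : Euc n) ∈ P → (∀ i, p i ∈ P) → (∀ i, 0 ≤ k i) →
        (∀ i, ‖p i - k i • v i‖ ≤ θ * k i) → 0 < h → (∀ i, h ≤ 2 * k i * d i) →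
        ENNReal.ofReal (h ^ n) ≤ ENNReal.ofReal (C * ∏ i, d i) * volume P := by
  have hn0 : (0 : ℝ) < n := by exact_mod_cast hn
  have hs : 0 < √(n : ℝ) := Real.sqrt_pos.2 hn0
  obtain ⟨θ, hθ, hθ2, hdet⟩ := exists_det_perturbation n (η := 1 / (2 * √n)) (by positivity)
  refine ⟨θ, 2 ^ n * (2 * √n) * (n : ℝ) ^ n, hθ, hθ2, by positivity, ?_⟩
  intro b v p P k d h hv hV hP h0 hp hk hpk hh hkd
  have hkp : ∀ i, 0 < k i := fun i => by
    refine lt_of_le_of_ne (hk i) fun h0 => ?_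
    have := hkd i
    rw [← h0] at this
    linarith
  have hdp : ∀ i, 0 < d i := fun i => by
    by_contra! hle
    have := hkd i
    have h2 : k i * d i ≤ 0 := mul_nonpos_of_nonneg_of_nonpos (hk i) hle
    linarith
  -- normalise the lengths
  set w : Fin n → Euc n := fun i => (k i)⁻¹ • p i with hw
  have hwv : ∀ i, ‖w i - v i‖ ≤ θ := fun i => by
    have e : w i - v i = (k i)⁻¹ • (p i - k i • v i) := by
      rw [smul_sub, smul_smul, inv_mul_cancel₀ (hkp i).ne', one_smul]
    rw [e, norm_smul, norm_inv, Real.norm_eq_abs, abs_of_pos (hkp i), inv_mul_le_iff₀ (hkp i)]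
    linarith [hpk i]
  have hW : 1 / (2 * √n) ≤ |(coordMatrix b w).det| := by
    have h1 := hdet (coordMatrix b v) (coordMatrix b w) (fun i j => ?_) (fun i j => ?_)
    · have h2 := abs_sub_abs_le_abs_sub (coordMatrix b v).det (coordMatrix b w).det
      rw [abs_sub_comm] at h2
      have h3 : 1 / √(n : ℝ) = 1 / (2 * √n) + 1 / (2 * √n) := by field_simp; norm_num
      linarith
    · have := abs_real_inner_le_norm (b i) (v j)
      rwa [b.norm_eq_one, hv, one_mul] at this
    · have := abs_real_inner_le_norm (b i) (w j - v j)
      rw [b.norm_eq_one, one_mul, inner_sub_right] at this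
      exact this.trans (hwv j)
  have hpw : coordMatrix b p = coordMatrix b w * Matrix.diagonal k := by
    ext i j
    rw [Matrix.mul_diagonal]
    simp only [coordMatrix, Matrix.of_apply, hw, inner_smul_right]
    have := (hkp j).ne'
    field_simp
  have hdetp : (∏ i, k i) / (2 * √n) ≤ |(coordMatrix b p).det| := by
    rw [hpw, Matrix.det_mul, Matrix.det_diagonal, abs_mul,
      abs_of_pos (Finset.prod_pos fun i _ => hkp i), div_eq_mul_one_div, mul_comm]
    exact mul_le_mul_of_nonneg_right hW (Finset.prod_pos fun i _ => hkp i).le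
  have hprod : h ^ n ≤ 2 ^ n * (∏ i, k i) * ∏ i, d i := by
    calc h ^ n = ∏ _i : Fin n, h := by simp
      _ ≤ ∏ i, (2 * k i * d i) := Finset.prod_le_prod (fun _ _ => hh.le) fun i _ => hkd i
      _ = _ := by simp [Finset.prod_mul_distrib]
  refine le_trans ?_ (mul_le_mul_right (volume_ge_det hP h0 b hp) _)
  have hD : 0 < ∏ i, d i := Finset.prod_pos fun i _ => hdp i
  rw [← ENNReal.ofReal_mul (by positivity)]
  refine ENNReal.ofReal_le_ofReal (hprod.trans ?_)
  calc 2 ^ n * (∏ i, k i) * ∏ i, d i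
      = 2 ^ n * (2 * √n) * (n : ℝ) ^ n * (∏ i, d i) * (((∏ i, k i) / (2 * √n)) / (n : ℝ) ^ n) := by
        field_simp
    _ ≤ _ := by gcongr

theorem det_linearAdjoint (A : Euc n →ₗ[ℝ] Euc n) : A.adjoint.det = A.det := by
  rw [← LinearMap.det_toMatrix (EuclideanSpace.basisFun (Fin n) ℝ).toBasis,
    LinearMap.toMatrix_adjoint, Matrix.det_conjTranspose, LinearMap.det_toMatrix]
  simp

/-- The principal axes of an ellipsoid: in an orthonormal eigenbasis of `A A†` the semi-axes are the
lengths of the vectors `A† b i`. -/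
theorem exists_principal_axes (A : Euc n →ₗ[ℝ] Euc n) :
    ∃ b : OrthonormalBasis (Fin n) ℝ (Euc n), ∏ i, ‖A.adjoint (b i)‖ = |A.det| := by
  have hT : (A ∘ₗ A.adjoint).IsSymmetric := A.isSymmetric_self_comp_adjoint
  have hfr : Module.finrank ℝ (Euc n) = n := by simp
  refine ⟨hT.eigenvectorBasis hfr, ?_⟩
  have h1 := hT.det_eq_prod_eigenvalues hfr
  have h2 : ∀ i, hT.eigenvalues hfr i = ‖A.adjoint (hT.eigenvectorBasis hfr i)‖ ^ 2 := by
    intro i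
    rw [← real_inner_self_eq_norm_sq, LinearMap.adjoint_inner_left, ← LinearMap.comp_apply,
      hT.apply_eigenvectorBasis, inner_smul_right, real_inner_self_eq_norm_sq,
      OrthonormalBasis.norm_eq_one]
    simp
  rw [LinearMap.det_comp, det_linearAdjoint] at h1
  simp only [h2, Finset.prod_pow, RCLike.ofReal_real_eq_id, id] at h1
  rw [← abs_of_nonneg (Finset.prod_nonneg fun i _ => norm_nonneg _ :
    0 ≤ ∏ i, ‖A.adjoint (hT.eigenvectorBasis hfr i)‖), ← sq_eq_sq_iff_abs_eq_abs, ← h1, sq]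

/-- `Q` lies in the box with centre `z`, axes `b` and half-widths `R a i`. -/
def InBox (Q : Set (Euc n)) (b : OrthonormalBasis (Fin n) ℝ (Euc n)) (a : Fin n → ℝ) (z : Euc n)
    (R : ℝ) : Prop :=
  ∀ q ∈ Q, ∀ i, |⟪b i, q - z⟫_ℝ| ≤ R * a i

/-- The image of a ball of radius `R` under `A` lies in the box with half-widths `R ‖A† b i‖`. -/
theorem inBox_of_linear {Q : Set (Euc n)} {A : Euc n →ₗ[ℝ] Euc n} {z : Euc n} {R : ℝ}
    (b : OrthonormalBasis (Fin n) ℝ (Euc n)) (hQ : ∀ q ∈ Q, ∃ x, ‖x‖ ≤ R ∧ q = z + A x) :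
    InBox Q b (fun i => ‖A.adjoint (b i)‖) z R := by
  intro q hq i
  obtain ⟨x, hx, rfl⟩ := hQ q hq
  rw [add_sub_cancel_left, ← LinearMap.adjoint_inner_left, mul_comm]
  exact (abs_real_inner_le_norm _ _).trans (by gcongr)

/-- A convex body is contained in a box of comparable volume. By Cramer's rule all points of the body
have coordinates of modulus at most one with respect to the edges of a simplex of maximal volume
with vertices in the body. -/
theorem exists_box (hn : 1 ≤ n) {Q : Set (Euc n)} (hQ : IsCompact Q) (hconv : Convex ℝ Q)
    (hint : (interior Q).Nonempty) :
    ∃ (b : OrthonormalBasis (Fin n) ℝ (Euc n)) (a : Fin n → ℝ) (z : Euc n), (∀ i, 0 < a i) ∧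
      InBox Q b a z (√n) ∧ ∏ i, a i ≤ (n : ℝ) ^ n * volume.real Q := by
  set V : (Fin (n + 1) → Euc n) → Matrix (Fin n) (Fin n) ℝ :=
    fun x => Matrix.of fun i j => (x j.succ - x 0) i with hV
  have hVc : Continuous fun x => |(V x).det| := by
    refine (Continuous.matrix_det ?_).abs
    refine continuous_matrix fun i j => ?_
    simp only [hV, Matrix.of_apply]
    fun_prop
  have hcomp : IsCompact (univ.pi fun _ : Fin (n + 1) => Q) := isCompact_univ_pi fun _ => hQ
  obtain ⟨q₀, hq₀⟩ := hint
  have hq₀Q := interior_subset hq₀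
  obtain ⟨x, hxQ, hmax⟩ := hcomp.exists_isMaxOn ⟨fun _ => q₀, fun _ _ => hq₀Q⟩ hVc.continuousOn
  have hpos : 0 < |(V x).det| := by
    obtain ⟨r, hr, hball⟩ := Metric.isOpen_iff.1 isOpen_interior q₀ hq₀
    set x' : Fin (n + 1) → Euc n := Fin.cons q₀ fun j => q₀ + (r / 2) • EuclideanSpace.single j 1
    have hx' : x' ∈ univ.pi fun _ : Fin (n + 1) => Q := by
      intro j _
      refine Fin.cases hq₀Q (fun j => interior_subset (hball ?_)) j
      simp only [x', Fin.cons_succ, mem_ball_iff_norm, add_sub_cancel_left, norm_smul]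
      simp [abs_of_pos hr, hr]
    refine lt_of_lt_of_le ?_ (hmax hx')
    have : V x' = (r / 2) • (1 : Matrix (Fin n) (Fin n) ℝ) := by
      ext i j
      simp [hV, x', Matrix.one_apply]
    change 0 < |(V x').det|
    rw [this, Matrix.det_smul, Matrix.det_one]
    positivity
  set A : Euc n →ₗ[ℝ] Euc n := Matrix.toEuclideanLin (V x) with hA
  have hAdet : A.det = (V x).det := by
    rw [hA, Matrix.toEuclideanLin_eq_toLin_orthonormal, LinearMap.det_toLin]
  obtain ⟨b, hb⟩ := exists_principal_axes A
  rw [hAdet] at hb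
  refine ⟨b, fun i => ‖A.adjoint (b i)‖, x 0, fun i => ?_, inBox_of_linear b fun q hq => ?_, ?_⟩
  · refine (norm_nonneg _).lt_of_ne fun h => ?_
    rw [← hb, Finset.prod_eq_zero (Finset.mem_univ i) h.symm] at hpos
    exact lt_irrefl _ hpos
  · -- the coordinates of a point of `Q` in the simplex are bounded by Cramer's rule
    set c : Fin n → ℝ := fun i => (V x).det⁻¹ * Matrix.cramer (V x) (q - x 0) i with hc
    have hdet0 : (V x).det ≠ 0 := abs_pos.1 hpos
    have hcb : ∀ i, |c i| ≤ 1 := by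
      intro i
      rw [hc, abs_mul, abs_inv, inv_mul_le_iff₀ hpos, mul_one, Matrix.cramer_apply]
      have : (V x).updateCol i (q - x 0) = V (Function.update x i.succ q) := by
        ext k j
        rcases eq_or_ne j i with rfl | hj
        · simp [hV, Function.update_of_ne (Fin.succ_ne_zero j).symm]
        · have : j.succ ≠ i.succ := fun h => hj (Fin.succ_injective _ h)
          simp [hV, hj, Function.update_of_ne (Fin.succ_ne_zero i).symm]
      rw [this]
      refine hmax fun j _ => ?_
      rcases eq_or_ne j i.succ with rfl | hj
      · simpa using hq
      · simpa [hj] using hxQ j (mem_univ j)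
    refine ⟨WithLp.toLp 2 c, ?_, ?_⟩
    · rw [EuclideanSpace.norm_eq]
      refine Real.sqrt_le_sqrt ?_
      calc ∑ i, ‖(WithLp.toLp 2 c : Euc n) i‖ ^ 2 ≤ ∑ _i : Fin n, (1 : ℝ) := by
            refine Finset.sum_le_sum fun i _ => ?_
            rw [Real.norm_eq_abs]
            exact pow_le_one₀ (abs_nonneg _) (hcb i)
        _ = n := by simp
    · have h1 := Matrix.mulVec_cramer (V x) (q - x 0).ofLp
      have h2 : (V x).mulVec c = (q - x 0).ofLp := by
        have : c = (V x).det⁻¹ • Matrix.cramer (V x) (q - x 0).ofLp := rfl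
        rw [this, Matrix.mulVec_smul, h1, smul_smul, inv_mul_cancel₀ hdet0, one_smul]
      have h3 : A (WithLp.toLp 2 c) = q - x 0 := by
        rw [hA, Matrix.toLpLin_toLp, Matrix.toLin'_apply, h2]
      rw [h3]; abel
  · rw [hb]
    have h1 := volume_ge_det (P := (fun w => x 0 + w) ⁻¹' Q) (hconv.translate_preimage_right (x 0))
      (by simpa using hxQ 0 (mem_univ 0)) (EuclideanSpace.basisFun (Fin n) ℝ)
      (p := fun j => x j.succ - x 0) fun i => by simpa using hxQ i.succ (mem_univ _)
    have h2 : coordMatrix (EuclideanSpace.basisFun (Fin n) ℝ) (fun j => x j.succ - x 0) = V x := by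
      ext i j
      simp [coordMatrix, hV, EuclideanSpace.inner_single_left]
    rw [h2, measure_preimage_add, ENNReal.ofReal_le_iff_le_toReal hQ.measure_lt_top.ne] at h1
    have hn0 : (0 : ℝ) < n := by exact_mod_cast hn
    rw [div_le_iff₀ (by positivity)] at h1
    rw [mul_comm]
    exact h1

/-! ### Tilting a supporting hyperplane -/

/-- If one of `n` numbers equals `1`, one of the `n` scales `[σ ^ (k + 1), σ ^ k)` is free. -/
theorem exists_scale_gap {ξ : Fin n → ℝ} {σ : ℝ} (h0 : 0 ≤ σ) (h1 : σ ≤ 1) {i₀ : Fin n}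
    (hi₀ : ξ i₀ = 1) :
    ∃ k < n, ∀ i, ξ i < σ ^ (k + 1) ∨ σ ^ k ≤ ξ i := by
  by_contra! hcon
  choose f hf using fun k : Fin n => hcon k k.2
  have hlt : ∀ k k' : Fin n, k < k' → f k ≠ f k' := fun k k' hkk h => by
    have h2 : σ ^ (k' : ℕ) ≤ σ ^ ((k : ℕ) + 1) := pow_le_pow_of_le_one h0 h1 hkk
    have h3 := (hf k).1
    have h4 := (hf k').2
    rw [← h] at h4
    linarith
  have hinj : Function.Injective f := fun k k' h => by
    rcases lt_trichotomy k k' with hk | hk | hk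
    · exact absurd h (hlt k k' hk)
    · exact hk
    · exact absurd h.symm (hlt k' k hk)
  obtain ⟨k, hk⟩ := Finite.injective_iff_surjective.1 hinj i₀
  have := (hf k).2
  rw [hk, hi₀] at this
  exact absurd (pow_le_one₀ h0 h1 : σ ^ (k : ℕ) ≤ 1) (not_le.2 this)

theorem inBox_inner_le {Q : Set (Euc n)} {b : OrthonormalBasis (Fin n) ℝ (Euc n)} {a : Fin n → ℝ}
    {z : Euc n} {R : ℝ} (hbox : InBox Q b a z R) {q q' : Euc n} (hq : q ∈ Q) (hq' : q' ∈ Q)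
    (i : Fin n) : |⟪b i, q - q'⟫_ℝ| ≤ 2 * R * a i := by
  have h : q - q' = (q - z) - (q' - z) := by abel
  rw [h, inner_sub_right]
  have h1 := abs_sub ⟪b i, q - z⟫_ℝ ⟪b i, q' - z⟫_ℝ
  linarith [hbox q hq i, hbox q' hq' i]

/-- The special case of `exists_tilted_normal` in which the largest of the numbers
`a i * |⟪b i, e⟫|` is one. -/
theorem exists_tilted_normal_of_normalized {Q : Set (Euc n)}
    {b : OrthonormalBasis (Fin n) ℝ (Euc n)} {a : Fin n → ℝ} (ha : ∀ i, 0 < a i) {z : Euc n}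
    {R : ℝ} (hR : 0 ≤ R) (hbox : InBox Q b a z R) {q₀ q₁ e : Euc n} (hq₀ : q₀ ∈ Q) (hq₁ : q₁ ∈ Q)
    (hsup : ∀ q ∈ Q, ⟪e, q - q₀⟫_ℝ ≤ 0) {σ : ℝ} (h0 : 0 < σ) (h1 : σ ≤ 1)
    (hq : q₁ = q₀ - σ ^ n • (q₀ - z)) (hle : ∀ i, a i * |⟪b i, e⟫_ℝ| ≤ 1) {i₀ : Fin n}
    (hi₀ : a i₀ * |⟪b i₀, e⟫_ℝ| = 1) :
    ∃ j, ∃ e' : Euc n, ‖e'‖ = 1 ∧ 1 / √n ≤ |⟪b j, e'⟫_ℝ| ∧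
      ∀ q ∈ Q, ⟪e', q - q₁⟫_ℝ ≤ 3 * n * R * σ * a j := by
  have hn0 : (0 : ℝ) < n := by exact_mod_cast (i₀.pos)
  obtain ⟨k, hkn, hk⟩ := exists_scale_gap (ξ := fun i => a i * |⟪b i, e⟫_ℝ|) h0.le h1 hi₀
  set ε : Fin n → ℝ := fun i => ⟪b i, e⟫_ℝ with hε
  set S : Finset (Fin n) := Finset.univ.filter fun i => σ ^ k ≤ a i * |ε i| with hS
  have hi₀S : i₀ ∈ S := by
    rw [hS, Finset.mem_filter]
    exact ⟨Finset.mem_univ _, hi₀ ▸ pow_le_one₀ h0.le h1⟩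
  obtain ⟨j, hjS, hj⟩ := Finset.exists_max_image S (fun i => |ε i|) ⟨i₀, hi₀S⟩
  have hjk : σ ^ k ≤ a j * |ε j| := (Finset.mem_filter.1 hjS).2
  have hεj : 0 < |ε j| := by
    have : 0 < a j * |ε j| := (pow_pos h0 k).trans_le hjk
    exact pos_of_mul_pos_right this (ha j).le
  -- the truncated normal
  set f : Euc n := ∑ i ∈ S, ε i • b i with hf
  have hbf : ∀ i, ⟪b i, f⟫_ℝ = if i ∈ S then ε i else 0 := fun i => by
    simp [hf, inner_sum, inner_smul_right, b.inner_eq_ite]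
  have hfn : ‖f‖ ^ 2 = ∑ i ∈ S, ε i ^ 2 := by
    rw [← b.sum_sq_norm_inner_right f]
    simp [hbf]
  have hfj : |ε j| ≤ ‖f‖ := by
    have := abs_real_inner_le_norm (b j) f
    rwa [hbf, if_pos hjS, b.norm_eq_one, one_mul] at this
  have hf0 : 0 < ‖f‖ := hεj.trans_le hfj
  have hfle : ‖f‖ ≤ √n * |ε j| := by
    refine abs_le_of_sq_le_sq' ?_ (by positivity) |>.2
    rw [hfn, mul_pow, Real.sq_sqrt hn0.le, sq_abs]
    calc ∑ i ∈ S, ε i ^ 2 ≤ ∑ _i ∈ S, ε j ^ 2 :=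
          Finset.sum_le_sum fun i hi => sq_le_sq.2 (hj i hi)
      _ = S.card * ε j ^ 2 := by simp
      _ ≤ n * ε j ^ 2 := by
          refine mul_le_mul_of_nonneg_right ?_ (sq_nonneg _)
          exact_mod_cast (Finset.card_le_univ S).trans_eq (by simp)
  refine ⟨j, ‖f‖⁻¹ • f, ?_, ?_, fun q hqQ => ?_⟩
  · rw [norm_smul, norm_inv, norm_norm, inv_mul_cancel₀ hf0.ne']
  · rw [inner_smul_right, hbf, if_pos hjS, abs_mul, abs_inv, abs_norm, inv_mul_eq_div,
      div_le_div_iff₀ (by positivity) hf0]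
    linarith
  · have he : e = f + ∑ i ∈ Sᶜ, ε i • b i := by
      rw [hf, Finset.sum_add_sum_compl]
      exact (b.sum_repr' e).symm
    have h2 : ⟪e, q - q₁⟫_ℝ ≤ σ ^ n * (n * R) := by
      have : q - q₁ = (q - q₀) + σ ^ n • (q₀ - z) := by rw [hq]; abel
      rw [this, inner_add_right, inner_smul_right]
      have h3 : ⟪e, q₀ - z⟫_ℝ ≤ n * R := by
        rw [← b.sum_inner_mul_inner]
        calc ∑ i, ⟪e, b i⟫_ℝ * ⟪b i, q₀ - z⟫_ℝ ≤ ∑ _i : Fin n, R := by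
              refine Finset.sum_le_sum fun i _ => ?_
              calc ⟪e, b i⟫_ℝ * ⟪b i, q₀ - z⟫_ℝ ≤ |⟪b i, e⟫_ℝ| * |⟪b i, q₀ - z⟫_ℝ| := by
                    rw [← abs_mul, real_inner_comm]; exact le_abs_self _
                _ ≤ |⟪b i, e⟫_ℝ| * (R * a i) := by gcongr; exact hbox q₀ hq₀ i
                _ = R * (a i * |⟪b i, e⟫_ℝ|) := by ring
                _ ≤ R * 1 := by gcongr; exact hle i
                _ = R := mul_one R
          _ = n * R := by simp
      have := hsup q hqQ
      have : σ ^ n * ⟪e, q₀ - z⟫_ℝ ≤ σ ^ n * (n * R) := by gcongr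
      linarith
    have h4 : -(∑ i ∈ Sᶜ, ε i * ⟪b i, q - q₁⟫_ℝ) ≤ n * (2 * R * σ ^ (k + 1)) := by
      rw [← Finset.sum_neg_distrib]
      calc ∑ i ∈ Sᶜ, -(ε i * ⟪b i, q - q₁⟫_ℝ) ≤ ∑ _i ∈ Sᶜ, 2 * R * σ ^ (k + 1) := by
            refine Finset.sum_le_sum fun i hi => ?_
            have hi' : a i * |ε i| < σ ^ (k + 1) := by
              refine (hk i).resolve_right fun h => ?_
              exact (Finset.mem_compl.1 hi) (Finset.mem_filter.2 ⟨Finset.mem_univ _, h⟩)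
            calc -(ε i * ⟪b i, q - q₁⟫_ℝ) ≤ |ε i| * |⟪b i, q - q₁⟫_ℝ| := by
                  rw [← abs_mul]; exact neg_le_abs _
              _ ≤ |ε i| * (2 * R * a i) := by gcongr; exact inBox_inner_le hbox hqQ hq₁ i
              _ = 2 * R * (a i * |ε i|) := by ring
              _ ≤ 2 * R * σ ^ (k + 1) := by gcongr
        _ = (Sᶜ).card * (2 * R * σ ^ (k + 1)) := by simp
        _ ≤ n * (2 * R * σ ^ (k + 1)) := by
            refine mul_le_mul_of_nonneg_right ?_ (by positivity)
            exact_mod_cast (Finset.card_le_univ Sᶜ).trans_eq (by simp)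
    have h5 : ⟪f, q - q₁⟫_ℝ ≤ 3 * n * R * σ ^ (k + 1) := by
      have h6 : ⟪e, q - q₁⟫_ℝ = ⟪f, q - q₁⟫_ℝ + ∑ i ∈ Sᶜ, ε i * ⟪b i, q - q₁⟫_ℝ := by
        conv_lhs => rw [he]
        rw [inner_add_left]
        congr 1
        rw [sum_inner]
        simp only [inner_smul_left, RCLike.conj_to_real]
      have h7 : σ ^ n * (n * R) ≤ σ ^ (k + 1) * (n * R) :=
        mul_le_mul_of_nonneg_right (pow_le_pow_of_le_one h0.le h1 hkn) (by positivity)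
      linarith
    rw [inner_smul_left, RCLike.conj_to_real, inv_mul_le_iff₀ hf0]
    calc ⟪f, q - q₁⟫_ℝ ≤ 3 * n * R * σ ^ (k + 1) := h5
      _ = 3 * n * R * σ * σ ^ k := by ring
      _ ≤ 3 * n * R * σ * (a j * |ε j|) := by gcongr
      _ = |ε j| * (3 * n * R * σ * a j) := by ring
      _ ≤ ‖f‖ * (3 * n * R * σ * a j) := by
        have := ha j
        gcongr

/-- If the segment from the centre of the box to `q₀ ∈ Q`, shortened by the proportion `σ ^ n` at
`q₀`, ends at `q₁`, and `Q` has a supporting hyperplane at `q₀`, then tilting the hyperplane gives a slab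
that contains `Q` on one side of `q₁` and is thin compared with one axis of the box. The normal
`e` of the hyperplane is truncated to the coordinates `i` for which `a i * |⟪b i, e⟫|` is above a gap
in the scale of powers of `σ`. -/
theorem exists_tilted_normal {Q : Set (Euc n)}
    {b : OrthonormalBasis (Fin n) ℝ (Euc n)} {a : Fin n → ℝ} (ha : ∀ i, 0 < a i) {z : Euc n}
    {R : ℝ} (hR : 0 ≤ R) (hbox : InBox Q b a z R) {q₀ q₁ e : Euc n} (hq₀ : q₀ ∈ Q) (hq₁ : q₁ ∈ Q)
    (he : e ≠ 0) (hsup : ∀ q ∈ Q, ⟪e, q - q₀⟫_ℝ ≤ 0) {σ : ℝ} (h0 : 0 < σ) (h1 : σ ≤ 1)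
    (hq : q₁ = q₀ - σ ^ n • (q₀ - z)) :
    ∃ j, ∃ e' : Euc n, ‖e'‖ = 1 ∧ 1 / √n ≤ |⟪b j, e'⟫_ℝ| ∧
      ∀ q ∈ Q, ⟪e', q - q₁⟫_ℝ ≤ 3 * n * R * σ * a j := by
  obtain ⟨i₁, hi₁⟩ : ∃ i, ⟪b i, e⟫_ℝ ≠ 0 := by
    by_contra! h
    refine he ?_
    rw [← b.sum_repr' e]
    simp [h]
  obtain ⟨i₀, -, hi₀⟩ := Finset.exists_max_image Finset.univ (fun i => a i * |⟪b i, e⟫_ℝ|)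
    ⟨i₁, Finset.mem_univ _⟩
  set m := a i₀ * |⟪b i₀, e⟫_ℝ| with hm
  have hm0 : 0 < m :=
    (mul_pos (ha i₁) (abs_pos.2 hi₁)).trans_le (hi₀ i₁ (Finset.mem_univ _))
  have hs : ∀ i, a i * |⟪b i, m⁻¹ • e⟫_ℝ| = m⁻¹ * (a i * |⟪b i, e⟫_ℝ|) := fun i => by
    rw [inner_smul_right, abs_mul, abs_of_pos (inv_pos.2 hm0)]; ring
  refine exists_tilted_normal_of_normalized ha hR hbox hq₀ hq₁ (e := m⁻¹ • e) (fun q hqQ => ?_) h0 h1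
    hq (fun i => ?_) (i₀ := i₀) ?_
  · rw [inner_smul_left, RCLike.conj_to_real]
    exact mul_nonpos_of_nonneg_of_nonpos (inv_nonneg.2 hm0.le) (hsup q hqQ)
  · rw [hs, inv_mul_le_iff₀ hm0, mul_one]
    exact hi₀ i (Finset.mem_univ _)
  · rw [hs, ← hm, inv_mul_cancel₀ hm0.ne']

theorem coordMatrix_self (b : OrthonormalBasis (Fin n) ℝ (Euc n)) : coordMatrix b b = 1 := by
  ext i j
  simp [coordMatrix, b.inner_eq_ite, Matrix.one_apply]

theorem det_coordMatrix_update (b : OrthonormalBasis (Fin n) ℝ (Euc n)) (j : Fin n) (e : Euc n) :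
    (coordMatrix b (Function.update b j e)).det = ⟪b j, e⟫_ℝ := by
  have h : coordMatrix b (Function.update b j e)
      = (1 : Matrix (Fin n) (Fin n) ℝ).updateCol j fun i => ⟪b i, e⟫_ℝ := by
    ext i k
    rcases eq_or_ne k j with rfl | hk
    · simp [coordMatrix]
    · simp [coordMatrix, hk, b.inner_eq_ite, Matrix.one_apply]
  rw [h, ← Matrix.cramer_apply, Matrix.cramer_one]
  rfl

theorem exists_supporting_normal {Q : Set (Euc n)} (hconv : Convex ℝ Q)
    (hint : (interior Q).Nonempty) {q₀ : Euc n} (hq₀ : q₀ ∈ frontier Q) :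
    ∃ e : Euc n, e ≠ 0 ∧ ∀ q ∈ Q, ⟪e, q - q₀⟫_ℝ ≤ 0 := by
  obtain ⟨f, hf⟩ := geometric_hahn_banach_open_point hconv.interior isOpen_interior hq₀.2
  obtain ⟨q₁, hq₁⟩ := hint
  set e := (InnerProductSpace.toDual ℝ (Euc n)).symm f with he
  have hfe : ∀ w, ⟪e, w⟫_ℝ = f w := fun w => InnerProductSpace.toDual_symm_apply
  refine ⟨e, fun h0 => ?_, fun q hq => ?_⟩
  · have h1 := hf q₁ hq₁
    rw [← hfe, ← hfe, h0, inner_zero_left, inner_zero_left] at h1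
    exact lt_irrefl _ h1
  · have h2 : q ∈ closure (interior Q) := by
      rw [hconv.closure_interior_eq_closure_of_nonempty_interior ⟨q₁, hq₁⟩]
      exact subset_closure hq
    have h3 : closure (interior Q) ⊆ {w | f w ≤ f q₀} :=
      closure_minimal (fun w hw => (hf w hw).le) (isClosed_le f.continuous continuous_const)
    have h4 : f q ≤ f q₀ := h3 h2
    rw [inner_sub_right, hfe, hfe]
    linarith

/-- The box around the dilated ellipsoid, with the volume of the ellipsoid as lower bound for the volume
of `Q`. -/
theorem exists_box_of_isJohnEllipsoid {Q : Set (Euc n)} (hQ : IsCompact Q)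
    {L : Euc n ≃ᵃ[ℝ] Euc n} (hL : IsJohnEllipsoid L Q) :
    ∃ (b : OrthonormalBasis (Fin n) ℝ (Euc n)) (a : Fin n → ℝ), (∀ i, 0 < a i) ∧
      InBox Q b a (L 0) n ∧
      (∏ i, a i) * volume.real (Metric.closedBall (0 : Euc n) 1) ≤ volume.real Q := by
  set A : Euc n →ₗ[ℝ] Euc n := (L.linear : Euc n →ₗ[ℝ] Euc n) with hA
  have hLA : ∀ x, L x = L 0 + A x := fun x => by
    have := L.map_vadd 0 x
    simp only [vadd_eq_add, add_zero] at this
    rw [this, add_comm]; rfl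
  have hdet : A.det ≠ 0 := (LinearEquiv.isUnit_det' L.linear).ne_zero
  obtain ⟨b, hb⟩ := exists_principal_axes A
  refine ⟨b, fun i => ‖A.adjoint (b i)‖, fun i => ?_, inBox_of_linear b fun q hq => ?_, ?_⟩
  · refine (norm_nonneg _).lt_of_ne fun h => ?_
    rw [Finset.prod_eq_zero (Finset.mem_univ i) h.symm] at hb
    exact (abs_pos.2 hdet).ne hb
  · obtain ⟨_, ⟨x, hx, rfl⟩, rfl⟩ := hL.2 hq
    refine ⟨(n : ℝ) • x, ?_, ?_⟩
    · rw [norm_smul, Real.norm_natCast]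
      exact mul_le_of_le_one_right (Nat.cast_nonneg n) (mem_closedBall_zero_iff.1 hx)
    · rw [AffineMap.homothety_apply, hLA x]
      simp [add_comm]
  · have h1 : (fun w => L 0 + w) '' (A '' Metric.closedBall 0 1) ⊆ Q := by
      rintro _ ⟨_, ⟨x, hx, rfl⟩, rfl⟩
      exact hL.1 ⟨x, hx, hLA x⟩
    have h2 := measureReal_mono (μ := volume) h1 hQ.measure_lt_top.ne
    rw [image_add_left, measureReal_def, measure_preimage_add,
      Measure.addHaar_image_linearMap, ENNReal.toReal_mul, ENNReal.toReal_ofReal (abs_nonneg _)] at h2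
    rw [hb]
    exact h2

/-! ### Oscillation of the gradient of the modified cost -/

theorem norm_le_of_inner_le {v : Euc n} {B : ℝ} (hB : 0 ≤ B) (h : ∀ w, ⟪v, w⟫_ℝ ≤ B * ‖w‖) :
    ‖v‖ ≤ B := by
  rcases eq_or_ne v 0 with rfl | hv
  · rwa [norm_zero]
  · have h1 := h v
    rw [real_inner_self_eq_norm_mul_norm] at h1
    exact le_of_mul_le_mul_right h1 (norm_pos_iff.2 hv)

theorem norm_sub_sub_le_on_closure {f g : Euc n → Euc n} {s : Set (Euc n)} {C : ℝ}
    (hf : ContinuousOn f (closure s)) (hg : ContinuousOn g (closure s))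
    (h : ∀ y ∈ s, ∀ y' ∈ s, ‖(f y - f y') - (g y - g y')‖ ≤ C * ‖g y - g y'‖) {y y' : Euc n}
    (hy : y ∈ closure s) (hy' : y' ∈ closure s) :
    ‖(f y - f y') - (g y - g y')‖ ≤ C * ‖g y - g y'‖ := by
  have h1 : ContinuousOn (fun z : Euc n × Euc n => f z.1) (closure s ×ˢ closure s) :=
    hf.comp continuousOn_fst fun z hz => hz.1
  have h2 : ContinuousOn (fun z : Euc n × Euc n => f z.2) (closure s ×ˢ closure s) :=
    hf.comp continuousOn_snd fun z hz => hz.2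
  have h3 : ContinuousOn (fun z : Euc n × Euc n => g z.1) (closure s ×ˢ closure s) :=
    hg.comp continuousOn_fst fun z hz => hz.1
  have h4 : ContinuousOn (fun z : Euc n × Euc n => g z.2) (closure s ×ˢ closure s) :=
    hg.comp continuousOn_snd fun z hz => hz.2
  have h5 : ContinuousOn (fun z : Euc n × Euc n => ‖(f z.1 - f z.2) - (g z.1 - g z.2)‖)
      (closure s ×ˢ closure s) :=
    ((h1.sub h2).sub (h3.sub h4)).norm
  have h6 : ContinuousOn (fun z : Euc n × Euc n => C * ‖g z.1 - g z.2‖)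
      (closure s ×ˢ closure s) := continuousOn_const.mul (h3.sub h4).norm
  rw [← closure_prod_eq] at h5 h6
  have h7 : (y, y') ∈ closure (s ×ˢ s) := by rw [closure_prod_eq]; exact ⟨hy, hy'⟩
  have h8 := le_on_closure (fun z hz => h z.1 hz.1 z.2 hz.2) h5 h6 h7
  exact h8

namespace RegCost

variable {U V : Set (Euc n)} {c : Euc n → Euc n → ℝ} (H : RegCost U V c) {x y : Euc n}
include H

theorem exists_fderiv_xOf_bound : ∃ C : ℝ, 0 < C ∧ ∀ ybar ∈ closure V, ∀ q ∈ coordDomain c U ybar,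
    ‖fderiv ℝ (xOf c U ybar) q‖ ≤ C := by
  obtain ⟨m, hm, hlow⟩ := H.exists_mixedHess_lower
  refine ⟨1 / m, by positivity, fun ybar hy q hq => ?_⟩
  refine ContinuousLinearMap.opNorm_le_bound _ (by positivity) fun ζ => ?_
  have h1 := hlow _ (subset_closure (H.xOf_mem hq hy)) _ hy (fderiv ℝ (xOf c U ybar) q ζ)
  rw [H.mixedHess_fderiv_xOf hq hy, norm_neg] at h1
  rw [one_div, ← div_eq_inv_mul, le_div_iff₀ hm]
  linarith

/-- In the coordinates at any `ybar` the mixed Hessian is Lipschitz, uniformly in `ybar`. -/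
theorem exists_mixedHess_lipschitz : ∃ C : ℝ, 0 < C ∧ ∀ ybar ∈ closure V,
    ∀ q ∈ coordDomain c U ybar, ∀ q' ∈ coordDomain c U ybar, ∀ y ∈ closure V,
      ‖mixedHess c (xOf c U ybar q) y - mixedHess c (xOf c U ybar q') y‖ ≤ C * ‖q - q'‖ := by
  obtain ⟨A, hA, hX⟩ := H.exists_fderiv_xOf_bound
  obtain ⟨B, hB, hjet⟩ := H.exists_jet_bound
  refine ⟨B * A, by positivity, fun ybar hyb q hq q' hq' y hy => ?_⟩
  refine ContinuousLinearMap.opNorm_le_bound _ (by positivity) fun ξ => ?_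
  refine norm_le_of_inner_le (by positivity) fun w => ?_
  have hdom : ∀ r ∈ Icc (0 : ℝ) 1, q' + r • (q - q') ∈ coordDomain c U ybar := fun r hr =>
    (H.b2.left ybar hyb).add_smul_sub_mem hq' hq hr
  have hC : ∀ r ∈ Icc (0 : ℝ) 1,
      ContDiffAt ℝ 4 (Function.uncurry c) (xOf c U ybar (q' + r • (q - q')), y) := fun r hr =>
    H.b0.contDiff _ (subset_closure (H.xOf_mem (hdom r hr) hyb)) _ hy
  have hd : ∀ r ∈ Icc (0 : ℝ) 1,
      HasDerivAt (fun r : ℝ => xOf c U ybar (q' + r • (q - q')))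
        (fderiv ℝ (xOf c U ybar) (q' + r • (q - q')) (q - q')) r := fun r hr => by
    have hl : HasDerivAt (fun r : ℝ => q' + r • (q - q')) (q - q') r := by
      simpa using ((hasDerivAt_id r).smul_const (q - q')).const_add q'
    exact ((H.contDiffAt_xOf (hdom r hr) hyb).differentiableAt
      (by norm_num)).hasFDerivAt.comp_hasDerivAt r hl
  have key := norm_image_sub_le_of_norm_deriv_le_segment_01'
    (f := fun r : ℝ => jet c 2 (xOf c U ybar (q' + r • (q - q'))) y ![(ξ, 0), (0, w)])
    (C := B * (A * ‖q - q'‖ * (‖ξ‖ * ‖w‖)))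
    (fun r hr => (jet_hasDerivAt (k := 2) (Y := fun _ => y) (hC r hr) (by norm_num) (hd r hr)
      (hasDerivAt_const r y) _).hasDerivWithinAt) fun r hr => ?_
  · have h0 := inner_mixedHess (hC 0 ⟨le_rfl, zero_le_one⟩) ξ w
    have h1 := inner_mixedHess (hC 1 ⟨zero_le_one, le_rfl⟩) ξ w
    beta_reduce at key
    rw [← h0, ← h1, zero_smul, add_zero, one_smul, add_sub_cancel, ← inner_sub_left,
      ← sub_apply] at key
    refine (le_abs_self _).trans (key.trans (le_of_eq ?_))
    ring
  · have hr' := Ico_subset_Icc_self hr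
    refine (hjet _ (subset_closure (H.xOf_mem (hdom r hr') hyb)) _ hy 3 (by norm_num) _).trans ?_
    have : ‖fderiv ℝ (xOf c U ybar) (q' + r • (q - q')) (q - q')‖ ≤ A * ‖q - q'‖ :=
      (ContinuousLinearMap.le_opNorm _ _).trans (by gcongr; exact hX ybar hyb _ (hdom r hr'))
    simp only [Fin.prod_univ_succ, Fin.cons_zero, Fin.cons_succ, Matrix.cons_val_zero,
      Matrix.cons_val_succ, Fin.prod_univ_zero, mul_one, Prod.norm_mk, norm_zero,
      max_eq_left (norm_nonneg _), max_eq_right (norm_nonneg _)]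
    gcongr

/-- The inverse of the coordinate map has a Lipschitz derivative. -/
theorem exists_fderiv_xOf_lipschitz : ∃ C : ℝ, 0 < C ∧ ∀ ybar ∈ closure V,
    ∀ q ∈ coordDomain c U ybar, ∀ q' ∈ coordDomain c U ybar,
      ‖fderiv ℝ (xOf c U ybar) q - fderiv ℝ (xOf c U ybar) q'‖ ≤ C * ‖q - q'‖ := by
  obtain ⟨A, hA, hX⟩ := H.exists_fderiv_xOf_bound
  obtain ⟨B, hB, hM⟩ := H.exists_mixedHess_lipschitz
  obtain ⟨m, hm, hlow⟩ := H.exists_mixedHess_lower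
  refine ⟨B * A / m, by positivity, fun ybar hy q hq q' hq' => ?_⟩
  refine ContinuousLinearMap.opNorm_le_bound _ (by positivity) fun ζ => ?_
  have h1 := hlow _ (subset_closure (H.xOf_mem hq hy)) _ hy
    ((fderiv ℝ (xOf c U ybar) q - fderiv ℝ (xOf c U ybar) q') ζ)
  have h2 : mixedHess c (xOf c U ybar q) ybar
      ((fderiv ℝ (xOf c U ybar) q - fderiv ℝ (xOf c U ybar) q') ζ) =
      -(mixedHess c (xOf c U ybar q) ybar - mixedHess c (xOf c U ybar q') ybar)
        (fderiv ℝ (xOf c U ybar) q' ζ) := by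
    rw [sub_apply, map_sub, H.mixedHess_fderiv_xOf hq hy, sub_apply,
      H.mixedHess_fderiv_xOf hq' hy]
    abel
  rw [h2, norm_neg] at h1
  have h3 : ‖(mixedHess c (xOf c U ybar q) ybar - mixedHess c (xOf c U ybar q') ybar)
      (fderiv ℝ (xOf c U ybar) q' ζ)‖ ≤ B * ‖q - q'‖ * (A * ‖ζ‖) := by
    refine (ContinuousLinearMap.le_opNorm _ _).trans ?_
    have h4 := hM ybar hy q hq q' hq' ybar hy
    have h5 : ‖fderiv ℝ (xOf c U ybar) q' ζ‖ ≤ A * ‖ζ‖ :=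
      (ContinuousLinearMap.le_opNorm _ _).trans (by gcongr; exact hX ybar hy q' hq')
    gcongr
  rw [div_mul_eq_mul_div, div_mul_eq_mul_div, le_div_iff₀ hm]
  linarith

theorem hasFDerivAt_pMap (hx : x ∈ closure U) (hy : y ∈ closure V) :
    HasFDerivAt (pMap c x) (-mixedHess (flipCost c) y x) y :=
  H.flip.hasFDerivAt_qMap hy hx

theorem continuousAt_pMap (hx : x ∈ closure U) (hy : y ∈ closure V) : ContinuousAt (pMap c x) y :=
  (H.hasFDerivAt_pMap hx hy).continuousAt

/-- A Lipschitz bound on the convex set `-D_x c(x', V)` for the map `-D_x c(x', y) ↦ -D_x c(x, y)`,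
compared with the identity. -/
theorem norm_pMap_sub_le_interior {x x' y y' : Euc n} (hx : x ∈ closure U) (hx' : x' ∈ closure U)
    {A L : ℝ} (hL0 : 0 ≤ L)
    (hY : ∀ p ∈ coordDomain (flipCost c) V x', ‖fderiv ℝ (xOf (flipCost c) V x') p‖ ≤ A)
    (hL : ∀ y ∈ closure V, ‖mixedHess c x y - mixedHess c x' y‖ ≤ L) (hy : y ∈ V) (hy' : y' ∈ V) :
    ‖(pMap c x y - pMap c x y') - (pMap c x' y - pMap c x' y')‖ ≤
      L * A * ‖pMap c x' y - pMap c x' y'‖ := by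
  have hdiff : ∀ p ∈ coordDomain (flipCost c) V x',
      HasFDerivWithinAt (fun p => pMap c x (xOf (flipCost c) V x' p) -
        pMap c x' (xOf (flipCost c) V x' p))
        ((-mixedHess (flipCost c) (xOf (flipCost c) V x' p) x -
          -mixedHess (flipCost c) (xOf (flipCost c) V x' p) x').comp
          (fderiv ℝ (xOf (flipCost c) V x') p)) (coordDomain (flipCost c) V x') p := by
    intro p hp
    have hyp := subset_closure (H.flip.xOf_mem hp hx')
    have h1 := ((H.flip.contDiffAt_xOf hp hx').differentiableAt (by norm_num)).hasFDerivAt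
    have h2 := (H.hasFDerivAt_pMap hx hyp).sub (H.hasFDerivAt_pMap hx' hyp)
    exact (HasFDerivAt.comp p h2 h1).hasFDerivWithinAt
  have hbd : ∀ p ∈ coordDomain (flipCost c) V x',
      ‖(-mixedHess (flipCost c) (xOf (flipCost c) V x' p) x -
          -mixedHess (flipCost c) (xOf (flipCost c) V x' p) x').comp
          (fderiv ℝ (xOf (flipCost c) V x') p)‖ ≤ L * A := by
    intro p hp
    have hyp := subset_closure (H.flip.xOf_mem hp hx')
    refine (ContinuousLinearMap.opNorm_comp_le _ _).trans ?_
    have h1 : ‖-mixedHess (flipCost c) (xOf (flipCost c) V x' p) x -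
          -mixedHess (flipCost c) (xOf (flipCost c) V x' p) x'‖ ≤ L := by
      rw [mixedHess_flipCost (H.b0.contDiff x hx _ hyp),
        mixedHess_flipCost (H.b0.contDiff x' hx' _ hyp), neg_sub_neg, ← map_sub,
        LinearIsometryEquiv.norm_map, norm_sub_rev]
      exact hL _ hyp
    have h2 := hY p hp
    gcongr
  have h := (H.b2.right x' hx').norm_image_sub_le_of_norm_hasFDerivWithin_le hdiff hbd
    (x := pMap c x' y') (y := pMap c x' y) ⟨y', hy', rfl⟩ ⟨y, hy, rfl⟩
  have e : ∀ y ∈ V, xOf (flipCost c) V x' (pMap c x' y) = y := fun y hy =>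
    H.flip.xOf_qMap (subset_closure hy) hx'
  beta_reduce at h
  rw [e y hy, e y' hy'] at h
  rwa [sub_sub_sub_comm]

theorem norm_pMap_sub_le {x x' y y' : Euc n} (hx : x ∈ closure U) (hx' : x' ∈ closure U)
    {A L : ℝ} (hL0 : 0 ≤ L)
    (hY : ∀ p ∈ coordDomain (flipCost c) V x', ‖fderiv ℝ (xOf (flipCost c) V x') p‖ ≤ A)
    (hL : ∀ y ∈ closure V, ‖mixedHess c x y - mixedHess c x' y‖ ≤ L) (hy : y ∈ closure V)
    (hy' : y' ∈ closure V) :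
    ‖(pMap c x y - pMap c x y') - (pMap c x' y - pMap c x' y')‖ ≤
      L * A * ‖pMap c x' y - pMap c x' y'‖ := by
  have hcont : ∀ x ∈ closure U, ContinuousOn (pMap c x) (closure V) := fun x hx y hy =>
    (H.continuousAt_pMap hx hy).continuousWithinAt
  exact norm_sub_sub_le_on_closure (hcont x hx) (hcont x' hx')
    (fun _ hy _ hy' => H.norm_pMap_sub_le_interior hx hx' hL0 hY hL hy hy') hy hy'

/-- The differences of `-D_x c(x, ·)` for two points `x` are comparable up to the distance of the
points in the coordinates at `ybar`. -/
theorem exists_pMap_oscillation : ∃ C : ℝ, 0 < C ∧ ∀ ybar ∈ closure V,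
    ∀ q ∈ coordDomain c U ybar, ∀ q' ∈ coordDomain c U ybar, ∀ y ∈ closure V, ∀ y' ∈ closure V,
      ‖(pMap c (xOf c U ybar q) y - pMap c (xOf c U ybar q) y') -
          (pMap c (xOf c U ybar q') y - pMap c (xOf c U ybar q') y')‖ ≤
        C * ‖q - q'‖ * ‖pMap c (xOf c U ybar q') y - pMap c (xOf c U ybar q') y'‖ := by
  obtain ⟨A, hA, hY⟩ := H.flip.exists_fderiv_xOf_bound
  obtain ⟨B, hB, hM⟩ := H.exists_mixedHess_lipschitz
  refine ⟨B * A, by positivity, fun ybar hyb q hq q' hq' y hy y' hy' => ?_⟩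
  have hx := subset_closure (H.xOf_mem hq hyb)
  have hx' := subset_closure (H.xOf_mem hq' hyb)
  refine (H.norm_pMap_sub_le hx hx' (by positivity) (hY _ hx') (hM ybar hyb q hq q' hq') hy
    hy').trans_eq ?_
  ring

end RegCost

/-- The gradient in `q` of `-c̃(q, y)`, the negative of the modified cost. -/
def chartGrad (c : Euc n → Euc n → ℝ) (U : Set (Euc n)) (ybar q y : Euc n) : Euc n :=
  ContinuousLinearMap.adjoint (fderiv ℝ (xOf c U ybar) q)
    (pMap c (xOf c U ybar q) y - pMap c (xOf c U ybar q) ybar)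

namespace RegCost

variable {U V : Set (Euc n)} {c : Euc n → Euc n → ℝ} (H : RegCost U V c) {ybar q : Euc n}
include H

theorem fderiv_xOf_mixedHess (hq : q ∈ coordDomain c U ybar) (hy : ybar ∈ closure V) (w : Euc n) :
    fderiv ℝ (xOf c U ybar) q (mixedHess c (xOf c U ybar q) ybar w) = -w := by
  refine H.injective_mixedHess (subset_closure (H.xOf_mem hq hy)) hy ?_
  rw [H.mixedHess_fderiv_xOf hq hy, map_neg]

theorem hasGradientAt_modCost (hy : ybar ∈ closure V) (hq : q ∈ coordDomain c U ybar) {y : Euc n}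
    (hy' : y ∈ closure V) :
    HasGradientAt (fun q => -modCost c U ybar q y) (chartGrad c U ybar q y) q := by
  have hx := subset_closure (H.xOf_mem hq hy)
  have hXd := ((H.contDiffAt_xOf hq hy).differentiableAt (by norm_num)).hasFDerivAt
  have hcd : ∀ y ∈ closure V,
      HasGradientAt (fun x => c x y) (gradX c (xOf c U ybar q) y) (xOf c U ybar q) := fun y hy => by
    have h := (H.b0.contDiff _ hx y hy).comp (xOf c U ybar q) (contDiff_prodMk_left y).contDiffAt
    exact (h.differentiableAt (by norm_num)).hasGradientAt
  have h1 := (((hcd y hy').hasFDerivAt.comp q hXd).sub ((hcd ybar hy).hasFDerivAt.comp q hXd)).neg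
  rw [hasGradientAt_iff_hasFDerivAt]
  refine h1.congr_fderiv ?_
  ext w
  simp only [neg_apply, sub_apply, ContinuousLinearMap.comp_apply,
    InnerProductSpace.toDual_apply_apply, chartGrad, ContinuousLinearMap.adjoint_inner_left, pMap,
    inner_sub_left, inner_neg_left]
  ring

/-- The relative oscillation of the gradient is at most a multiple of the distance, uniformly in
`ybar`. -/
theorem exists_chartGrad_oscillation : ∃ K : ℝ, 0 ≤ K ∧ ∀ ybar ∈ closure V,
    ∀ q ∈ coordDomain c U ybar, ∀ q' ∈ coordDomain c U ybar, ∀ y ∈ closure V,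
      ‖chartGrad c U ybar q y - chartGrad c U ybar q' y‖ ≤
        K * ‖q - q'‖ * ‖chartGrad c U ybar q' y‖ := by
  obtain ⟨A, hA, hX⟩ := H.exists_fderiv_xOf_bound
  obtain ⟨B, hB, hXl⟩ := H.exists_fderiv_xOf_lipschitz
  obtain ⟨D, hD, hP⟩ := H.exists_pMap_oscillation
  obtain ⟨M, hM, hMb⟩ := H.exists_mixedHess_upper
  refine ⟨(A * D + B) * M, by positivity, fun ybar hyb q hq q' hq' y hy => ?_⟩
  set P := pMap c (xOf c U ybar q) y - pMap c (xOf c U ybar q) ybar with hPd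
  set P' := pMap c (xOf c U ybar q') y - pMap c (xOf c U ybar q') ybar with hPd'
  set X := fderiv ℝ (xOf c U ybar) q with hXd
  set X' := fderiv ℝ (xOf c U ybar) q' with hXd'
  have h1 : ‖P'‖ ≤ M * ‖chartGrad c U ybar q' y‖ := by
    refine norm_le_of_inner_le (by positivity) fun w => ?_
    have h2 : ⟪P', w⟫_ℝ =
        ⟪chartGrad c U ybar q' y, -mixedHess c (xOf c U ybar q') ybar w⟫_ℝ := by
      rw [chartGrad, ContinuousLinearMap.adjoint_inner_left, map_neg,
        H.fderiv_xOf_mixedHess hq' hyb, neg_neg]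
    rw [h2]
    refine (real_inner_le_norm _ _).trans ?_
    have h3 : ‖-mixedHess c (xOf c U ybar q') ybar w‖ ≤ M * ‖w‖ := by
      rw [norm_neg]
      refine (ContinuousLinearMap.le_opNorm _ _).trans ?_
      gcongr
      exact hMb _ (subset_closure (H.xOf_mem hq' hyb)) _ hyb
    calc _ ≤ ‖chartGrad c U ybar q' y‖ * (M * ‖w‖) := by gcongr
      _ = _ := by ring
  have h4 : chartGrad c U ybar q y - chartGrad c U ybar q' y =
      ContinuousLinearMap.adjoint X (P - P') + ContinuousLinearMap.adjoint (X - X') P' := by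
    rw [chartGrad, chartGrad, map_sub _ P P', map_sub _ X X', sub_apply]
    abel
  have h5 : ‖ContinuousLinearMap.adjoint X (P - P')‖ ≤ A * (D * ‖q - q'‖ * ‖P'‖) := by
    refine (ContinuousLinearMap.le_opNorm _ _).trans ?_
    rw [LinearIsometryEquiv.norm_map]
    have e1 := hX ybar hyb q hq
    have e2 := hP ybar hyb q hq q' hq' y hy ybar hyb
    gcongr
  have h6 : ‖ContinuousLinearMap.adjoint (X - X') P'‖ ≤ B * ‖q - q'‖ * ‖P'‖ := by
    refine (ContinuousLinearMap.le_opNorm _ _).trans ?_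
    rw [LinearIsometryEquiv.norm_map]
    have e1 := hXl ybar hyb q hq q' hq'
    gcongr
  rw [h4]
  refine (norm_add_le _ _).trans ((add_le_add h5 h6).trans ?_)
  calc A * (D * ‖q - q'‖ * ‖P'‖) + B * ‖q - q'‖ * ‖P'‖ = (A * D + B) * ‖q - q'‖ * ‖P'‖ := by ring
    _ ≤ (A * D + B) * ‖q - q'‖ * (M * ‖chartGrad c U ybar q' y‖) := by gcongr
    _ = _ := by ring

end RegCost

/-! ### The chart of the modified cost -/

namespace RegCost

variable {U V : Set (Euc n)} {c : Euc n → Euc n → ℝ} (H : RegCost U V c) {ybar q : Euc n}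
include H

theorem closure_coordDomain (hy : ybar ∈ closure V) :
    closure (coordDomain c U ybar) = qMap c ybar '' closure U :=
  (image_closure_of_isCompact H.isCompact_left fun _ hx =>
    (H.hasFDerivAt_qMap hx hy).continuousAt.continuousWithinAt).symm

theorem xOf_mem_closure (hq : q ∈ closure (coordDomain c U ybar)) (hy : ybar ∈ closure V) :
    xOf c U ybar q ∈ closure U := by
  rw [H.closure_coordDomain hy] at hq
  obtain ⟨x, hx, rfl⟩ := hq
  rwa [H.xOf_qMap hx hy]

theorem qMap_xOf_closure (hq : q ∈ closure (coordDomain c U ybar)) (hy : ybar ∈ closure V) :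
    qMap c ybar (xOf c U ybar q) = q := by
  rw [H.closure_coordDomain hy] at hq
  obtain ⟨x, hx, rfl⟩ := hq
  rw [H.xOf_qMap hx hy]

theorem continuousOn_xOf (hy : ybar ∈ closure V) :
    ContinuousOn (xOf c U ybar) (closure (coordDomain c U ybar)) := by
  obtain ⟨-, g, hg, hg'⟩ := H.b1.left ybar hy
  rw [H.closure_coordDomain hy]
  refine ContinuousOn.congr (f := g) ?_ ?_
  · rintro _ ⟨x, hx, rfl⟩
    exact (hg' x hx).continuousAt.continuousWithinAt
  · rintro _ ⟨x, hx, rfl⟩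
    rw [H.xOf_qMap hx hy, hg x hx]

theorem continuousOn_modCost (hy : ybar ∈ closure V) :
    ContinuousOn (Function.uncurry (modCost c U ybar))
      (closure (coordDomain c U ybar) ×ˢ closure V) := by
  have hc : ContinuousOn (Function.uncurry c) (closure U ×ˢ closure V) := fun z hz =>
    (H.b0.contDiff z.1 hz.1 z.2 hz.2).continuousAt.continuousWithinAt
  have h1 : ContinuousOn (fun z : Euc n × Euc n => xOf c U ybar z.1)
      (closure (coordDomain c U ybar) ×ˢ closure V) :=
    (H.continuousOn_xOf hy).comp continuousOn_fst fun z hz => hz.1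
  have h2 := hc.comp (h1.prodMk continuousOn_snd) fun z hz => ⟨H.xOf_mem_closure hz.1 hy, hz.2⟩
  have h3 := hc.comp (h1.prodMk (continuousOn_const (c := ybar))) fun z hz =>
    ⟨H.xOf_mem_closure hz.1 hy, hy⟩
  exact h2.sub h3

theorem injective_adjoint_fderiv_xOf (hq : q ∈ coordDomain c U ybar) (hy : ybar ∈ closure V) :
    Function.Injective (ContinuousLinearMap.adjoint (fderiv ℝ (xOf c U ybar) q)) := by
  intro p p' h
  refine ext_inner_right ℝ fun w => ?_
  have h1 := congrArg (fun v => ⟪v, mixedHess c (xOf c U ybar q) ybar (-w)⟫_ℝ) h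
  simpa only [ContinuousLinearMap.adjoint_inner_left, H.fderiv_xOf_mixedHess hq hy, neg_neg] using h1

/-- The segment between two points in the dual coordinates at `x`. -/
theorem exists_dual_segment {x y₀ y₁ : Euc n} (hx : x ∈ closure U) (hy₀ : y₀ ∈ closure V)
    (hy₁ : y₁ ∈ closure V) :
    ∃ γ : ℝ → Euc n, ContinuousOn γ (Icc 0 1) ∧ ∀ s ∈ Icc (0 : ℝ) 1, γ s ∈ closure V ∧
      pMap c x (γ s) = pMap c x y₀ + s • (pMap c x y₁ - pMap c x y₀) := by
  have hmem : ∀ s ∈ Icc (0 : ℝ) 1, pMap c x y₀ + s • (pMap c x y₁ - pMap c x y₀) ∈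
      closure (coordDomain (flipCost c) V x) := by
    have h : ∀ y ∈ closure V, pMap c x y ∈ closure (coordDomain (flipCost c) V x) := fun y hy => by
      rw [H.flip.closure_coordDomain hx]
      exact ⟨y, hy, rfl⟩
    exact fun s hs => (H.b2.right x hx).closure.add_smul_sub_mem (h _ hy₀) (h _ hy₁) hs
  refine ⟨fun s => xOf (flipCost c) V x (pMap c x y₀ + s • (pMap c x y₁ - pMap c x y₀)), ?_,
    fun s hs => ⟨H.flip.xOf_mem_closure (hmem s hs) hx, H.flip.qMap_xOf_closure (hmem s hs) hx⟩⟩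
  exact (H.flip.continuousOn_xOf hx).comp (by fun_prop) hmem

/-- The modified cost at `ybar` satisfies the hypotheses of the abstract argument, with an
oscillation constant that does not depend on `ybar`. -/
theorem exists_costChart (h3 : B3 U V c) : ∃ K : ℝ, ∀ ybar ∈ closure V,
    CostChart (coordDomain c U ybar) (closure V) (fun q y => -modCost c U ybar q y)
      (chartGrad c U ybar) ybar K := by
  obtain ⟨K, hK0, hK⟩ := H.exists_chartGrad_oscillation
  obtain ⟨K', hK'0, hK'⟩ := H.exists_crossCurvatureBound h3
  refine ⟨K, fun ybar hy => ?_⟩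
  refine
    { isOpen := H.isOpen_coordDomain hy
      isCompact := H.isCompact_right
      ybar_mem := hy
      continuousOn := (H.continuousOn_modCost hy).neg
      apply_ybar := fun q => by simp [modCost]
      hasGradientAt := fun q hq y hy' => H.hasGradientAt_modCost hy hq hy'
      continuousOn_grad := fun q hq y hy' => ?_
      injOn := fun q hq y₀ hy₀ y₁ hy₁ h => ?_
      nonneg := hK0
      oscillation := fun q hq q' hq' y hy' => hK ybar hy q hq q' hq' y hy'
      convex := (H.b2.left ybar hy).closure
      quasiconvex := fun y hy' q₀ hq₀ q₁ hq₁ s hs => ?_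
      segment := fun q hq y₀ hy₀ y₁ hy₁ => ?_ }
  · have hx := subset_closure (H.xOf_mem hq hy)
    exact ((ContinuousLinearMap.continuous _).continuousAt.comp
      ((H.continuousAt_pMap hx hy').sub continuousAt_const)).continuousWithinAt
  · have hx := subset_closure (H.xOf_mem hq hy)
    exact H.flip.injOn_qMap hx hy₀ hy₁
      (sub_left_injective (H.injective_adjoint_fderiv_xOf hq hy h))
  · have hq := (H.b2.left ybar hy).closure.add_smul_sub_mem hq₀ hq₁ hs
    have h := H.maximum_principle hK'0 hK' (H.xOf_mem_closure hq₀ hy) (H.xOf_mem_closure hq₁ hy)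
      (H.xOf_mem_closure hq hy) hy hy' hs (by
        rw [H.qMap_xOf_closure hq hy, H.qMap_xOf_closure hq₀ hy, H.qMap_xOf_closure hq₁ hy])
    simpa only [modCost, neg_sub] using h
  · have hx := subset_closure (H.xOf_mem hq hy)
    obtain ⟨γ, hγ, hγs⟩ := H.exists_dual_segment hx hy₀ hy₁
    refine ⟨γ, hγ, fun s hs => ⟨(hγs s hs).1, ?_, fun q' hq' => ?_⟩⟩
    · rw [chartGrad, chartGrad, chartGrad, (hγs s hs).2, ← map_sub, ← map_smul, ← map_add]
      congr 1
      module
    · have h := H.maximum_principle_dual hK'0 hK' hx (H.xOf_mem_closure hq' hy) hy₀ hy₁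
        (hγs s hs).1 hs (hγs s hs).2
      simp only [modCost]
      rw [← add_le_add_iff_right (c (xOf c U ybar q') ybar - c (xOf c U ybar q) ybar),
        ← max_add_add_right] at h
      convert h using 1
      · ring
      · congr 1 <;> ring

end RegCost

/-! ### Determinants and distortion of volume -/

theorem det_adjoint (A : Euc n →L[ℝ] Euc n) : (ContinuousLinearMap.adjoint A).det = A.det := by
  have h : ((ContinuousLinearMap.adjoint A : Euc n →L[ℝ] Euc n) : Euc n →ₗ[ℝ] Euc n) =
      LinearMap.adjoint (A : Euc n →ₗ[ℝ] Euc n) := by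
    rw [LinearMap.eq_adjoint_iff]
    exact fun x y => ContinuousLinearMap.adjoint_inner_left A y x
  rw [ContinuousLinearMap.det, ContinuousLinearMap.det, h, det_linearAdjoint]

theorem abs_det_neg (A : Euc n →L[ℝ] Euc n) : |(-A).det| = |A.det| := by
  rw [ContinuousLinearMap.det, ContinuousLinearMap.det, ContinuousLinearMap.toLinearMap_neg,
    ← neg_one_smul ℝ, LinearMap.det_smul, abs_mul, abs_pow]
  simp

theorem det_comp (A B : Euc n →L[ℝ] Euc n) : (A.comp B).det = A.det * B.det :=
  LinearMap.det_comp _ _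

theorem toReal_eLpNorm_top_le {X : Type*} [MeasurableSpace X] {μ : Measure X} {S : Set X}
    (hS : MeasurableSet S) {f : X → ℝ} {C : ℝ} (hC : 0 ≤ C) (h : ∀ z ∈ S, |f z| ≤ C) :
    eLpNorm f ∞ (μ.restrict S) ≠ ∞ ∧ (eLpNorm f ∞ (μ.restrict S)).toReal ≤ C := by
  have h1 : eLpNorm f ∞ (μ.restrict S) ≤ ENNReal.ofReal C := by
    rw [eLpNorm_exponent_top]
    exact eLpNormEssSup_le_of_ae_bound (ae_restrict_of_forall_mem hS h)
  exact ⟨ne_top_of_le_ne_top ENNReal.ofReal_ne_top h1, ENNReal.toReal_le_of_le_ofReal hC h1⟩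

/-- A continuous function on an open set is bounded pointwise by its essential supremum. -/
theorem abs_le_toReal_eLpNorm_top {X : Type*} [TopologicalSpace X] [MeasurableSpace X]
    [OpensMeasurableSpace X] {μ : Measure X} [μ.IsOpenPosMeasure] {S W : Set X} (hW : IsOpen W)
    (hWS : W ⊆ S) {f : X → ℝ} (hf : ContinuousOn f W) (hfin : eLpNorm f ∞ (μ.restrict S) ≠ ∞)
    {z : X} (hz : z ∈ W) : |f z| ≤ (eLpNorm f ∞ (μ.restrict S)).toReal := by
  set C := (eLpNorm f ∞ (μ.restrict S)).toReal with hC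
  by_contra! hlt
  have hae : ∀ᵐ z ∂μ.restrict W, |f z| ≤ C := by
    refine ae_mono (Measure.restrict_mono hWS le_rfl) ?_
    filter_upwards [ae_le_eLpNormEssSup (f := f) (μ := μ.restrict S)] with z hz
    rw [← eLpNorm_exponent_top] at hz
    have := ENNReal.toReal_mono hfin hz
    rwa [toReal_enorm, Real.norm_eq_abs] at this
  have hopen : IsOpen (W ∩ {z | C < |f z|}) :=
    hf.abs.isOpen_inter_preimage hW isOpen_Ioi
  have hnull : μ (W ∩ {z | C < |f z|}) = 0 := by
    rw [ae_iff, Measure.restrict_apply₀' hW.nullMeasurableSet] at hae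
    rw [inter_comm]
    simpa only [not_le] using hae
  have := (hopen.measure_eq_zero_iff μ).1 hnull
  exact (this ▸ (⟨hz, hlt⟩ : z ∈ W ∩ {z | C < |f z|}) : z ∈ (∅ : Set X))

namespace RegCost

variable {U V : Set (Euc n)} {c : Euc n → Euc n → ℝ} (H : RegCost U V c) {ybar q : Euc n}
include H

theorem continuousOn_det_mixedHess :
    ContinuousOn (fun z : Euc n × Euc n => (mixedHess c z.1 z.2).det) (closure U ×ˢ closure V) :=
  fun z hz => (ContinuousLinearMap.continuous_det.continuousAt.comp
    (continuousAt_mixedHess (H.b0.contDiff z.1 hz.1 z.2 hz.2))).continuousWithinAt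

theorem abs_det_mixedHess_le {x y : Euc n} (hx : x ∈ U) (hy : y ∈ V) :
    |(mixedHess c x y).det| ≤ gammaPlus c U V := by
  obtain ⟨C, hC⟩ := (H.isCompact_left.prod H.isCompact_right).exists_bound_of_continuousOn
    H.continuousOn_det_mixedHess
  have hsub : U ×ˢ V ⊆ closure U ×ˢ closure V := prod_mono subset_closure subset_closure
  have hopen := H.b0.isOpen_left.prod H.b0.isOpen_right
  exact abs_le_toReal_eLpNorm_top hopen subset_rfl (H.continuousOn_det_mixedHess.mono hsub)
    (toReal_eLpNorm_top_le hopen.measurableSet (abs_nonneg C)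
      fun z hz => (hC z (hsub hz)).trans (le_abs_self C)).1 (z := (x, y)) ⟨hx, hy⟩

theorem abs_inv_det_mixedHess_le {x y : Euc n} (hx : x ∈ U) (hy : y ∈ closure V) :
    |((mixedHess c x y).det)⁻¹| ≤ gammaMinus c U V := by
  have hcont := H.continuousOn_det_mixedHess.inv₀
    fun z hz => H.det_mixedHess_ne_zero hz.1 hz.2
  obtain ⟨C, hC⟩ := (H.isCompact_left.prod H.isCompact_right).exists_bound_of_continuousOn hcont
  have hsub : U ×ˢ V ⊆ closure U ×ˢ closure V := prod_mono subset_closure subset_closure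
  have hopen := H.b0.isOpen_left.prod H.b0.isOpen_right
  have hint : ∀ y ∈ V, |((mixedHess c x y).det)⁻¹| ≤ gammaMinus c U V := fun y hy =>
    abs_le_toReal_eLpNorm_top hopen subset_rfl (hcont.mono hsub)
      (toReal_eLpNorm_top_le hopen.measurableSet (abs_nonneg C)
        fun z hz => (hC z (hsub hz)).trans (le_abs_self C)).1 (z := (x, y)) ⟨hx, hy⟩
  have h1 : ContinuousOn (fun y => ((mixedHess c x y).det)⁻¹) (closure V) :=
    hcont.comp (f := fun y => (x, y)) (by fun_prop) fun y hy => ⟨subset_closure hx, hy⟩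
  have h2 := le_on_closure hint h1.abs continuousOn_const hy
  exact h2

theorem mixedHess_modCost (hq : q ∈ coordDomain c U ybar) (hy : ybar ∈ closure V) {y : Euc n}
    (hy' : y ∈ closure V) : mixedHess (modCost c U ybar) q y =
      (mixedHess c (xOf c U ybar q) y).comp (fderiv ℝ (xOf c U ybar) q) := by
  have h1 : ∀ q, gradY (modCost c U ybar) q y = gradY c (xOf c U ybar q) y := fun q => by
    simp only [gradY, modCost, gradient, fderiv_sub_const]
  have h2 := (hasFDerivAt_gradY (H.b0.contDiff _ (subset_closure (H.xOf_mem hq hy)) y hy')).comp q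
    ((H.contDiffAt_xOf hq hy).differentiableAt (by norm_num)).hasFDerivAt
  rw [mixedHess, funext h1]
  exact h2.fderiv

theorem abs_det_fderiv_xOf (hq : q ∈ coordDomain c U ybar) (hy : ybar ∈ closure V) :
    |(fderiv ℝ (xOf c U ybar) q).det| = |((mixedHess c (xOf c U ybar q) ybar).det)⁻¹| := by
  have h1 : (mixedHess c (xOf c U ybar q) ybar).comp (fderiv ℝ (xOf c U ybar) q) =
      -ContinuousLinearMap.id ℝ (Euc n) := by
    ext1 ζ
    exact H.mixedHess_fderiv_xOf hq hy ζ
  have h2 := congrArg (fun A : Euc n →L[ℝ] Euc n => |A.det|) h1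
  simp only [abs_det_neg, det_comp, abs_mul] at h2
  rw [abs_inv]
  refine eq_inv_of_mul_eq_one_right (h2.trans ?_)
  simp [ContinuousLinearMap.det]

theorem abs_det_mixedHess_modCost (hq : q ∈ coordDomain c U ybar) (hy : ybar ∈ closure V)
    {y : Euc n} (hy' : y ∈ closure V) : |(mixedHess (modCost c U ybar) q y).det| =
      |(mixedHess c (xOf c U ybar q) y).det| * |(fderiv ℝ (xOf c U ybar) q).det| := by
  rw [H.mixedHess_modCost hq hy hy', det_comp, abs_mul]

theorem eLpNorm_det_modCost {Q : Set (Euc n)} (hQ : MeasurableSet Q)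
    (hQO : Q ⊆ coordDomain c U ybar) (hy : ybar ∈ closure V) :
    eLpNorm (fun z : Euc n × Euc n => (mixedHess (modCost c U ybar) z.1 z.2).det) ∞
        (volume.restrict (Q ×ˢ V)) ≠ ∞ ∧
      gammaPlus (modCost c U ybar) Q V ≤ gammaPlus c U V * gammaMinus c U V := by
  refine toReal_eLpNorm_top_le (hQ.prod H.b0.isOpen_right.measurableSet)
    (mul_nonneg ENNReal.toReal_nonneg ENNReal.toReal_nonneg) fun z hz => ?_
  have hx := H.xOf_mem (hQO hz.1) hy
  rw [H.abs_det_mixedHess_modCost (hQO hz.1) hy (subset_closure hz.2),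
    H.abs_det_fderiv_xOf (hQO hz.1) hy]
  exact mul_le_mul (H.abs_det_mixedHess_le hx hz.2) (H.abs_inv_det_mixedHess_le hx hy)
    (abs_nonneg _) ENNReal.toReal_nonneg

theorem abs_det_modCost_le {Q : Set (Euc n)} (hQ : MeasurableSet Q)
    (hQO : Q ⊆ coordDomain c U ybar) (hy : ybar ∈ closure V) (hq : q ∈ interior Q) {y : Euc n}
    (hy' : y ∈ V) : |(mixedHess c (xOf c U ybar q) y).det| * |(fderiv ℝ (xOf c U ybar) q).det| ≤
      gammaPlus (modCost c U ybar) Q V := by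
  have hsub := (interior_subset (s := Q)).trans hQO
  rw [← H.abs_det_mixedHess_modCost (hsub hq) hy (subset_closure hy')]
  refine abs_le_toReal_eLpNorm_top (isOpen_interior.prod H.b0.isOpen_right)
    (prod_mono interior_subset subset_rfl) ?_ (H.eLpNorm_det_modCost hQ hQO hy).1
    (z := (q, y)) ⟨hq, hy'⟩
  have h1 : ContinuousOn (fun z : Euc n × Euc n => (mixedHess c (xOf c U ybar z.1) z.2).det *
      (fderiv ℝ (xOf c U ybar) z.1).det) (interior Q ×ˢ V) := by
    have h2 : ContinuousOn (fun z : Euc n × Euc n => (xOf c U ybar z.1, z.2)) (interior Q ×ˢ V) :=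
      ((H.continuousOn_xOf hy).comp continuousOn_fst
        fun z hz => subset_closure (hsub hz.1)).prodMk continuousOn_snd
    have h3 := H.continuousOn_det_mixedHess.comp h2
      fun z hz => ⟨subset_closure (H.xOf_mem (hsub hz.1) hy), subset_closure hz.2⟩
    have h4 : ContinuousOn (fun q => (fderiv ℝ (xOf c U ybar) q).det) (interior Q) := fun q hq =>
      (ContinuousLinearMap.continuous_det.continuousAt.comp
        ((H.contDiffAt_xOf (hsub hq) hy).fderiv_right (m := 2)
          (by norm_num)).continuousAt).continuousWithinAt
    exact h3.mul (h4.comp continuousOn_fst fun z hz => hz.1)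
  refine h1.congr fun z hz => ?_
  beta_reduce
  rw [H.mixedHess_modCost (hsub hz.1) hy (subset_closure hz.2), det_comp]

/-- The boundary part of `closure V` is mapped into the boundary of the convex set `-D_x c(x, V)`. -/
theorem volume_image_pMap_boundary {x : Euc n} (hx : x ∈ closure U) :
    volume (pMap c x '' (closure V \ V)) = 0 := by
  refine measure_mono_null ?_ (Convex.addHaar_frontier volume (H.b2.right x hx))
  rintro _ ⟨y, ⟨hy, hyV⟩, rfl⟩
  have hopen : IsOpen (pMap c x '' V) := H.flip.isOpen_coordDomain hx
  refine ⟨?_, ?_⟩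
  · have h : closure (pMap c x '' V) = pMap c x '' closure V := H.flip.closure_coordDomain hx
    rw [h]
    exact ⟨y, hy, rfl⟩
  · rw [hopen.interior_eq]
    rintro ⟨y', hy', h⟩
    exact hyV (H.flip.injOn_qMap hx (subset_closure hy') hy h ▸ hy')

theorem volume_image_pMap_le {x : Euc n} (hx : x ∈ closure U) {b : ℝ}
    (hb : ∀ y ∈ V, |(mixedHess c x y).det| ≤ b) {Y : Set (Euc n)} (hY : MeasurableSet Y)
    (hYV : Y ⊆ closure V) : volume (pMap c x '' Y) ≤ ENNReal.ofReal b * volume Y := by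
  have hYm := hY.inter H.b0.isOpen_right.measurableSet
  have h1 : pMap c x '' Y ⊆ pMap c x '' (Y ∩ V) ∪ pMap c x '' (closure V \ V) := by
    rw [← image_union]
    refine image_mono fun y hy => ?_
    by_cases hyV : y ∈ V
    · exact Or.inl ⟨hy, hyV⟩
    · exact Or.inr ⟨hYV hy, hyV⟩
  calc volume (pMap c x '' Y)
      ≤ volume (pMap c x '' (Y ∩ V)) + volume (pMap c x '' (closure V \ V)) :=
        (measure_mono h1).trans (measure_union_le _ _)
    _ = volume (pMap c x '' (Y ∩ V)) := by rw [H.volume_image_pMap_boundary hx, add_zero]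
    _ ≤ ∫⁻ y in Y ∩ V, ENNReal.ofReal |(-mixedHess (flipCost c) y x).det| :=
        addHaar_image_le_lintegral_abs_det_fderiv volume hYm fun y hy =>
          (H.hasFDerivAt_pMap hx (subset_closure hy.2)).hasFDerivWithinAt
    _ ≤ ∫⁻ _y in Y ∩ V, ENNReal.ofReal b := by
        refine setLIntegral_mono measurable_const fun y hy => ENNReal.ofReal_le_ofReal ?_
        rw [abs_det_neg, mixedHess_flipCost (H.b0.contDiff x hx y (subset_closure hy.2)),
          det_adjoint]
        exact hb y hy.2
    _ = ENNReal.ofReal b * volume (Y ∩ V) := setLIntegral_const _ _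
    _ ≤ ENNReal.ofReal b * volume Y := by gcongr; exact inter_subset_left

/-- The gradient map `y ↦ -D_q c̃(q, y)` expands volumes at most by the factor `γ⁺`; the part of
`Y` on the boundary of `V`, where `γ⁺` says nothing, is mapped into the boundary of a convex set. -/
theorem volume_image_chartGrad_le {Q : Set (Euc n)} (hQ : MeasurableSet Q)
    (hQO : Q ⊆ coordDomain c U ybar) (hy : ybar ∈ closure V) (hq : q ∈ interior Q)
    {Y : Set (Euc n)} (hY : MeasurableSet Y) (hYV : Y ⊆ closure V) :
    volume (chartGrad c U ybar q '' Y) ≤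
      ENNReal.ofReal (gammaPlus (modCost c U ybar) Q V) * volume Y := by
  have hqO := hQO (interior_subset hq)
  have hx := subset_closure (H.xOf_mem hqO hy)
  set X := fderiv ℝ (xOf c U ybar) q with hX
  set x := xOf c U ybar q with hxd
  have hdet : 0 < |X.det| := by
    rw [hX, H.abs_det_fderiv_xOf hqO hy, abs_pos]
    exact inv_ne_zero (H.det_mixedHess_ne_zero hx hy)
  have h1 : chartGrad c U ybar q '' Y = ContinuousLinearMap.adjoint X ''
      ((fun p => p - pMap c x ybar) '' (pMap c x '' Y)) := by
    rw [image_image, image_image]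
    rfl
  have h2 := H.volume_image_pMap_le hx (b := gammaPlus (modCost c U ybar) Q V / |X.det|)
    (fun y hy' => by
      rw [le_div_iff₀ hdet]
      exact H.abs_det_modCost_le hQ hQO hy hq hy') hY hYV
  rw [h1, Measure.addHaar_image_continuousLinearMap]
  change ENNReal.ofReal |(ContinuousLinearMap.adjoint X).det| * _ ≤ _
  simp only [sub_eq_add_neg, image_add_right, measure_preimage_add_right]
  rw [det_adjoint]
  calc _ ≤ ENNReal.ofReal |X.det| * (ENNReal.ofReal (gammaPlus (modCost c U ybar) Q V / |X.det|) *
        volume Y) := by gcongr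
    _ = _ := by
      rw [← mul_assoc, ← ENNReal.ofReal_mul hdet.le, mul_div_cancel₀ _ hdet.ne']

end RegCost

/-! ### Supports of `c`-convex functions -/

theorem supports_subset_cSubdiff {X Y : Set (Euc n)} {c : Euc n → Euc n → ℝ} {u : Euc n → ℝ}
    {q : Euc n} (hq : q ∈ X) :
    supports X Y (fun q y => -c q y) u q ⊆ cSubdiff X Y c u q := by
  rintro y ⟨hy, h⟩
  refine ⟨hq, hy, ?_⟩
  have h1 : cStar X c u y = -c q y - u q := by
    refine IsGreatest.csSup_eq ⟨⟨q, hq, rfl⟩, ?_⟩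
    rintro _ ⟨q', hq', rfl⟩
    have := h q' hq'
    beta_reduce at *
    linarith
  rw [h1]; ring

/-- The supremum in the definition of `c`-convexity is attained, because `cStar` is lower
semicontinuous; a maximizer supports `u`. -/
theorem IsCConvex.nonempty_supports {X Y : Set (Euc n)} {c : Euc n → Euc n → ℝ} {u : Euc n → ℝ}
    (h : IsCConvex X Y c u) (hY : IsCompact Y) (hY0 : Y.Nonempty)
    (hc : ContinuousOn (Function.uncurry c) (X ×ˢ Y)) {q : Euc n} (hq : q ∈ X) :
    (supports X Y (fun q y => -c q y) u q).Nonempty := by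
  have hcq : ∀ q ∈ X, ContinuousOn (fun y => -c q y) Y := fun q hq =>
    (hc.comp (f := fun y => (q, y)) (by fun_prop) fun y hy => ⟨hq, hy⟩).neg
  have hle : ∀ q ∈ X, ∀ y ∈ Y, -c q y - u q ≤ cStar X c u y := fun q hq y hy =>
    le_csSup (h.1 y hy) ⟨q, hq, rfl⟩
  have hlsc : LowerSemicontinuousOn (cStar X c u) Y := by
    intro y hy a ha
    obtain ⟨_, ⟨q', hq', rfl⟩, hq'a⟩ := exists_lt_of_lt_csSup (Set.Nonempty.image _ ⟨q, hq⟩) ha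
    have hev := ((hcq q' hq' y hy).sub continuousWithinAt_const).eventually (lt_mem_nhds hq'a)
    filter_upwards [hev, self_mem_nhdsWithin] with y' h1 h2
    exact h1.trans_le (hle q' hq' y' h2)
  obtain ⟨y, hy, hmax⟩ := ((hcq q hq).upperSemicontinuousOn.add hlsc.neg).exists_isMaxOn hY0 hY
  have h1 : u q ≤ -c q y - cStar X c u y := by
    refine (h.2 q hq).2 ?_
    rintro _ ⟨y', hy', rfl⟩
    have h2 := isMaxOn_iff.1 hmax y' hy'
    simpa only [Pi.neg_apply, ← sub_eq_add_neg] using h2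
  refine ⟨y, hy, fun q' hq' => ?_⟩
  have := hle q' hq' y hy
  linarith

namespace RegCost

variable {U V : Set (Euc n)} {c : Euc n → Euc n → ℝ} (H : RegCost U V c) {ybar : Euc n}
include H

theorem nonempty_supports {u : Euc n → ℝ} (hy : ybar ∈ closure V)
    (hu : IsCConvex (closure (coordDomain c U ybar)) (closure V) (modCost c U ybar) u) :
    ∀ q ∈ closure (coordDomain c U ybar), (supports (closure (coordDomain c U ybar)) (closure V)
      (fun q y => -modCost c U ybar q y) u q).Nonempty := fun _ hq =>
  hu.nonempty_supports H.isCompact_right ⟨ybar, hy⟩ (H.continuousOn_modCost hy) hq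

/-- The volume of the gradients of the supports of the cone with vertex `q₁` over `Q`. -/
theorem volume_grad_coneSupports_le {K : ℝ} (hy : ybar ∈ closure V)
    (hS : CostChart (coordDomain c U ybar) (closure V) (fun q y => -modCost c U ybar q y)
      (chartGrad c U ybar) ybar K) {u : Euc n → ℝ} {lam : ℝ} (hlam : 0 < lam) {Q : Set (Euc n)}
    (hu : IsCConvex (closure (coordDomain c U ybar)) (closure V) (modCost c U ybar) u)
    (hQ : IsCompact Q) (hQO : Q ⊆ coordDomain c U ybar) (hfr : ∀ q ∈ frontier Q, u q = 0)
    (hMA : cMongeAmpere (closure (coordDomain c U ybar)) (closure V) (modCost c U ybar) u Q ≤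
      ENNReal.ofReal (1 / lam) * volume Q) {q₁ : Euc n} (hq₁ : q₁ ∈ Q) (hneg : u q₁ < 0) :
    volume (chartGrad c U ybar q₁ ''
        coneSupports Q (closure V) (fun q y => -modCost c U ybar q y) u q₁) ≤
      ENNReal.ofReal (gammaPlus (modCost c U ybar) Q V / lam * volume.real Q) := by
  have hQX := hQO.trans subset_closure
  have hint : q₁ ∈ interior Q := by
    by_contra h
    have := hfr q₁ ⟨subset_closure hq₁, h⟩
    linarith
  have h1 := H.volume_image_chartGrad_le hQ.measurableSet hQO hy hint
    (hS.isClosed_coneSupports (u := u) hQX (hQX hq₁)).measurableSet fun y hy => hy.1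
  have h2 : volume (coneSupports Q (closure V) (fun q y => -modCost c U ybar q y) u q₁) ≤
      ENNReal.ofReal (1 / lam) * volume Q := by
    refine le_trans (measure_mono ?_) hMA
    refine (hS.coneSupports_subset (H.nonempty_supports hy hu) hQ hQO hfr hq₁ hneg).trans ?_
    exact iUnion₂_mono fun q hq => supports_subset_cSubdiff (hQX hq)
  have hg : 0 ≤ gammaPlus (modCost c U ybar) Q V := ENNReal.toReal_nonneg
  calc _ ≤ _ := h1
    _ ≤ ENNReal.ofReal (gammaPlus (modCost c U ybar) Q V) *
        (ENNReal.ofReal (1 / lam) * ENNReal.ofReal (volume.real Q)) := by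
      rw [ofReal_measureReal hQ.measure_lt_top.ne]
      gcongr
    _ = _ := by
      rw [← ENNReal.ofReal_mul (by positivity), ← ENNReal.ofReal_mul hg]
      congr 1
      ring

end RegCost

/-! ### The height estimate -/

/-- The height of `u` below zero at `q₁`, in terms of the widths `d i` of `Q` beyond `q₁` in `n`
independent directions and of the volume of the gradients of the cone with vertex `q₁`. -/
theorem exists_height_estimate (hn : 1 ≤ n) : ∃ θ C : ℝ, 0 < θ ∧ 0 < C ∧
    ∀ (O B : Set (Euc n)) (F : Euc n → Euc n → ℝ) (G : Euc n → Euc n → Euc n) (ybar : Euc n)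
      (K : ℝ), CostChart O B F G ybar K → ∀ (u : Euc n → ℝ) (Q : Set (Euc n)),
      (∀ q ∈ closure O, (supports (closure O) B F u q).Nonempty) →
      Q = {q | q ∈ closure O ∧ u q ≤ 0} → (∀ q ∈ frontier Q, u q = 0) →
      ∀ (z : Euc n) (r : ℝ), Q ⊆ Metric.ball z r → Metric.ball z (4 * r) ⊆ O →
      ∀ ε : ℝ, (∀ q ∈ Q, ∀ q' ∈ Q, ‖q - q'‖ ≤ ε) → K * ε ≤ θ →
      ∀ (q₁ : Euc n) (W : ℝ), q₁ ∈ Q → u q₁ < 0 → 0 ≤ W →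
      volume (G q₁ '' coneSupports Q B F u q₁) ≤ ENNReal.ofReal W →
      ∀ (b : OrthonormalBasis (Fin n) ℝ (Euc n)) (v : Fin n → Euc n) (d : Fin n → ℝ),
      (∀ i, ‖v i‖ = 1) → 1 / √n ≤ |(coordMatrix b v).det| →
      (∀ i, ∀ q ∈ Q, ⟪v i, q - q₁⟫_ℝ ≤ d i) → |u q₁| ^ n ≤ C * (∏ i, d i) * W := by
  obtain ⟨θ, C, hθ, hθ2, hC, hvol⟩ := exists_volume_estimate hn
  refine ⟨θ, C, hθ, hC, ?_⟩
  intro O B F G ybar K S u Q hu hQ hfr z r hQz hzO ε hdiam hKε q₁ W hq₁ hneg hW hWv b v d hv hdet hd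
  have hex := fun i => S.exists_coneSupport_direction hu hQ hfr hQz hzO hdiam hKε hθ2 hq₁ hneg (hv i)
    (hd i)
  choose y hy k hk hGk hkd using hex
  have hQX : Q ⊆ closure O := by rw [hQ]; exact fun q hq => hq.1
  have hq₁O : q₁ ∈ O := by
    refine hzO (Metric.ball_subset_ball ?_ (hQz hq₁))
    have := dist_nonneg.trans_lt (Metric.mem_ball.1 (hQz hq₁))
    linarith
  have h0 : (0 : Euc n) ∈ G q₁ '' coneSupports Q B F u q₁ :=
    ⟨ybar, S.ybar_mem_coneSupports hneg.le, S.grad_ybar hq₁O⟩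
  have h1 := hvol b v (fun i => G q₁ (y i)) _ k d (-u q₁) hv hdet
    (S.convex_grad_coneSupports hQX hq₁O) h0 (fun i => ⟨y i, hy i, rfl⟩) hk hGk (by linarith) hkd
  have hdnn : 0 ≤ ∏ i, d i := by
    refine Finset.prod_nonneg fun i _ => ?_
    have := hd i q₁ hq₁
    rwa [sub_self, inner_zero_right] at this
  have h2 : ENNReal.ofReal ((-u q₁) ^ n) ≤ ENNReal.ofReal (C * (∏ i, d i) * W) := by
    refine h1.trans ?_
    rw [ENNReal.ofReal_mul (p := C * ∏ i, d i) (by positivity)]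
    exact mul_le_mul' le_rfl hWv
  rw [abs_of_neg hneg]
  exact (ENNReal.ofReal_le_ofReal_iff (by positivity)).1 h2

/-- The product of the widths in the axes of a box, one of them replaced by a tilted direction. -/
theorem exists_tilted_widths (hn : 1 ≤ n) {Q : Set (Euc n)}
    {b : OrthonormalBasis (Fin n) ℝ (Euc n)}
    {a : Fin n → ℝ} (ha : ∀ i, 0 < a i) {z : Euc n} (hbox : InBox Q b a z n) {q₁ : Euc n}
    (hq₁ : q₁ ∈ Q) {j : Fin n} {e : Euc n} (he : ‖e‖ = 1) {σ : ℝ}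
    (hsup : ∀ q ∈ Q, ⟪e, q - q₁⟫_ℝ ≤ 3 * n * n * σ * a j) :
    ∃ d : Fin n → ℝ, (∀ i, ‖Function.update b j e i‖ = 1) ∧
      (∀ i, ∀ q ∈ Q, ⟪Function.update b j e i, q - q₁⟫_ℝ ≤ d i) ∧
      ∏ i, d i = (3 * (n : ℝ) ^ 2) ^ n * (∏ i, a i) * σ := by
  have hn1 : (1 : ℝ) ≤ n := by exact_mod_cast hn
  refine ⟨fun i => 3 * (n : ℝ) ^ 2 * a i * (if i = j then σ else 1), fun i => ?_,
    fun i q hq => ?_, ?_⟩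
  · rcases eq_or_ne i j with rfl | hi
    · simpa using he
    · simp [hi]
  · rcases eq_or_ne i j with rfl | hi
    · simp only [Function.update_self, if_true]
      refine (hsup q hq).trans_eq ?_
      ring
    · simp only [Function.update_of_ne hi, if_neg hi, mul_one]
      refine (le_abs_self _).trans ((inBox_inner_le hbox hq hq₁ i).trans ?_)
      have := ha i
      gcongr
      · norm_num
      · nlinarith
  · rw [Finset.prod_mul_distrib, Finset.prod_mul_distrib, Finset.prod_ite_eq']
    simp

theorem le_rpow_one_div_two_pow (hn : 1 ≤ n) {τ : ℝ} (h0 : 0 < τ) (h1 : τ ≤ 1) :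
    τ ^ ((1 : ℝ) / n) ≤ τ ^ ((1 : ℝ) / 2 ^ (n - 1)) := by
  refine Real.rpow_le_rpow_of_exponent_ge h0 h1 ?_
  have h2 : n ≤ 2 ^ (n - 1) := by
    have := Nat.lt_two_pow_self (n := n - 1)
    omega
  have hn0 : (0 : ℝ) < n := by exact_mod_cast hn
  exact one_div_le_one_div_of_le hn0 (by exact_mod_cast h2)

end

end OT

open OT

theorem mainTheorem8 (n : ℕ) (hn : 1 ≤ n) :
    ∃ C : ℝ, 0 < C ∧
      ∀ (U V : Set (Euc n)) (c : Euc n → Euc n → ℝ),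
        OT.B0 U V c → OT.B1 U V c → OT.B2 U V c → OT.B3 U V c →
        ∃ ε : ℝ, 0 < ε ∧
          ∀ ybar ∈ closure V, ∀ (u : Euc n → ℝ) (lam : ℝ) (Q : Set (Euc n)),
            OT.IsCConvex (closure (OT.coordDomain c U ybar)) (closure V)
              (OT.modCost c U ybar) u →
            0 < lam →
            Q = OT.zeroSection (closure (OT.coordDomain c U ybar)) u →
            (∀ q ∈ frontier Q, u q = 0) →
            (∀ S ⊆ Q, MeasurableSet S →
              OT.cMongeAmpere (closure (OT.coordDomain c U ybar)) (closure V)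
                (OT.modCost c U ybar) u S ≤ ENNReal.ofReal (1 / lam) * volume S) →
            (∃ (z : Euc n) (r : ℝ), Q ⊆ Metric.ball z r ∧
              Metric.ball z (4 * r) ⊆ OT.coordDomain c U ybar) →
            Metric.diam Q ≤ ε →
            (∀ (L : Euc n ≃ᵃ[ℝ] Euc n), OT.IsJohnEllipsoid L Q →
              ∀ t : ℝ, 1 / (2 * (n : ℝ)) < t → t ≤ 1 →
                ∀ q ∈ Q, q ∈ AffineMap.homothety (L 0) t '' frontier Q →
                  |u q| ^ n ≤ C * (OT.gammaPlus (OT.modCost c U ybar) Q V / lam) *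
                    (1 - t) ^ ((1 : ℝ) / 2 ^ (n - 1)) * volume.real Q ^ 2) ∧
            |sInf (u '' Q)| ^ n ≤
              C * (OT.gammaPlus (OT.modCost c U ybar) Q V / lam) * volume.real Q ^ 2 ∧
            OT.gammaPlus (OT.modCost c U ybar) Q V ≤
              OT.gammaPlus c U V * OT.gammaMinus c U V := by
  obtain ⟨θ, C₀, hθ, hC₀, hest⟩ := exists_height_estimate hn
  have hn0 : (0 : ℝ) < n := by exact_mod_cast hn
  have hn' : n ≠ 0 := by omega
  set β := volume.real (Metric.closedBall (0 : Euc n) 1) with hβ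
  have hβ0 : 0 < β :=
    ENNReal.toReal_pos (Metric.measure_closedBall_pos volume 0 one_pos).ne'
      measure_closedBall_lt_top.ne
  -- the constants for the estimates near the boundary and of the infimum
  set C₁ := C₀ * ((3 * (n : ℝ) ^ 2) ^ n / β) with hC₁
  set C₂ := C₀ * ((2 * √n) ^ n * (n : ℝ) ^ n) with hC₂
  have hC₁0 : 0 < C₁ := by positivity
  have hC₂0 : 0 < C₂ := by positivity
  refine ⟨C₁ + C₂, by positivity, fun U V c h0 h1 h2 h3 => ?_⟩
  have H : RegCost U V c := ⟨h0, h1, h2⟩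
  obtain ⟨K, hK⟩ := H.exists_costChart h3
  have hKε : K * (θ / (|K| + 1)) ≤ θ := by
    rw [mul_div_assoc', div_le_iff₀ (by positivity)]
    nlinarith [le_abs_self K]
  refine ⟨θ / (|K| + 1), by positivity, ?_⟩
  rintro ybar hy u lam Q hu hlam hQ hfr hMA ⟨z, r, hQz, hzO⟩ hdiam
  have S := hK ybar hy
  have hsup := H.nonempty_supports hy hu
  have hQbdd : Bornology.IsBounded Q := Metric.isBounded_ball.subset hQz
  have hQcl : IsClosed Q := by rw [hQ]; exact S.isClosed_sublevel hsup
  have hQcomp : IsCompact Q := Metric.isCompact_of_isClosed_isBounded hQcl hQbdd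
  have hQconv : Convex ℝ Q := by rw [hQ]; exact S.convex_sublevel hsup
  have hQO : Q ⊆ coordDomain c U ybar := fun q hq => by
    refine hzO (Metric.ball_subset_ball ?_ (hQz hq))
    have := dist_nonneg.trans_lt (Metric.mem_ball.1 (hQz hq))
    linarith
  have hdist : ∀ q ∈ Q, ∀ q' ∈ Q, ‖q - q'‖ ≤ θ / (|K| + 1) := fun q hq q' hq' => by
    rw [← dist_eq_norm]
    exact (Metric.dist_le_diam_of_mem hQbdd hq hq').trans hdiam
  have hle0 : ∀ q ∈ Q, u q ≤ 0 := fun q hq => by rw [hQ] at hq; exact hq.2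
  have hint : ∀ q ∈ Q, u q < 0 → q ∈ interior Q := fun q hq hneg => by
    by_contra h
    have := hfr q ⟨subset_closure hq, h⟩
    linarith
  have hγ : 0 ≤ gammaPlus (modCost c U ybar) Q V := ENNReal.toReal_nonneg
  set W := gammaPlus (modCost c U ybar) Q V / lam * volume.real Q with hW
  have hW0 : 0 ≤ W := by positivity
  have hvol : ∀ q ∈ Q, u q < 0 → _ := fun q hq hneg =>
    H.volume_grad_coneSupports_le hy S hlam hu hQcomp hQO hfr (hMA Q subset_rfl hQcl.measurableSet)
      hq hneg
  have key := fun (q : Euc n) (hq : q ∈ Q) (hneg : u q < 0) =>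
    hest _ _ _ _ _ _ S u Q hsup hQ hfr z r hQz hzO _ hdist hKε q W hq hneg hW0 (hvol q hq hneg)
  refine ⟨fun L hL t ht ht1 q hq hqt => ?_, ?_, (H.eLpNorm_det_modCost hQcl.measurableSet hQO hy).2⟩
  · have ht0 : 0 < t := lt_trans (by positivity) ht
    rcases (hle0 q hq).eq_or_lt with huq | huq
    · rw [huq, abs_zero, zero_pow hn']
      have := Real.rpow_nonneg (sub_nonneg.2 ht1) ((1 : ℝ) / 2 ^ (n - 1))
      positivity
    obtain ⟨p, hp, rfl⟩ := hqt
    have hpQ : p ∈ Q := hQcl.frontier_subset hp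
    -- for `t = 1` the point would lie on the boundary, where `u` vanishes
    have hτ : 0 < 1 - t := by
      refine sub_pos.2 (lt_of_le_of_ne ht1 ?_)
      rintro rfl
      rw [AffineMap.homothety_one, AffineMap.id_apply] at huq
      exact huq.ne (hfr p hp)
    set σ := (1 - t) ^ ((1 : ℝ) / n) with hσ
    have hσ0 : 0 < σ := Real.rpow_pos_of_pos hτ _
    have hσ1 : σ ≤ 1 := Real.rpow_le_one hτ.le (by linarith) (by positivity)
    have hσn : σ ^ n = 1 - t := by
      rw [hσ, one_div, Real.rpow_inv_natCast_pow hτ.le hn']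
    obtain ⟨b, a, ha, hbox, hvolE⟩ := exists_box_of_isJohnEllipsoid hQcomp hL
    obtain ⟨e, he, hnormal⟩ := exists_supporting_normal hQconv ⟨_, hint _ hq huq⟩ hp
    obtain ⟨j, e', he', hje', hslab⟩ := exists_tilted_normal ha hn0.le hbox hpQ hq he hnormal hσ0 hσ1
      (by
        rw [hσn, AffineMap.homothety_apply, vsub_eq_sub, vadd_eq_add]
        module)
    obtain ⟨d, hv, hd, hprod⟩ := exists_tilted_widths hn ha hbox hq he' hslab
    have h4 := key _ hq huq b _ d hv (by rwa [det_coordMatrix_update]) hd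
    have h5 : ∏ i, a i ≤ volume.real Q / β := (le_div_iff₀ hβ0).2 hvolE
    have h6 : σ ≤ (1 - t) ^ ((1 : ℝ) / 2 ^ (n - 1)) :=
      le_rpow_one_div_two_pow hn hτ (by linarith)
    calc _ ≤ C₀ * (∏ i, d i) * W := h4
      _ ≤ C₀ * ((3 * (n : ℝ) ^ 2) ^ n * (volume.real Q / β) *
          (1 - t) ^ ((1 : ℝ) / 2 ^ (n - 1))) * W := by
        rw [hprod]
        gcongr
      _ = C₁ * (gammaPlus (modCost c U ybar) Q V / lam) * (1 - t) ^ ((1 : ℝ) / 2 ^ (n - 1)) *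
          volume.real Q ^ 2 := by
        rw [hC₁, hW]; ring
      _ ≤ _ := by
        gcongr
        linarith
  · rcases Q.eq_empty_or_nonempty with hemp | hne
    · rw [hemp, image_empty, Real.sInf_empty, abs_zero, zero_pow hn', ← hemp]
      positivity
    obtain ⟨q, hq, hmin⟩ := ((S.lowerSemicontinuousOn hsup).mono
      (hQO.trans subset_closure)).exists_isMinOn hne hQcomp
    have hinf : sInf (u '' Q) = u q :=
      IsLeast.csInf_eq ⟨⟨q, hq, rfl⟩, by rintro _ ⟨q', hq', rfl⟩; exact hmin hq'⟩
    rw [hinf]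
    rcases (hle0 q hq).eq_or_lt with huq | huq
    · rw [huq, abs_zero, zero_pow hn']
      positivity
    obtain ⟨b, a, z', ha, hbox, hvolE⟩ := exists_box hn hQcomp hQconv ⟨q, hint q hq huq⟩
    have h4 := key q hq huq b b (fun i => 2 * √n * a i) b.norm_eq_one
      (by
        rw [coordMatrix_self, Matrix.det_one, abs_one, div_le_one (Real.sqrt_pos.2 hn0)]
        exact Real.one_le_sqrt.2 (by exact_mod_cast hn))
      fun i q' hq' => (le_abs_self _).trans (inBox_inner_le hbox hq' hq i)
    calc _ ≤ C₀ * (∏ i, 2 * √n * a i) * W := h4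
      _ ≤ C₀ * ((2 * √n) ^ n * ((n : ℝ) ^ n * volume.real Q)) * W := by
        rw [Finset.prod_mul_distrib, Finset.prod_const, Finset.card_univ, Fintype.card_fin]
        gcongr
      _ = C₂ * (gammaPlus (modCost c U ybar) Q V / lam) * volume.real Q ^ 2 := by
        rw [hC₂, hW]; ring
      _ ≤ _ := by
        gcongr
        linarith
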